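/- Let $d\ge 1$. For $f\in\mathcal S'(\mathbb R^n)$ and a window $g\in\mathcal S(\mathbb R^n)$, $g\neq 0$, let $V_gf(x,\xi)=\langle f, M_\xi T_x g\rangle=\int f(t)\,\overline{g(t-x)}\,e^{-2\pi i\xi\cdot t}\,dt$ be the short-time Fourier transform. For $p,q\in[1,\infty]$ and a weight $m>0$ on $\mathbb R^{2n}$ put $$\|f\|_{M^{p,q}_m(\mathbb R^n)}=\Big\|\ \xi\mapsto\big\|V_gf(\cdot,\xi)\,m(\cdot,\xi)\big\|_{L^p(\mathbb R^n)}\Big\|_{L^q(\mathbb R^n)},\qquad M^{p,q}_m(\mathbb R^n)=\{f\in\mathcal S'(\mathbb R^n):\|f\|_{M^{p,q}_m}<\infty\},$$ and write $M^{p,q}$ for $m\equiv1$. Fix nonzero windows in $\mathcal S(\mathbb R^d)$ and in $\mathcal S(\mathbb R^{2d})$ to define the norms on $\mathbb R^d$ and on $\mathbb R^{2d}$; the statement holds for every choice of them (the constants may depend on the choice). For $s\in\mathbb R$ let $v_s(z)=(1+|z|^2)^{s/2}$, $z\in\mathbb R^{2d}$, and $(1\otimes v_s)(z,\zeta)=v_s(\zeta)$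 for $z,\zeta\in\mathbb R^{2d}$. Let $$W(f_1,f_2)(x,\xi)=\int_{\mathbb R^d}f_1\big(x+\tfrac t2\big)\,\overline{f_2\big(x-\tfrac t2\big)}\,e^{-2\pi i\xi\cdot t}\,dt$$ be the cross-Wigner distribution, extended to $f_1,f_2\in\mathcal S'(\mathbb R^d)$ as the tempered distribution on $\mathbb R^{2d}$ given by $\langle W(f_1,f_2),\Psi\rangle=\langle f_1\otimes\overline{f_2},K_\Psi\rangle$ (bilinear pairings) with $K_\Psi(u,v)=\int\Psi\big(\tfrac{u+v}2,\xi\big)e^{-2\pi i\xi\cdot(u-v)}\,d\xi$. Let $p_1,q_1,p_2,q_2,p,q\in[1,\infty]$ (with $1/\infty=0$), and consider the conditions $$p_1,q_1,p_2,q_2\le q \tag{1}$$ $$\frac1{p_1}+\frac1{p_2}\ge\frac1p+\frac1q,\qquad \frac1{q_1}+\frac1{q_2}\ge\frac1p+\frac1q. \tag{2}$$ (Sufficiency.) If (1) and (2) hold and $s\in\mathbb R$, then there is a constant $C$ such that for all $f_1\in M^{p_1,q_1}_{v_{|s|}}(\mathbb R^d)$ and $f_2\in M^{p_2,q_2}_{v_s}(\mathbb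 R^d)$ one has $W(f_1,f_2)\in M^{p,q}_{1\otimes v_s}(\mathbb R^{2d})$ and $$\|W(f_1,f_2)\|_{M^{p,q}_{1\otimes v_s}}\le C\,\|f_1\|_{M^{p_1,q_1}_{v_{|s|}}}\,\|f_2\|_{M^{p_2,q_2}_{v_s}}.$$ (Necessity.) Conversely, if there is a constant $C$ such that $$\|W(f_1,f_2)\|_{M^{p,q}}\le C\,\|f_1\|_{M^{p_1,q_1}}\,\|f_2\|_{M^{p_2,q_2}}\qquad\text{for all } f_1,f_2\in\mathcal S(\mathbb R^d),$$ then (1) and (2) hold. -/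

import Mathlib

open SchwartzMap MeasureTheory
open scoped ENNReal NNReal

namespace TFA

open scoped ContDiff LineDeriv

section Calculus

variable {D : Type*} [NormedAddCommGroup D] [NormedSpace ℝ D]
variable {V : Type*} [NormedAddCommGroup V] [NormedSpace ℝ V]

/-- A criterion for operators from a Schwartz space to functions on a finite-dimensional space:
if a class of operators has rapidly decreasing values and is stable under directional derivatives
along a basis, then its members take values in Schwartz functions, with seminorm bounds. -/
theorem smooth_and_bounds {ι : Type*} [Fintype ι] [FiniteDimensional ℝ V]
    (b : Module.Basis ι ℝ V) (𝒪 : Set (𝓢(D, ℂ) → V → ℂ))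
    (h1 : ∀ T ∈ 𝒪, ∀ Φ, Differentiable ℝ (T Φ))
    (h2 : ∀ T ∈ 𝒪, ∀ i, ∃ T' ∈ 𝒪, ∀ Φ v, fderiv ℝ (T Φ) v (b i) = T' Φ v)
    (h3 : ∀ T ∈ 𝒪, ∀ k : ℕ, ∃ (s : Finset (ℕ × ℕ)) (C : ℝ), 0 ≤ C ∧ ∀ (Φ : 𝓢(D, ℂ)) (v : V),
      ‖v‖ ^ k * ‖T Φ v‖ ≤ C * s.sup (schwartzSeminormFamily ℂ D ℂ) Φ) (n : ℕ) :
    ∀ T ∈ 𝒪, (∀ Φ, ContDiff ℝ n (T Φ)) ∧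
      ∀ k : ℕ, ∃ (s : Finset (ℕ × ℕ)) (C : ℝ), 0 ≤ C ∧ ∀ (Φ : 𝓢(D, ℂ)) (v : V),
      ‖v‖ ^ k * ‖iteratedFDeriv ℝ n (T Φ) v‖ ≤
        C * s.sup (schwartzSeminormFamily ℂ D ℂ) Φ := by
  induction n with
  | zero =>
    intro T hT
    refine ⟨fun Φ => ?_, fun k => ?_⟩
    · exact contDiff_zero.2 (h1 T hT Φ).continuous
    · simpa using h3 T hT k
  | succ n ih =>
    intro T hT
    choose T' hT' hd using h2 T hT
    let R : ι → ℂ →L[ℝ] (V →L[ℝ] ℂ) := fun i =>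
      ContinuousLinearMap.smulRightL ℝ V ℂ (LinearMap.toContinuousLinearMap (b.coord i))
    have hf : ∀ Φ, fderiv ℝ (T Φ) = fun v => ∑ i, (R i ∘ T' i Φ) v := by
      intro Φ
      funext v
      refine ContinuousLinearMap.coe_injective (b.ext fun j => ?_)
      classical
      simp only [R, ContinuousLinearMap.coe_coe, hd, Function.comp_apply,
        sum_apply, ContinuousLinearMap.smulRightL_apply_apply,
        ContinuousLinearMap.smulRight_apply, LinearMap.coe_toContinuousLinearMap',
        Module.Basis.coord_apply, Module.Basis.repr_self, Finsupp.single_apply]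
      simp
    have hc : ∀ Φ i, ContDiff ℝ n (R i ∘ T' i Φ) := fun Φ i =>
      (R i).contDiff.comp ((ih _ (hT' i)).1 Φ)
    refine ⟨fun Φ => ?_, fun k => ?_⟩
    · rw [Nat.cast_add, Nat.cast_one, contDiff_succ_iff_fderiv]
      refine ⟨h1 T hT Φ, by simp, ?_⟩
      rw [hf]
      exact ContDiff.sum fun i _ => hc Φ i
    · choose s C hC hb using fun i => (ih _ (hT' i)).2 k
      refine ⟨Finset.univ.biUnion s, ∑ i, ‖R i‖ * C i,
        Finset.sum_nonneg fun i _ => mul_nonneg (norm_nonneg (R i)) (hC i), fun Φ v => ?_⟩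
      rw [← norm_iteratedFDeriv_fderiv, hf, iteratedFDeriv_sum fun i _ => hc Φ i,
        Finset.sum_apply, Finset.sum_mul]
      calc ‖v‖ ^ k * ‖∑ i, iteratedFDeriv ℝ n (R i ∘ T' i Φ) v‖
          ≤ ‖v‖ ^ k * ∑ i, ‖R i‖ * ‖iteratedFDeriv ℝ n (T' i Φ) v‖ := by
            gcongr
            refine (norm_sum_le _ _).trans (Finset.sum_le_sum fun i _ => ?_)
            exact (R i).norm_iteratedFDeriv_comp_left ((ih _ (hT' i)).1 Φ).contDiffAt le_rfl
        _ = ∑ i, ‖R i‖ * (‖v‖ ^ k * ‖iteratedFDeriv ℝ n (T' i Φ) v‖) := by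
            rw [Finset.mul_sum]
            exact Finset.sum_congr rfl fun i _ => by ring
        _ ≤ _ := by
            refine Finset.sum_le_sum fun i _ => ?_
            rw [mul_assoc]
            refine mul_le_mul_of_nonneg_left ((hb i Φ v).trans ?_) (norm_nonneg (R i))
            refine mul_le_mul_of_nonneg_left ?_ (hC i)
            exact Finset.sup_mono (f := schwartzSeminormFamily ℂ D ℂ)
              (Finset.subset_biUnion_of_mem s (Finset.mem_univ i)) Φ

/-- A continuous linear map between Schwartz spaces satisfies seminorm bounds. -/
theorem exists_seminorm_le (L : 𝓢(D, ℂ) →L[ℂ] 𝓢(V, ℂ)) (k n : ℕ) :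
    ∃ (s : Finset (ℕ × ℕ)) (C : ℝ), 0 ≤ C ∧ ∀ Φ : 𝓢(D, ℂ),
      SchwartzMap.seminorm ℂ k n (L Φ) ≤ C * s.sup (schwartzSeminormFamily ℂ D ℂ) Φ := by
  obtain ⟨s, C, -, h⟩ := Seminorm.bound_of_continuous (schwartz_withSeminorms ℂ D ℂ)
    ((schwartzSeminormFamily ℂ V ℂ (k, n)).comp (L : 𝓢(D, ℂ) →ₗ[ℂ] 𝓢(V, ℂ)))
    (((schwartz_withSeminorms ℂ V ℂ).continuous_seminorm (k, n)).comp L.continuous)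
  exact ⟨s, C, C.2, fun Φ => h Φ⟩

theorem lineDeriv_comm (Φ : 𝓢(D, ℂ)) (a c : D) : ∂_{a} (∂_{c} Φ) = ∂_{c} (∂_{a} Φ) := by
  ext z
  have h : ∀ a c : D, (∂_{a} (∂_{c} Φ)) z = fderiv ℝ (fderiv ℝ Φ) z a c := by
    intro a c
    rw [lineDerivOp_apply_eq_fderiv]
    have : ((∂_{c} Φ : 𝓢(D, ℂ)) : D → ℂ) = fun w => fderiv ℝ Φ w c := by
      funext w
      exact lineDerivOp_apply_eq_fderiv c Φ w
    rw [this]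
    have hd : DifferentiableAt ℝ (fderiv ℝ Φ) z :=
      ((Φ.smooth 2).fderiv_right (m := 1) (by norm_num)).differentiable (by norm_num) z
    rw [fderiv_clm_apply hd (differentiableAt_const c)]
    simp
  rw [h, h]
  have := (Φ.smooth 2).contDiffAt (x := z) |>.isSymmSndFDerivAt (by simp)
  exact this a c

theorem iteratedLineDeriv_comm (Φ : 𝓢(D, ℂ)) (a : D) {n : ℕ} (m : Fin n → D) :
    ∂^{m} (∂_{a} Φ) = ∂_{a} (∂^{m} Φ) := by
  induction n with
  | zero => simp
  | succ n ih => rw [LineDeriv.iteratedLineDerivOp_succ_left, ih, lineDeriv_comm,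
      LineDeriv.iteratedLineDerivOp_succ_left]

/-- Second order Taylor estimate for translations in the Schwartz space. -/
theorem translation_remainder (Φ : 𝓢(D, ℂ)) (k n : ℕ) :
    ∃ C : ℝ, 0 ≤ C ∧ ∀ a : D, ‖a‖ ≤ 1 →
      SchwartzMap.seminorm ℂ k n (compSubConstCLM ℂ (-a) Φ - Φ - ∂_{a} Φ) ≤ C * ‖a‖ ^ 2 := by
  set M : ℝ := 2 ^ k * ((Finset.Iic (k, n + 2)).sup (schwartzSeminormFamily ℂ D ℂ)) Φ
  have hM : 0 ≤ M := by positivity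
  have hbd : ∀ w : D, (1 + ‖w‖) ^ k * ‖iteratedFDeriv ℝ (n + 2) Φ w‖ ≤ M := fun w =>
    one_add_le_sup_seminorm_apply (m := (k, n + 2)) le_rfl le_rfl Φ w
  refine ⟨2 ^ k * M, by positivity, fun a ha => ?_⟩
  refine seminorm_le_bound ℂ k n _ (by positivity) fun z => ?_
  set u := iteratedFDeriv ℝ n Φ
  have hu : ∀ i : ℕ, Differentiable ℝ (iteratedFDeriv ℝ i Φ) := fun i =>
    (Φ.smooth ⊤).differentiable_iteratedFDeriv (by exact_mod_cast ENat.natCast_lt_top i)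
  have hR : iteratedFDeriv ℝ n (compSubConstCLM ℂ (-a) Φ - Φ - ∂_{a} Φ : 𝓢(D, ℂ)) z
      = u (z + a) - u z - fderiv ℝ u z a := by
    ext m
    rw [← iteratedLineDerivOp_eq_iteratedFDeriv, sub_eq_add_neg, sub_eq_add_neg,
      LineDeriv.iteratedLineDerivOp_add, LineDeriv.iteratedLineDerivOp_add,
      LineDeriv.iteratedLineDerivOp_neg, LineDeriv.iteratedLineDerivOp_neg]
    simp only [add_apply, neg_apply]
    have e1 : (∂^{m} (compSubConstCLM ℂ (-a) Φ)) z = u (z + a) m := by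
      rw [iteratedLineDerivOp_eq_iteratedFDeriv]
      have : ((compSubConstCLM ℂ (-a) Φ : 𝓢(D, ℂ)) : D → ℂ) = fun w => Φ (w + a) := by
        funext w; simp
      rw [this, iteratedFDeriv_comp_add_right]
    have e2 : (∂^{m} (∂_{a} Φ)) z = fderiv ℝ u z a m := by
      have := iteratedFDeriv_succ_apply_left (𝕜 := ℝ) (f := Φ) (x := z)
        (Fin.cons a m : Fin (n + 1) → D)
      rw [← iteratedLineDerivOp_eq_iteratedFDeriv,
        LineDeriv.iteratedLineDerivOp_succ_left] at this
      simpa [iteratedLineDeriv_comm] using this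
    rw [e1, e2, iteratedLineDerivOp_eq_iteratedFDeriv]
    simp [u, sub_eq_add_neg]
  rw [hR]
  set K : ℝ := 2 ^ k * M / (1 + ‖z‖) ^ k
  have hz : 0 < 1 + ‖z‖ := by positivity
  have hK : 0 ≤ K := by positivity
  have hw : ∀ w ∈ Metric.closedBall z ‖a‖, ‖iteratedFDeriv ℝ (n + 2) Φ w‖ ≤ K := by
    intro w hw
    rw [le_div_iff₀ (by positivity)]
    have h1 : 1 + ‖z‖ ≤ 2 * (1 + ‖w‖) := by
      have : ‖z - w‖ ≤ ‖a‖ := by rw [← dist_eq_norm, dist_comm]; exact hw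
      have := norm_le_norm_add_norm_sub' z w
      have := norm_nonneg w
      linarith
    calc ‖iteratedFDeriv ℝ (n + 2) Φ w‖ * (1 + ‖z‖) ^ k
        ≤ ‖iteratedFDeriv ℝ (n + 2) Φ w‖ * (2 * (1 + ‖w‖)) ^ k := by gcongr
      _ = 2 ^ k * ((1 + ‖w‖) ^ k * ‖iteratedFDeriv ℝ (n + 2) Φ w‖) := by rw [mul_pow]; ring
      _ ≤ 2 ^ k * M := by gcongr; exact hbd w
  have hconv : Convex ℝ (Metric.closedBall z ‖a‖) := convex_closedBall _ _
  have hz0 : z ∈ Metric.closedBall z ‖a‖ := Metric.mem_closedBall_self (norm_nonneg _)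
  have hza : z + a ∈ Metric.closedBall z ‖a‖ := by simp [Metric.mem_closedBall]
  have hD : ∀ w ∈ Metric.closedBall z ‖a‖, ‖fderiv ℝ u w - fderiv ℝ u z‖ ≤ K * ‖a‖ := by
    intro w hwm
    have e : ‖fderiv ℝ u w - fderiv ℝ u z‖ =
        ‖iteratedFDeriv ℝ (n + 1) Φ w - iteratedFDeriv ℝ (n + 1) Φ z‖ := by
      have e := (continuousMultilinearCurryLeftEquiv ℝ (fun _ : Fin (n + 1) => D) ℂ).norm_map
        (iteratedFDeriv ℝ (n + 1) Φ w - iteratedFDeriv ℝ (n + 1) Φ z)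
      rw [← e, (continuousMultilinearCurryLeftEquiv ℝ (fun _ : Fin (n + 1) => D) ℂ).map_sub,
        fderiv_iteratedFDeriv]
      rfl
    rw [e]
    refine (hconv.norm_image_sub_le_of_norm_fderiv_le (𝕜 := ℝ) (fun x _ => hu (n + 1) x)
      (C := K) ?_ hz0 hwm).trans ?_
    · intro x hx
      rw [norm_fderiv_iteratedFDeriv]
      exact hw x hx
    · gcongr
      rw [← dist_eq_norm]; exact hwm
  have hT := hconv.norm_image_sub_le_of_norm_hasFDerivWithin_le' (f := u) (𝕜 := ℝ)
    (fun x _ => ((hu n x).hasFDerivAt).hasFDerivWithinAt) hD hz0 hza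
  rw [add_sub_cancel_left] at hT
  calc ‖z‖ ^ k * ‖u (z + a) - u z - fderiv ℝ u z a‖
      ≤ (1 + ‖z‖) ^ k * (K * ‖a‖ * ‖a‖) := by
        gcongr
        linarith [norm_nonneg z]
    _ = 2 ^ k * M * ‖a‖ ^ 2 := by
        simp only [K]
        field_simp

theorem seminorm_lineDeriv_le (Φ : 𝓢(D, ℂ)) (a : D) (k n : ℕ) :
    SchwartzMap.seminorm ℂ k n (∂_{a} Φ) ≤ ‖a‖ * SchwartzMap.seminorm ℂ k (n + 1) Φ := by
  refine seminorm_le_bound ℂ k n _ (by positivity) fun z => ?_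
  have e : ((∂_{a} Φ : 𝓢(D, ℂ)) : D → ℂ) = fun w => fderiv ℝ Φ w a := by
    funext w
    exact lineDerivOp_apply_eq_fderiv a Φ w
  have hd : ContDiffAt ℝ n (fderiv ℝ Φ) z :=
    ((Φ.smooth (n + 1 : ℕ)).fderiv_right (m := n) (by norm_cast)).contDiffAt
  have h := norm_iteratedFDeriv_clm_apply_const (c := a) hd le_rfl
  rw [norm_iteratedFDeriv_fderiv] at h
  rw [e]
  calc ‖z‖ ^ k * ‖iteratedFDeriv ℝ n (fun w => fderiv ℝ Φ w a) z‖
      ≤ ‖z‖ ^ k * (‖a‖ * ‖iteratedFDeriv ℝ (n + 1) Φ z‖) := by gcongr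
    _ = ‖a‖ * (‖z‖ ^ k * ‖iteratedFDeriv ℝ (n + 1) Φ z‖) := by ring
    _ ≤ _ := by gcongr; exact Φ.le_seminorm ℂ k (n + 1) z

end Calculus

section Partial

variable {E F G : Type*} [NormedAddCommGroup E] [NormedSpace ℝ E]
  [NormedAddCommGroup F] [NormedSpace ℝ F] [NormedAddCommGroup G] [NormedSpace ℝ G]

/-- The restriction `Φ ↦ Φ(x, ·)` of a Schwartz function on a product. -/
noncomputable def slice (x : E) : 𝓢(E × F, ℂ) →L[ℂ] 𝓢(F, ℂ) :=
  compCLM ℂ (g := fun y : F => (x, (0 : F)) + ContinuousLinearMap.inr ℝ E F y)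
    ((Function.HasTemperateGrowth.const _).add
      (ContinuousLinearMap.inr ℝ E F).hasTemperateGrowth)
    ⟨1, 1, fun y => by
      have : ‖y‖ ≤ ‖((x, (0 : F)) + ContinuousLinearMap.inr ℝ E F y : E × F)‖ := by
        simp [Prod.norm_def]
      linarith⟩

@[simp]
theorem slice_apply (x : E) (Φ : 𝓢(E × F, ℂ)) (y : F) : slice x Φ y = Φ (x, y) := by
  simp [slice]

theorem norm_pow_mul_seminorm_slice_le (j k n : ℕ) (x : E) (Φ : 𝓢(E × F, ℂ)) :
    ‖x‖ ^ j * SchwartzMap.seminorm ℂ k n (slice x Φ) ≤ SchwartzMap.seminorm ℂ (j + k) n Φ := by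
  have key : ∀ y : F, ‖x‖ ^ j * (‖y‖ ^ k * ‖iteratedFDeriv ℝ n (slice x Φ) y‖) ≤
      SchwartzMap.seminorm ℂ (j + k) n Φ := by
    intro y
    have e : ((slice x Φ : 𝓢(F, ℂ)) : F → ℂ) =
        (fun z => Φ (z + (x, (0 : F)))) ∘ ContinuousLinearMap.inr ℝ E F := by
      funext w
      simp
    have hs : ContDiff ℝ n (fun z => Φ (z + (x, (0 : F)))) :=
      (Φ.smooth n).comp (contDiff_id.add contDiff_const)
    have h : ‖iteratedFDeriv ℝ n (slice x Φ) y‖ ≤ ‖iteratedFDeriv ℝ n Φ (x, y)‖ := by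
      rw [e, ContinuousLinearMap.iteratedFDeriv_comp_right _ hs y le_rfl,
        iteratedFDeriv_comp_add_right]
      refine (ContinuousMultilinearMap.norm_compContinuousLinearMap_le _ _).trans ?_
      have : ContinuousLinearMap.inr ℝ E F y + (x, (0 : F)) = (x, y) := by simp
      rw [this]
      refine mul_le_of_le_one_right (norm_nonneg _) (Finset.prod_le_one (fun _ _ => norm_nonneg _)
        fun _ _ => ContinuousLinearMap.norm_inr_le_one ℝ E F)
    have hx : ‖x‖ ≤ ‖(x, y)‖ := norm_fst_le (x, y)
    have hy : ‖y‖ ≤ ‖(x, y)‖ := norm_snd_le (x, y)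
    calc ‖x‖ ^ j * (‖y‖ ^ k * ‖iteratedFDeriv ℝ n (slice x Φ) y‖)
        ≤ ‖(x, y)‖ ^ j * (‖(x, y)‖ ^ k * ‖iteratedFDeriv ℝ n Φ (x, y)‖) := by gcongr
      _ = ‖(x, y)‖ ^ (j + k) * ‖iteratedFDeriv ℝ n Φ (x, y)‖ := by rw [pow_add]; ring
      _ ≤ _ := Φ.le_seminorm ℂ (j + k) n (x, y)
  rcases eq_or_ne (‖x‖ ^ j) 0 with h0 | h0
  · rw [h0, zero_mul]
    positivity
  · have hp : 0 < ‖x‖ ^ j := lt_of_le_of_ne (by positivity) h0.symm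
    rw [← le_div_iff₀' hp]
    refine seminorm_le_bound ℂ k n _ (by positivity) fun y => ?_
    rw [le_div_iff₀' hp]
    exact key y

theorem slice_add (x a : E) (Φ : 𝓢(E × F, ℂ)) :
    slice (x + a) Φ = slice x (compSubConstCLM ℂ (-(a, (0 : F))) Φ) := by
  ext y
  simp

theorem partial_bound (L : 𝓢(F, ℂ) →L[ℂ] 𝓢(G, ℂ)) (k : ℕ) :
    ∃ (s : Finset (ℕ × ℕ)) (C : ℝ), 0 ≤ C ∧ ∀ (Φ : 𝓢(E × F, ℂ)) (z : E × G),
      ‖z‖ ^ k * ‖L (slice z.1 Φ) z.2‖ ≤ C * s.sup (schwartzSeminormFamily ℂ (E × F) ℂ) Φ := by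
  -- the two cases `‖z‖ = ‖z.1‖` and `‖z‖ = ‖z.2‖`
  have main : ∀ j l : ℕ, ∃ (s : Finset (ℕ × ℕ)) (C : ℝ), 0 ≤ C ∧
      ∀ (Φ : 𝓢(E × F, ℂ)) (z : E × G),
      ‖z.1‖ ^ j * (‖z.2‖ ^ l * ‖L (slice z.1 Φ) z.2‖) ≤
        C * s.sup (schwartzSeminormFamily ℂ (E × F) ℂ) Φ := by
    intro j l
    obtain ⟨s, C, hC, h⟩ := exists_seminorm_le L l 0
    refine ⟨s.image (fun i => (j + i.1, i.2)), C * s.card, by positivity, fun Φ z => ?_⟩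
    have h0 := (L (slice z.1 Φ)).norm_pow_mul_le_seminorm ℂ l z.2
    calc ‖z.1‖ ^ j * (‖z.2‖ ^ l * ‖L (slice z.1 Φ) z.2‖)
        ≤ ‖z.1‖ ^ j * (C * ∑ i ∈ s, SchwartzMap.seminorm ℂ i.1 i.2 (slice z.1 Φ)) := by
          refine mul_le_mul_of_nonneg_left (h0.trans ((h _).trans ?_)) (by positivity)
          gcongr
          have := Seminorm.finset_sup_le_sum (schwartzSeminormFamily ℂ F ℂ) s (slice z.1 Φ)
          rwa [sum_apply] at this
      _ = C * ∑ i ∈ s, ‖z.1‖ ^ j * SchwartzMap.seminorm ℂ i.1 i.2 (slice z.1 Φ) := by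
          rw [← Finset.mul_sum]; ring
      _ ≤ C * ∑ i ∈ s, (s.image (fun i => (j + i.1, i.2))).sup
            (schwartzSeminormFamily ℂ (E × F) ℂ) Φ := by
          gcongr with i hi
          refine (norm_pow_mul_seminorm_slice_le j i.1 i.2 z.1 Φ).trans ?_
          exact Seminorm.le_finset_sup_apply (p := schwartzSeminormFamily ℂ (E × F) ℂ)
            (i := (j + i.1, i.2)) (Finset.mem_image_of_mem _ hi)
      _ = _ := by rw [Finset.sum_const, nsmul_eq_mul]; ring
  obtain ⟨s, C, hC, h⟩ := main k 0
  obtain ⟨s', C', hC', h'⟩ := main 0 k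
  refine ⟨s ∪ s', C + C', by positivity, fun Φ z => ?_⟩
  have m1 : s.sup (schwartzSeminormFamily ℂ (E × F) ℂ) Φ ≤
      (s ∪ s').sup (schwartzSeminormFamily ℂ (E × F) ℂ) Φ :=
    Finset.sup_mono (f := schwartzSeminormFamily ℂ (E × F) ℂ) Finset.subset_union_left Φ
  have m2 : s'.sup (schwartzSeminormFamily ℂ (E × F) ℂ) Φ ≤
      (s ∪ s').sup (schwartzSeminormFamily ℂ (E × F) ℂ) Φ :=
    Finset.sup_mono (f := schwartzSeminormFamily ℂ (E × F) ℂ) Finset.subset_union_right Φ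
  have hz : ‖z‖ ^ k ≤ ‖z.1‖ ^ k + ‖z.2‖ ^ k := by
    rw [Prod.norm_def]
    rcases max_cases ‖z.1‖ ‖z.2‖ with ⟨e, _⟩ | ⟨e, _⟩ <;> rw [e] <;> simp
  have a1 := h Φ z
  have a2 := h' Φ z
  simp only [pow_zero, one_mul] at a1 a2
  calc ‖z‖ ^ k * ‖L (slice z.1 Φ) z.2‖
      ≤ (‖z.1‖ ^ k + ‖z.2‖ ^ k) * ‖L (slice z.1 Φ) z.2‖ := by gcongr
    _ ≤ C * s.sup (schwartzSeminormFamily ℂ (E × F) ℂ) Φ +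
        C' * s'.sup (schwartzSeminormFamily ℂ (E × F) ℂ) Φ := by rw [add_mul]; gcongr
    _ ≤ _ := by rw [add_mul]; gcongr

theorem partial_hasFDerivAt [FiniteDimensional ℝ E] (L : 𝓢(F, ℂ) →L[ℂ] 𝓢(G, ℂ))
    (Φ : 𝓢(E × F, ℂ)) (z : E × G) :
    ∃ f' : E × G →L[ℝ] ℂ, HasFDerivAt (fun w : E × G => L (slice w.1 Φ) w.2) f' z ∧
      ∀ a c, f' (a, c) = L (slice z.1 (∂_{(a, (0 : F))} Φ)) z.2 +
        (∂_{c} (L (slice z.1 Φ))) z.2 := by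
  obtain ⟨x, y⟩ := z
  let B : 𝓢(E × F, ℂ) →L[ℂ] 𝓢(G, ℂ) := L ∘L slice x
  let A : E →ₗ[ℝ] ℂ :=
    { toFun := fun a => B (∂_{(a, (0 : F))} Φ) y
      map_add' := fun a a' => by
        have : ((a + a', (0 : F)) : E × F) = (a, 0) + (a', 0) := by simp
        rw [this, LineDeriv.lineDerivOp_left_add, map_add, add_apply]
      map_smul' := fun r a => by
        have : ((r • a, (0 : F)) : E × F) = r • (a, 0) := by simp
        rw [this, LineDeriv.lineDerivOp_left_smul]
        have h2 : r • (∂_{(a, (0 : F))} Φ : 𝓢(E × F, ℂ)) = (r : ℂ) • ∂_{(a, (0 : F))} Φ := by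
          ext w; simp
        rw [h2, map_smul]
        simp }
  refine ⟨(LinearMap.toContinuousLinearMap A).coprod (fderiv ℝ (B Φ) y), ?_, fun a c => ?_⟩
  swap
  · simp only [ContinuousLinearMap.coprod_apply, LinearMap.coe_toContinuousLinearMap',
      lineDerivOp_apply_eq_fderiv]
    rfl
  rw [hasFDerivAt_iff_isLittleO_nhds_zero]
  have t2 : (fun v : E × G => B Φ (y + v.2) - B Φ y - fderiv ℝ (B Φ) y v.2)
      =o[nhds 0] fun v => v := by
    have h := ((B Φ).differentiableAt (x := y)).hasFDerivAt
    have h' := (hasFDerivAt_iff_isLittleO_nhds_zero.1 h).comp_tendsto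
      (k := fun v : E × G => v.2) (l' := nhds 0) (by
        simpa using (continuous_snd (X := E) (Y := G)).tendsto 0)
    exact h'.trans_isBigO (Asymptotics.isBigO_of_le _ fun v => norm_snd_le v)
  -- the remaining part is quadratic
  obtain ⟨s, C, hC, hB⟩ := exists_seminorm_le B 0 0
  obtain ⟨s', C', hC', hB'⟩ := exists_seminorm_le B 0 1
  choose K hK hrem using fun i : ℕ × ℕ => translation_remainder Φ i.1 i.2
  let K' : ℕ × ℕ → ℝ := fun i => SchwartzMap.seminorm ℂ i.1 (i.2 + 1) Φ
  have t1 : (fun v : E × G =>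
      B (compSubConstCLM ℂ (-(v.1, (0 : F))) Φ - Φ - ∂_{(v.1, (0 : F))} Φ) (y + v.2) +
      (B (∂_{(v.1, (0 : F))} Φ) (y + v.2) - B (∂_{(v.1, (0 : F))} Φ) y))
      =o[nhds 0] fun v => v := by
    refine Asymptotics.IsBigO.trans_isLittleO (g := fun v : E × G => ‖v‖ ^ 2) ?_
      (Asymptotics.isLittleO_norm_pow_id one_lt_two)
    refine Asymptotics.IsBigO.of_bound (C * ∑ i ∈ s, K i + C' * ∑ i ∈ s', K' i) ?_
    filter_upwards [Metric.closedBall_mem_nhds (0 : E × G) one_pos] with v hv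
    have hv1 : ‖v‖ ≤ 1 := by simpa using hv
    have ha : ‖((v.1, (0 : F)) : E × F)‖ ≤ ‖v‖ := by
      simp [Prod.norm_def]
    set a : E × F := (v.1, (0 : F))
    have b1 : ‖B (compSubConstCLM ℂ (-a) Φ - Φ - ∂_{a} Φ) (y + v.2)‖ ≤
        C * (∑ i ∈ s, K i) * ‖v‖ ^ 2 := by
      refine ((B _).norm_le_seminorm ℂ _).trans ((hB _).trans ?_)
      rw [mul_assoc]
      gcongr
      refine (Seminorm.finset_sup_le_sum (schwartzSeminormFamily ℂ (E × F) ℂ) s _).trans ?_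
      rw [sum_apply, Finset.sum_mul]
      refine Finset.sum_le_sum fun i _ => (hrem i a (ha.trans hv1)).trans ?_
      have := hK i
      gcongr
    have b2 : ‖B (∂_{a} Φ) (y + v.2) - B (∂_{a} Φ) y‖ ≤ C' * (∑ i ∈ s', K' i) * ‖v‖ ^ 2 := by
      have hs : SchwartzMap.seminorm ℂ 0 1 (B (∂_{a} Φ)) ≤ C' * (∑ i ∈ s', K' i) * ‖v‖ := by
        refine (hB' _).trans ?_
        rw [mul_assoc]
        gcongr
        refine (Seminorm.finset_sup_le_sum (schwartzSeminormFamily ℂ (E × F) ℂ) s' _).trans ?_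
        rw [sum_apply, Finset.sum_mul]
        refine Finset.sum_le_sum fun i _ => (seminorm_lineDeriv_le Φ a i.1 i.2).trans ?_
        rw [mul_comm]
        gcongr
      have hm := convex_univ.norm_image_sub_le_of_norm_fderiv_le (𝕜 := ℝ)
        (f := (B (∂_{a} Φ))) (C := SchwartzMap.seminorm ℂ 0 1 (B (∂_{a} Φ)))
        (fun w _ => (B (∂_{a} Φ)).differentiableAt)
        (fun w _ => by
          have := (B (∂_{a} Φ)).norm_iteratedFDeriv_le_seminorm ℂ 1 w
          rwa [norm_iteratedFDeriv_one] at this) (Set.mem_univ y) (Set.mem_univ (y + v.2))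
      rw [add_sub_cancel_left] at hm
      calc _ ≤ _ := hm
        _ ≤ (C' * (∑ i ∈ s', K' i) * ‖v‖) * ‖v‖ := by
          gcongr
          exact norm_snd_le v
        _ = _ := by ring
    rw [Real.norm_of_nonneg (by positivity), add_mul]
    exact (norm_add_le _ _).trans (add_le_add b1 b2)
  refine (t2.add t1).congr_left fun v => ?_
  have e : L (slice (x + v.1) Φ) = B (compSubConstCLM ℂ (-(v.1, (0 : F))) Φ) := by
    rw [slice_add]; rfl
  have eA : (LinearMap.toContinuousLinearMap A) v.1 = B (∂_{(v.1, (0 : F))} Φ) y := rfl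
  simp only [Prod.fst_add, Prod.snd_add, e, map_sub, sub_apply, ContinuousLinearMap.coprod_apply,
    eA]
  have e0 : L (slice x Φ) = B Φ := rfl
  rw [e0]
  ring

/-- The operator `1 ⊗ L` acting on the second variable only: for a continuous linear map `L`
between Schwartz spaces, `(partialCLM L Φ) (x, ·) = L (Φ (x, ·))`. -/
noncomputable def partialCLM [FiniteDimensional ℝ E] [FiniteDimensional ℝ G]
    (L : 𝓢(F, ℂ) →L[ℂ] 𝓢(G, ℂ)) : 𝓢(E × F, ℂ) →L[ℂ] 𝓢(E × G, ℂ) :=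
  have key := smooth_and_bounds
    ((Module.finBasis ℝ E).prod (Module.finBasis ℝ G))
    {T : 𝓢(E × F, ℂ) → E × G → ℂ | ∃ (L' : 𝓢(F, ℂ) →L[ℂ] 𝓢(G, ℂ))
      (P : 𝓢(E × F, ℂ) →L[ℂ] 𝓢(E × F, ℂ)), T = fun Φ z => L' (slice z.1 (P Φ)) z.2}
    (by
      rintro _ ⟨L', P, rfl⟩ Φ z
      obtain ⟨f', hf, -⟩ := partial_hasFDerivAt L' (P Φ) z
      exact hf.differentiableAt)
    (by
      rintro _ ⟨L', P, rfl⟩ i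
      rcases i with i | i
      · refine ⟨_, ⟨L', LineDeriv.lineDerivOpCLM ℂ 𝓢(E × F, ℂ)
          ((Module.finBasis ℝ E i, (0 : F)) : E × F) ∘L P, rfl⟩, fun Φ z => ?_⟩
        obtain ⟨f', hf, h⟩ := partial_hasFDerivAt L' (P Φ) z
        rw [hf.fderiv]
        have : ((Module.finBasis ℝ E).prod (Module.finBasis ℝ G)) (Sum.inl i) =
          (Module.finBasis ℝ E i, (0 : G)) := by ext <;> simp
        rw [this, h]
        simp
      · refine ⟨_, ⟨LineDeriv.lineDerivOpCLM ℂ 𝓢(G, ℂ) (Module.finBasis ℝ G i) ∘L L', P, rfl⟩,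
          fun Φ z => ?_⟩
        obtain ⟨f', hf, h⟩ := partial_hasFDerivAt L' (P Φ) z
        rw [hf.fderiv]
        have : ((Module.finBasis ℝ E).prod (Module.finBasis ℝ G)) (Sum.inr i) =
          ((0 : E), Module.finBasis ℝ G i) := by ext <;> simp
        rw [this, h]
        have h0 : (∂_{((0 : E), (0 : F))} (P Φ) : 𝓢(E × F, ℂ)) = 0 :=
          LineDeriv.lineDerivOp_left_zero (P Φ)
        simp [h0])
    (by
      rintro _ ⟨L', P, rfl⟩ k
      obtain ⟨s, C, hC, h⟩ := partial_bound (E := E) L' k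
      obtain ⟨s', C', -, h'⟩ := Seminorm.bound_of_continuous
        (schwartz_withSeminorms ℂ (E × F) ℂ)
        ((s.sup (schwartzSeminormFamily ℂ (E × F) ℂ)).comp
          (P : 𝓢(E × F, ℂ) →ₗ[ℂ] 𝓢(E × F, ℂ)))
        (((schwartz_withSeminorms ℂ (E × F) ℂ).finset_sups.continuous_seminorm s).comp
          P.continuous)
      refine ⟨s', C * C', by positivity, fun Φ z => (h (P Φ) z).trans ?_⟩
      rw [mul_assoc]
      exact mul_le_mul_of_nonneg_left (h' Φ) hC)
  mkCLM (fun Φ z => L (slice z.1 Φ) z.2) (fun Φ Ψ z => by simp) (fun c Φ z => by simp)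
    (fun Φ => contDiff_infty.2 fun n =>
      (key n _ ⟨L, ContinuousLinearMap.id ℂ _, rfl⟩).1 Φ)
    (fun n => (key n.2 _ ⟨L, ContinuousLinearMap.id ℂ _, rfl⟩).2 n.1)

@[simp]
theorem partialCLM_apply [FiniteDimensional ℝ E] [FiniteDimensional ℝ G]
    (L : 𝓢(F, ℂ) →L[ℂ] 𝓢(G, ℂ)) (Φ : 𝓢(E × F, ℂ)) (x : E) (y : G) :
    partialCLM L Φ (x, y) = L (slice x Φ) y := rfl

end Partial

section TimeFrequency

variable {E : Type*} [NormedAddCommGroup E] [InnerProductSpace ℝ E]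

/-- The character `t ↦ exp (-2πi ξ·t)`. -/
noncomputable def character (ξ t : E) : ℂ :=
  Complex.exp (-(2 * Real.pi * Complex.I) * (inner ℝ ξ t : ℝ))

theorem character_hasTemperateGrowth (ξ : E) : (character ξ).HasTemperateGrowth := by
  have h : (fun r : ℝ => Complex.exp (-(2 * Real.pi * Complex.I) * (r : ℂ))).HasTemperateGrowth := by
    set c : ℂ := -(2 * Real.pi * Complex.I) with hc
    have hit : ∀ n : ℕ, iteratedDeriv n (fun r : ℝ => Complex.exp (c * (r : ℂ))) =
        fun r : ℝ => c ^ n * Complex.exp (c * (r : ℂ)) := by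
      intro n
      induction n with
      | zero => simp
      | succ n ih =>
        rw [iteratedDeriv_succ, ih]
        funext r
        have h1 : HasDerivAt (fun r : ℝ => Complex.exp (c * (r : ℂ)))
            (Complex.exp (c * (r : ℂ)) * (c * 1)) r :=
          ((Complex.ofRealCLM.hasDerivAt (x := r)).const_mul c).cexp
        rw [(h1.const_mul (c ^ n)).deriv]
        ring
    refine ⟨?_, fun n => ⟨0, ‖c‖ ^ n, fun r => ?_⟩⟩
    · exact (contDiff_const.mul Complex.ofRealCLM.contDiff).cexp
    · rw [norm_iteratedFDeriv_eq_norm_iteratedDeriv, hit]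
      have : ‖Complex.exp (c * (r : ℂ))‖ = 1 := by
        rw [Complex.norm_exp]
        simp [hc]
      simp [this]
  exact h.comp (Function.hasTemperateGrowth_inner_right ξ)

theorem norm_character (ξ t : E) : ‖character ξ t‖ = 1 := by
  rw [character, Complex.norm_exp]
  simp

theorem continuous_character : Continuous fun w : E × E => character w.1 w.2 := by
  unfold character
  fun_prop

/-- Complex conjugation of Schwartz functions. -/
noncomputable def conjSchwartz (φ : 𝓢(E, ℂ)) : 𝓢(E, ℂ) :=
  postcompCLM (𝕜 := ℝ) (Complex.conjCLE : ℂ →L[ℝ] ℂ) φ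

@[simp]
theorem conjSchwartz_apply (φ : 𝓢(E, ℂ)) (t : E) :
    conjSchwartz φ t = (starRingEnd ℂ) (φ t) := rfl

theorem continuous_conjSchwartz : Continuous (conjSchwartz : 𝓢(E, ℂ) → 𝓢(E, ℂ)) :=
  (postcompCLM (𝕜 := ℝ) (E := E) (Complex.conjCLE : ℂ →L[ℝ] ℂ)).continuous

/-- The complex conjugate of a tempered distribution, `⟨f̄, φ⟩ = conj ⟨f, φ̄⟩`. -/
noncomputable def conjDist (f : 𝓢'(E, ℂ)) : 𝓢'(E, ℂ) :=
  ContinuousLinearMap.toPointwiseConvergenceCLM ℂ (RingHom.id ℂ) 𝓢(E, ℂ) ℂ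
    { toFun := fun φ => (starRingEnd ℂ) (f (conjSchwartz φ))
      map_add' := fun φ ψ => by
        have : conjSchwartz (φ + ψ) = conjSchwartz φ + conjSchwartz ψ := by ext t; simp
        rw [this, map_add, map_add]
      map_smul' := fun c φ => by
        have : conjSchwartz (c • φ) = (starRingEnd ℂ c) • conjSchwartz φ := by ext t; simp
        rw [this, map_smul]
        simp
      cont := Complex.continuous_conj.comp ((map_continuous f).comp continuous_conjSchwartz) }

@[simp]
theorem conjDist_apply (f : 𝓢'(E, ℂ)) (φ : 𝓢(E, ℂ)) :
    conjDist f φ = (starRingEnd ℂ) (f (conjSchwartz φ)) := rfl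

/-- The complex conjugate of the time-frequency shift `M_ξ T_x g`, that is the Schwartz function
`t ↦ conj (g (t - x)) exp (-2πi ξ·t)`. -/
noncomputable def conjShift (g : 𝓢(E, ℂ)) (x ξ : E) : 𝓢(E, ℂ) :=
  smulLeftCLM ℂ (character ξ) (conjSchwartz (compSubConstCLM ℂ x g))

theorem conjShift_apply (g : 𝓢(E, ℂ)) (x ξ t : E) :
    conjShift g x ξ t = (starRingEnd ℂ) (g (t - x)) * character ξ t := by
  rw [conjShift, smulLeftCLM_apply_apply (character_hasTemperateGrowth ξ)]
  simp [mul_comm]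

/-- The short-time Fourier transform
`V_g f (x, ξ) = ⟨f, M_ξ T_x g⟩ = ∫ f(t) conj (g (t - x)) exp (-2πi ξ·t) dt`
of a tempered distribution `f` with window `g`. -/
noncomputable def stft (g : 𝓢(E, ℂ)) (f : 𝓢'(E, ℂ)) (x ξ : E) : ℂ :=
  f (conjShift g x ξ)

/-- The constant function `1` on a one-point space. -/
noncomputable def oneSchwartz : 𝓢(PUnit.{1}, ℂ) :=
  HasCompactSupport.toSchwartzMap (f := fun _ : PUnit.{1} => (1 : ℂ))
    (HasCompactSupport.of_compactSpace _) contDiff_const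

/-- Pairing a Schwartz function on a product with a tempered distribution in the second variable:
`(pairSnd f Φ) x = ⟨f, Φ (x, ·)⟩`. The tensor product of `f₁` and `f₂` is
`Φ ↦ f₁ (pairSnd f₂ Φ)`. -/
noncomputable def pairSnd [FiniteDimensional ℝ E] (f : 𝓢'(E, ℂ)) : 𝓢(E × E, ℂ) →L[ℂ] 𝓢(E, ℂ) :=
  compCLMOfContinuousLinearEquiv ℂ (ContinuousLinearEquiv.prodUnique ℝ E PUnit.{1}).symm ∘L
    partialCLM
      { toFun := fun ψ => f ψ • oneSchwartz
        map_add' := fun φ ψ => by rw [map_add, add_smul]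
        map_smul' := fun c φ => by rw [map_smul, smul_assoc]; rfl
        cont := (map_continuous f).smul continuous_const }

@[simp]
theorem pairSnd_apply [FiniteDimensional ℝ E] (f : 𝓢'(E, ℂ)) (Φ : 𝓢(E × E, ℂ)) (x : E) :
    pairSnd f Φ x = f (slice x Φ) := by
  change (f (slice x Φ) • oneSchwartz) PUnit.unit = _
  simp [oneSchwartz]

/-- The linear change of variables `(u, v) ↦ ((u + v) / 2, u - v)`, the inverse of
`(x, t) ↦ (x + t / 2, x - t / 2)`. -/
noncomputable def midpointDiff (E : Type*) [NormedAddCommGroup E] [InnerProductSpace ℝ E] :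
    (E × E) ≃L[ℝ] E × E where
  toFun w := ((1 / 2 : ℝ) • (w.1 + w.2), w.1 - w.2)
  invFun w := (w.1 + (1 / 2 : ℝ) • w.2, w.1 - (1 / 2 : ℝ) • w.2)
  map_add' w w' := by ext <;> simp <;> module
  map_smul' c w := by ext <;> simp <;> module
  left_inv w := by ext <;> simp <;> module
  right_inv w := by ext <;> simp <;> module
  continuous_toFun := by fun_prop
  continuous_invFun := by fun_prop

variable [FiniteDimensional ℝ E] [MeasurableSpace E] [BorelSpace E]

theorem partialFourier_apply (Φ : 𝓢(E × E, ℂ)) (x t : E) :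
    partialCLM (fourierTransformCLM ℂ) Φ (x, t) = ∫ ξ, Φ (x, ξ) * character ξ t := by
  rw [partialCLM_apply, fourierTransformCLM_apply, fourier_coe]
  rw [Real.fourier_eq']
  refine integral_congr_ae (Filter.Eventually.of_forall fun ξ => ?_)
  simp only [character, smul_eq_mul, slice_apply, real_inner_comm]
  rw [mul_comm]
  congr 2
  push_cast
  ring

/-- The kernel `(u, v) ↦ ∫ Ψ((u + v) / 2, ξ) exp (-2πi ξ·(u - v)) dξ` of a Schwartz function `Ψ`
on phase space: the partial Fourier transform in the second variable followed by a linear change of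
variables. -/
noncomputable def wignerKernel : 𝓢(WithLp 2 (E × E), ℂ) →L[ℂ] 𝓢(E × E, ℂ) :=
  compCLMOfContinuousLinearEquiv ℂ (midpointDiff E) ∘L
    partialCLM (fourierTransformCLM ℂ) ∘L
      compCLMOfContinuousLinearEquiv ℂ (WithLp.prodContinuousLinearEquiv 2 ℝ E E).symm

theorem wignerKernel_apply (Ψ : 𝓢(WithLp 2 (E × E), ℂ)) (u v : E) :
    wignerKernel Ψ (u, v) =
      ∫ ξ, Ψ (WithLp.toLp 2 ((1 / 2 : ℝ) • (u + v), ξ)) * character ξ (u - v) := by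
  exact partialFourier_apply _ _ _

/-- The cross-Wigner distribution of two tempered distributions,
`⟨W(f₁, f₂), Ψ⟩ = ⟨f₁ ⊗ f̄₂, wignerKernel Ψ⟩`, a tempered distribution on phase space. -/
noncomputable def crossWigner (f₁ f₂ : 𝓢'(E, ℂ)) : 𝓢'(WithLp 2 (E × E), ℂ) :=
  PointwiseConvergenceCLM.precomp ℂ (pairSnd (conjDist f₂) ∘L wignerKernel) f₁

theorem crossWigner_apply (f₁ f₂ : 𝓢'(E, ℂ)) (Ψ : 𝓢(WithLp 2 (E × E), ℂ)) :
    crossWigner f₁ f₂ Ψ = f₁ (pairSnd (conjDist f₂) (wignerKernel Ψ)) := rfl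

/-- The cross-Wigner distribution of two functions,
`W(f₁, f₂)(x, ξ) = ∫ f₁(x + t/2) conj (f₂(x - t/2)) exp (-2πi ξ·t) dt`. -/
noncomputable def crossWignerFun (f₁ f₂ : E → ℂ) (x ξ : E) : ℂ :=
  ∫ t, f₁ (x + (1 / 2 : ℝ) • t) * (starRingEnd ℂ) (f₂ (x - (1 / 2 : ℝ) • t)) * character ξ t

/-- On Schwartz functions the two definitions of the cross-Wigner distribution agree. -/
theorem crossWigner_schwartz (f₁ f₂ : 𝓢(E, ℂ)) (Ψ : 𝓢(WithLp 2 (E × E), ℂ)) :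
    crossWigner (toTemperedDistributionCLM E ℂ volume f₁) (toTemperedDistributionCLM E ℂ volume f₂)
      Ψ = ∫ z, Ψ z * crossWignerFun f₁ f₂ z.fst z.snd := by
  -- `S x t = ∫ Ψ(x, ξ) exp (-2πi ξ·t) dξ` and `H x t = f₁(x + t/2) conj (f₂(x - t/2))`
  let Ψ' : 𝓢(E × E, ℂ) :=
    compCLMOfContinuousLinearEquiv ℂ (WithLp.prodContinuousLinearEquiv 2 ℝ E E).symm Ψ
  let S : 𝓢(E × E, ℂ) := partialCLM (fourierTransformCLM ℂ) Ψ'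
  let H : E × E → ℂ := fun w =>
    f₁ (w.1 + (1 / 2 : ℝ) • w.2) * (starRingEnd ℂ) (f₂ (w.1 - (1 / 2 : ℝ) • w.2))
  have hS : ∀ x t, S (x, t) = ∫ ξ, Ψ' (x, ξ) * character ξ t := by
    exact fun x t => partialFourier_apply _ _ _
  have hHc : Continuous H := by
    have := f₁.continuous
    have := f₂.continuous
    fun_prop
  set M₁ := SchwartzMap.seminorm ℂ 0 0 f₁
  set M₂ := SchwartzMap.seminorm ℂ 0 0 f₂
  have hHb : ∀ w, ‖H w‖ ≤ M₁ * M₂ := by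
    intro w
    simp only [H, norm_mul, RCLike.norm_conj]
    gcongr
    · exact f₁.norm_le_seminorm ℂ _
    · exact f₂.norm_le_seminorm ℂ _
  have : (volume : Measure (E × E)).IsAddHaarMeasure :=
    inferInstanceAs (Measure.prod volume volume : Measure (E × E)).IsAddHaarMeasure
  have hint : ∀ R : 𝓢(E × E, ℂ), Integrable R (volume : Measure (E × E)) := fun R => R.integrable
  have hmul : ∀ (R : 𝓢(E × E, ℂ)) (h : E × E → ℂ), Continuous h → (∀ w, ‖h w‖ ≤ M₁ * M₂) →
      Integrable (fun w => R w * h w) (volume : Measure (E × E)) := fun R h hc hb =>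
    (hint R).mul_bdd hc.aestronglyMeasurable (Filter.Eventually.of_forall hb)
  -- the left-hand side
  have hL : crossWigner (toTemperedDistributionCLM E ℂ volume f₁)
      (toTemperedDistributionCLM E ℂ volume f₂) Ψ =
      ∫ u, ∫ v, S (midpointDiff E (u, v)) * H (midpointDiff E (u, v)) := by
    rw [crossWigner_apply]
    refine (toTemperedDistributionCLM_apply_apply volume f₁ _).trans ?_
    refine integral_congr_ae (Filter.Eventually.of_forall fun u => ?_)
    simp only [pairSnd_apply, conjDist_apply, smul_eq_mul]
    rw [toTemperedDistributionCLM_apply_apply volume f₂]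
    rw [← integral_conj, ← integral_mul_const]
    refine integral_congr_ae (Filter.Eventually.of_forall fun v => ?_)
    have e := (midpointDiff E).symm_apply_apply (u, v)
    have e1 : (midpointDiff E (u, v)).1 + (1 / 2 : ℝ) • (midpointDiff E (u, v)).2 = u :=
      congrArg Prod.fst e
    have e2 : (midpointDiff E (u, v)).1 - (1 / 2 : ℝ) • (midpointDiff E (u, v)).2 = v :=
      congrArg Prod.snd e
    have e3 : wignerKernel Ψ (u, v) = S (midpointDiff E (u, v)) := rfl
    simp only [H, e1, e2, map_mul, conjSchwartz_apply, slice_apply, smul_eq_mul,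
      Complex.conj_conj, e3]
    ring
  let J : E × E → ℂ := fun w => S w * H w
  have hJ : Integrable J (volume : Measure (E × E)) := hmul S H hHc hHb
  -- shear in the second variable
  have hshear : ∀ u, ∫ v, J (midpointDiff E (u, v)) = ∫ t, J (u - (1 / 2 : ℝ) • t, t) := by
    intro u
    rw [← integral_sub_left_eq_self (fun v => J (midpointDiff E (u, v))) volume u]
    refine integral_congr_ae (Filter.Eventually.of_forall fun t => ?_)
    have : midpointDiff E (u, u - t) = (u - (1 / 2 : ℝ) • t, t) := by
      ext1
      · change (1 / 2 : ℝ) • (u + (u - t)) = u - (1 / 2 : ℝ) • t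
        module
      · change u - (u - t) = t
        simp
    simp only [this]
  let sh : (E × E) ≃L[ℝ] E × E :=
    { toFun := fun w => (w.1 - (1 / 2 : ℝ) • w.2, w.2)
      invFun := fun w => (w.1 + (1 / 2 : ℝ) • w.2, w.2)
      map_add' := fun w w' => by ext <;> simp; module
      map_smul' := fun c w => by ext <;> simp; module
      left_inv := fun w => by ext <;> simp
      right_inv := fun w => by ext <;> simp
      continuous_toFun := by fun_prop
      continuous_invFun := by fun_prop }
  have hJsh : Integrable (fun w : E × E => J (w.1 - (1 / 2 : ℝ) • w.2, w.2))
      (volume : Measure (E × E)) :=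
    hmul (compCLMOfContinuousLinearEquiv ℂ sh S) (H ∘ sh) (hHc.comp sh.continuous)
      fun w => hHb _
  have hL2 : ∫ u, ∫ v, J (midpointDiff E (u, v)) = ∫ x, ∫ t, J (x, t) := by
    simp only [hshear]
    rw [integral_integral_swap hJsh]
    have : ∀ t, ∫ u, J (u - (1 / 2 : ℝ) • t, t) = ∫ x, J (x, t) := fun t =>
      integral_sub_right_eq_self (fun x => J (x, t)) ((1 / 2 : ℝ) • t)
    simp only [this]
    exact (integral_integral_swap hJ).symm
  -- the right-hand side
  have hHt : ∀ x, Integrable (fun t => H (x, t)) := by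
    intro x
    have h2 : Integrable (fun t => f₂ (x - (1 / 2 : ℝ) • t)) := by
      have h := ((f₂.integrable (μ := volume)).comp_sub_left x)
      exact h.comp_smul (by norm_num : (1 / 2 : ℝ) ≠ 0)
    have h2' : Integrable (fun t => (starRingEnd ℂ) (f₂ (x - (1 / 2 : ℝ) • t))) :=
      (LinearIsometryEquiv.integrable_comp_iff (Complex.conjLIE)).2 h2
    refine h2'.bdd_mul (c := M₁) ?_ (Filter.Eventually.of_forall fun t => f₁.norm_le_seminorm ℂ _)
    have := f₁.continuous
    exact Continuous.aestronglyMeasurable (by fun_prop)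
  have hW : ∀ x ξ, crossWignerFun f₁ f₂ x ξ = ∫ t, H (x, t) * character ξ t := fun x ξ => rfl
  have hx : ∀ x, ∫ ξ, Ψ' (x, ξ) * crossWignerFun f₁ f₂ x ξ = ∫ t, J (x, t) := by
    intro x
    have hΨx : Integrable (fun ξ => Ψ' (x, ξ)) := by
      have := (slice x Ψ').integrable (μ := volume)
      exact this.congr (Filter.Eventually.of_forall fun ξ => slice_apply x Ψ' ξ)
    have hprod : Integrable (fun w : E × E => Ψ' (x, w.1) * (H (x, w.2) * character w.1 w.2))
        (volume.prod volume) := by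
      have h := (hΨx.mul_prod (hHt x)).mul_bdd (c := 1)
        (continuous_character (E := E)).aestronglyMeasurable
        (Filter.Eventually.of_forall fun w => (norm_character w.1 w.2).le)
      exact h.congr (Filter.Eventually.of_forall fun w => by simp only [mul_assoc])
    calc ∫ ξ, Ψ' (x, ξ) * crossWignerFun f₁ f₂ x ξ
        = ∫ ξ, ∫ t, Ψ' (x, ξ) * (H (x, t) * character ξ t) := by
          simp only [hW, integral_const_mul]
      _ = ∫ t, ∫ ξ, Ψ' (x, ξ) * (H (x, t) * character ξ t) := integral_integral_swap hprod
      _ = ∫ t, J (x, t) := by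
          refine integral_congr_ae (Filter.Eventually.of_forall fun t => ?_)
          simp only [J, hS, ← integral_mul_const]
          refine integral_congr_ae (Filter.Eventually.of_forall fun ξ => ?_)
          simp only
          ring
  have hΨW : Integrable (fun w : E × E => Ψ' w * crossWignerFun f₁ f₂ w.1 w.2)
      (volume.prod volume) := by
    have hm : AEStronglyMeasurable (fun w : E × E => crossWignerFun f₁ f₂ w.1 w.2)
        (volume.prod volume) := by
      refine StronglyMeasurable.aestronglyMeasurable ?_
      refine StronglyMeasurable.integral_prod_right'
        (f := fun w : (E × E) × E => H (w.1.1, w.2) * character w.1.2 w.2) ?_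
      refine Continuous.stronglyMeasurable ?_
      have := continuous_character (E := E)
      exact (hHc.comp (by fun_prop)).mul (this.comp (by fun_prop : Continuous
        fun w : (E × E) × E => (w.1.2, w.2)))
    refine (hint Ψ').mul_bdd (c := M₁ * ∫ t, ‖f₂ ((1 / 2 : ℝ) • t)‖) hm
      (Filter.Eventually.of_forall fun w => ?_)
    have hsub : ∫ t, ‖f₂ (w.1 - (1 / 2 : ℝ) • t)‖ = ∫ t, ‖f₂ ((1 / 2 : ℝ) • t)‖ := by
      rw [← integral_sub_left_eq_self (fun t => ‖f₂ ((1 / 2 : ℝ) • t)‖) volume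
        ((2 : ℝ) • w.1)]
      refine integral_congr_ae (Filter.Eventually.of_forall fun t => ?_)
      simp only [smul_sub, smul_smul]
      norm_num
    rw [hW, ← hsub, ← integral_const_mul]
    refine norm_integral_le_of_norm_le ?_ (Filter.Eventually.of_forall fun t => ?_)
    · have h := ((f₂.integrable (μ := volume)).comp_sub_left w.1)
      exact ((h.comp_smul (by norm_num : (1 / 2 : ℝ) ≠ 0)).norm).const_mul _
    · simp only [H, norm_mul, norm_character, RCLike.norm_conj, mul_one]
      gcongr
      exact f₁.norm_le_seminorm ℂ _
  have hR : ∫ z, Ψ z * crossWignerFun f₁ f₂ z.fst z.snd = ∫ x, ∫ t, J (x, t) := by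
    rw [← (WithLp.volume_preserving_toLp E E).integral_comp
      (MeasurableEquiv.toLp 2 (E × E)).measurableEmbedding]
    simp only [← hx]
    exact integral_prod _ hΨW
  rw [hL, hR]
  exact hL2

end TimeFrequency

section Norms

variable {E : Type*} [NormedAddCommGroup E] [InnerProductSpace ℝ E]
  [FiniteDimensional ℝ E] [MeasurableSpace E] [BorelSpace E]


/-- The weighted mixed norm of `L^{p,q}_m`, for `1 ≤ p, q ≤ ∞`: the `L^q` norm in the second
variable of the `L^p` norm in the first variable of `F m`. -/
noncomputable def mixedNorm (p q : ℝ≥0∞) (m : E → E → ℝ) (F : E → E → ℂ) : ℝ≥0∞ :=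
  eLpNorm (fun ξ => eLpNorm (fun x => F x ξ * (m x ξ : ℂ)) p volume) q volume

/-- The modulation space norm `‖V_g f‖_{L^{p,q}_m}` with window `g`. -/
noncomputable def modNorm (g : 𝓢(E, ℂ)) (p q : ℝ≥0∞) (m : E → E → ℝ) (f : 𝓢'(E, ℂ)) : ℝ≥0∞ :=
  mixedNorm p q m (stft g f)

/-- The modulation space `M^{p,q}_m`: tempered distributions whose short-time Fourier transform
with window `g` lies in `L^{p,q}_m`. -/
def modulationSpace (g : 𝓢(E, ℂ)) (p q : ℝ≥0∞) (m : E → E → ℝ) : Set 𝓢'(E, ℂ) :=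
  {f | modNorm g p q m f < ⊤}

/-- The weight `v_s(z) = (1 + |z|²)^{s/2}`. -/
noncomputable def polyWeight {Z : Type*} [NormedAddCommGroup Z] (s : ℝ) (z : Z) : ℝ :=
  (1 + ‖z‖ ^ 2) ^ (s / 2)

/-- `v_s` as a weight on phase space. -/
noncomputable def phaseWeight (s : ℝ) (x ξ : E) : ℝ :=
  polyWeight s (WithLp.toLp 2 (x, ξ))

/-- `1 ⊗ v_s`, a weight depending only on the second variable. -/
noncomputable def freqWeight (s : ℝ) (_x ξ : E) : ℝ :=
  polyWeight s ξ

end Norms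

end TFA

namespace TFA

/-! ### Hölder duality and Minkowski's inequality for `[0, ∞]`-valued functions -/

section Lebesgue

variable {α β : Type*} [MeasurableSpace α] [MeasurableSpace β] {μ : Measure α} {ν : Measure β}

/-! Everything rests on a product formula (`stft_crossWigner`). With the window `W(g, g)`, the
modulus of the short-time Fourier transform of `W(f₁, f₂)` at `(z, ζ)` is `|V_g f₁(a)| |V_g f₂(b)|`,
where `a` and `b` have midpoint `z` and `b - a = (ζ₂, -ζ₁)`.

Sufficiency. For finite `p`, raise the product to the power `p` and integrate over `z`. The result
is the convolution of a reflected `|V_g f₁|^p` with `|V_g f₂|^p`, evaluated at the rotated point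
`(ζ₂, -ζ₁)`. Since the rotation preserves Lebesgue measure, Young's inequality for mixed norms
bounds its `L^{q/p}` norm (`mixed_product_le`), provided that `p ≤ q`, that the exponents `P₁, P₂,
Q₁, Q₂` are at least `p`, and that `1/P₁ + 1/P₂ = 1/Q₁ + 1/Q₂ = 1/p + 1/q`. Conditions (1) and (2)
allow the given exponents to be enlarged to such ones (`exists_exponents`), and modulation spaces
grow with their exponents. If `q < p`, the argument runs with `min p q` in place of `p`, since (1)
alone gives (2) for that pair. The weight is handled by Peetre's inequality for `b - a`
(`freqWeight_le`), which explains the asymmetry between `|s|` and `s`.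

Both the inclusion between modulation spaces and the freedom in the choice of windows come from
`exists_modNorm_le`. A reproducing formula bounds `V_h f` by the convolution of `|V_g f|` with a
Schwartz kernel, and mixed Young applies again. For tempered `f` the reproducing formula needs `f`
to commute with a parameter integral (`dist_integral_slice`). This is proved by factoring `f`
through a Banach space of weighted derivatives, using Hahn–Banach.

Necessity. Gaussians `exp(-πl|t|²)` have short-time Fourier transforms of modulus `c · exp(-πα|x|²)
exp(-πγ|ξ|²)` with `α + γ = 1` (`exists_enorm_stft_gaussian`). By the product formula the transform
of `W(f₁, f₂)` is Gaussian too, so every norm is an explicit product of powers of the parameters.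
Sending one parameter to zero gives (1), and sending the corresponding parameters of `f₁` and `f₂`
to zero together gives (2) (`exponents_of_bound`). -/

theorem eLpNorm_ennreal_eq {p : ℝ≥0∞} (h0 : p ≠ 0) (ht : p ≠ ∞) (f : α → ℝ≥0∞) :
    eLpNorm f p μ = (∫⁻ x, f x ^ p.toReal ∂μ) ^ (1 / p.toReal) := by
  simpa using eLpNorm_eq_lintegral_rpow_enorm_toReal h0 ht (f := f) (μ := μ)

theorem eLpNorm_rpow_eq_lintegral {p : ℝ≥0∞} (h0 : p ≠ 0) (ht : p ≠ ∞) (f : α → ℝ≥0∞) :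
    eLpNorm f p μ ^ p.toReal = ∫⁻ x, f x ^ p.toReal ∂μ := by
  have := (ENNReal.toReal_pos h0 ht).ne'
  rw [eLpNorm_ennreal_eq h0 ht, ← ENNReal.rpow_mul, one_div_mul_cancel this, ENNReal.rpow_one]

theorem eLpNorm_ennreal_top_le_iff {f : α → ℝ≥0∞} {c : ℝ≥0∞} :
    eLpNorm f ∞ μ ≤ c ↔ ∀ᵐ x ∂μ, f x ≤ c := by
  rw [eLpNorm_exponent_top, eLpNormEssSup_eq_essSup_enorm]
  exact ⟨fun h => (ENNReal.ae_le_essSup f).mono fun x hx => hx.trans h,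
    fun h => essSup_le_of_ae_le _ h⟩

theorem ae_le_eLpNorm_top (f : α → ℝ≥0∞) : ∀ᵐ x ∂μ, f x ≤ eLpNorm f ∞ μ :=
  eLpNorm_ennreal_top_le_iff.1 le_rfl

theorem eLpNorm_mono_ennreal {p : ℝ≥0∞} {f g : α → ℝ≥0∞} (h : ∀ x, f x ≤ g x) :
    eLpNorm f p μ ≤ eLpNorm g p μ :=
  eLpNorm_mono_enorm (by simpa using h)

theorem toReal_holderConjugate {p q : ℝ≥0∞} (h : p⁻¹ + q⁻¹ = 1) (hp : p ≠ ∞) (hq : q ≠ ∞) :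
    p.toReal.HolderConjugate q.toReal := by
  have hp0 : p ≠ 0 := by rintro rfl; simp at h
  have hq0 : q ≠ 0 := by rintro rfl; simp at h
  have hs : p.toReal⁻¹ + q.toReal⁻¹ = 1 := by
    rw [← ENNReal.toReal_inv, ← ENNReal.toReal_inv, ← ENNReal.toReal_add (by simpa) (by simpa), h,
      ENNReal.toReal_one]
  have hp' := ENNReal.toReal_pos hp0 hp
  have hq' := ENNReal.toReal_pos hq0 hq
  rw [Real.holderConjugate_iff]
  refine ⟨?_, hs⟩
  rw [← inv_lt_one₀ hp']
  have := inv_pos.2 hq'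
  linarith

/-- Hölder's inequality for functions with values in `[0, ∞]`. -/
theorem lintegral_mul_le_eLpNorm_mul_eLpNorm {p q : ℝ≥0∞} (hpq : p⁻¹ + q⁻¹ = 1)
    {f g : α → ℝ≥0∞} (hf : AEMeasurable f μ) (hg : AEMeasurable g μ) :
    ∫⁻ x, f x * g x ∂μ ≤ eLpNorm f p μ * eLpNorm g q μ := by
  have top : ∀ {f g : α → ℝ≥0∞}, AEMeasurable g μ →
      ∫⁻ x, f x * g x ∂μ ≤ eLpNorm f ∞ μ * eLpNorm g 1 μ := by
    intro f g hg
    rw [eLpNorm_one_eq_lintegral_enorm]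
    simp only [enorm_eq_self]
    rw [← lintegral_const_mul'' _ hg]
    refine lintegral_mono_ae ((ae_le_eLpNorm_top f).mono fun x hx => ?_)
    gcongr
  rcases eq_or_ne p ∞ with rfl | hp
  · have : q = 1 := by simpa using hpq
    rw [this]
    exact top hg
  rcases eq_or_ne q ∞ with rfl | hq
  · have : p = 1 := by simpa using hpq
    rw [this, mul_comm]
    simp only [mul_comm (f _)]
    exact top hf
  have h := toReal_holderConjugate hpq hp hq
  have hp0 : p ≠ 0 := by rintro rfl; simp at hpq
  have hq0 : q ≠ 0 := by rintro rfl; simp at hpq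
  rw [eLpNorm_ennreal_eq hp0 hp, eLpNorm_ennreal_eq hq0 hq]
  exact ENNReal.lintegral_mul_le_Lp_mul_Lq μ h hf hg

/-- The converse of Hölder's inequality. -/
theorem eLpNorm_le_of_forall_lintegral_mul_le [SigmaFinite μ] {r r' : ℝ≥0∞}
    (hr : r⁻¹ + r'⁻¹ = 1) {F : α → ℝ≥0∞} (hF : Measurable F) {K : ℝ≥0∞}
    (h : ∀ g : α → ℝ≥0∞, Measurable g → ∫⁻ x, F x * g x ∂μ ≤ K * eLpNorm g r' μ) :
    eLpNorm F r μ ≤ K := by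
  -- The endpoints need their own test functions: indicators of measurable sets for `r = ∞`, the
  -- constant `1` for `r = 1`.
  rcases eq_or_ne r ∞ with rfl | hrt
  · have hr' : r' = 1 := by simpa using hr
    rw [eLpNorm_ennreal_top_le_iff]
    refine ae_le_of_forall_setLIntegral_le_of_sigmaFinite hF fun s hs _ => ?_
    have := h (s.indicator 1) (measurable_one.indicator hs)
    rw [hr', eLpNorm_one_eq_lintegral_enorm] at this
    simp only [enorm_eq_self] at this
    rw [lintegral_indicator_one hs] at this
    rw [setLIntegral_const, ← lintegral_indicator hs]
    convert this using 3 with x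
    by_cases hx : x ∈ s <;> simp [hx]
  rcases eq_or_ne r' ∞ with rfl | hrt'
  · have hr' : r = 1 := by simpa using hr
    have h1 := h 1 measurable_one
    rw [hr', eLpNorm_one_eq_lintegral_enorm]
    simp only [enorm_eq_self]
    refine (by simpa using h1 : _ ≤ _).trans ((mul_le_mul_right (b := _) (c := 1) ?_ K).trans ?_)
    · rw [← eLpNorm_exponent_top, eLpNorm_ennreal_top_le_iff]
      simp
    · simp
  have hc := toReal_holderConjugate hr hrt hrt'
  have hr0 : r ≠ 0 := by rintro rfl; simp at hr
  have hr0' : r' ≠ 0 := by rintro rfl; simp at hr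
  set s := r.toReal
  set s' := r'.toReal
  have hs : 0 < s := hc.pos
  have hs' : 0 < s' := hc.symm.pos
  rw [eLpNorm_ennreal_eq hr0 hrt, one_div, ENNReal.rpow_inv_le_iff hs]
  -- Truncating in height and in support makes `∫ G n ^ s` finite. This is needed to divide by a
  -- power of it below; monotone convergence then recovers `F`.
  let G : ℕ → α → ℝ≥0∞ := fun n => (spanningSets μ n).indicator fun x => min (F x) n
  have hG : ∀ n, Measurable (G n) := fun n =>
    (hF.min measurable_const).indicator (measurableSet_spanningSets μ n)
  have hGF : ∀ n x, G n x ≤ F x := fun n x => by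
    by_cases hx : x ∈ spanningSets μ n <;> simp [G, hx]
  have hmono : ∀ x, Monotone fun n => G n x := by
    intro x m n hmn
    by_cases hx : x ∈ spanningSets μ m
    · have hx' := monotone_spanningSets μ hmn hx
      simp only [G, Set.indicator_of_mem hx, Set.indicator_of_mem hx']
      gcongr
    · simp [G, hx]
  have hlim : ∀ x, Filter.Tendsto (fun n => G n x) Filter.atTop (nhds (F x)) := by
    intro x
    have h1 : Filter.Tendsto (fun n : ℕ => min (F x) (n : ℝ≥0∞)) Filter.atTop
        (nhds (min (F x) ∞)) :=
      tendsto_const_nhds.min ENNReal.tendsto_nat_nhds_top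
    rw [min_eq_left le_top] at h1
    refine h1.congr' ?_
    obtain ⟨m, hm⟩ := Set.mem_iUnion.1 ((iUnion_spanningSets μ).symm ▸ Set.mem_univ x)
    filter_upwards [Filter.eventually_ge_atTop m] with n hn
    simp [G, monotone_spanningSets μ hn hm]
  have hI : ∀ n, ∫⁻ x, G n x ^ s ∂μ ≤ K ^ s := by
    intro n
    set I := ∫⁻ x, G n x ^ s ∂μ with hIdef
    have hfin : I ≠ ∞ := by
      refine ne_top_of_le_ne_top (b := (n : ℝ≥0∞) ^ s * μ (spanningSets μ n)) ?_ ?_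
      · exact ENNReal.mul_ne_top (ENNReal.rpow_ne_top_of_nonneg hs.le (by simp))
          (measure_spanningSets_lt_top μ n).ne
      · rw [← setLIntegral_const, ← lintegral_indicator (measurableSet_spanningSets μ n)]
        refine lintegral_mono fun x => ?_
        by_cases hx : x ∈ spanningSets μ n
        · simp only [G, Set.indicator_of_mem hx]
          gcongr
          exact min_le_right _ _
        · simp [G, hx, hs]
    rcases eq_or_ne I 0 with h0 | h0
    · rw [h0]; exact zero_le
    -- The extremal test function: `(s - 1) * s' = s`, so its `r'`-norm is `I ^ (1 / s')`.
    have h1 := h (fun x => G n x ^ (s - 1)) ((hG n).pow_const _)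
    rw [eLpNorm_ennreal_eq hr0' hrt'] at h1
    have e1 : ∀ x, (G n x ^ (s - 1)) ^ s' = G n x ^ s := fun x => by
      rw [← ENNReal.rpow_mul, hc.sub_one_mul_conj]
    have h2 : I ≤ ∫⁻ x, F x * G n x ^ (s - 1) ∂μ := by
      refine lintegral_mono fun x => ?_
      calc G n x ^ s = G n x ^ (1 + (s - 1)) := by ring_nf
        _ = G n x * G n x ^ (s - 1) := by
          rw [ENNReal.rpow_add_of_nonneg _ _ zero_le_one hc.sub_one_pos.le, ENNReal.rpow_one]
        _ ≤ _ := by gcongr; exact hGF n x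
    have h3 : I ≤ K * I ^ (1 / s') := by
      refine h2.trans (h1.trans ?_)
      change K * (∫⁻ x, (G n x ^ (s - 1)) ^ s' ∂μ) ^ (1 / s') ≤ _
      simp only [e1]
      exact le_rfl
    have h4 : I ^ (1 / s) ≤ K := by
      have e : I = I ^ (1 / s) * I ^ (1 / s') := by
        rw [← ENNReal.rpow_add _ _ h0 hfin, one_div, one_div, hc.inv_add_inv_eq_one,
          ENNReal.rpow_one]
      have hne : I ^ (1 / s') ≠ 0 := by simp [h0, hfin]
      have hne' : I ^ (1 / s') ≠ ∞ := ENNReal.rpow_ne_top_of_nonneg (by positivity) hfin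
      exact (ENNReal.mul_le_mul_iff_left hne hne').1 (e.symm.trans_le h3)
    rwa [one_div, ENNReal.rpow_inv_le_iff hs] at h4
  refine le_of_tendsto' (lintegral_tendsto_of_tendsto_of_monotone
    (f := fun n x => G n x ^ s) (fun n => ((hG n).pow_const s).aemeasurable) ?_ ?_) hI
  · exact Filter.Eventually.of_forall fun x m n hmn =>
      ENNReal.rpow_le_rpow (hmono x hmn) hs.le
  · exact Filter.Eventually.of_forall fun x =>
      (ENNReal.continuous_rpow_const.tendsto _).comp (hlim x)

theorem exists_conjExponent {r : ℝ≥0∞} (hr : 1 ≤ r) : ∃ r' : ℝ≥0∞, r⁻¹ + r'⁻¹ = 1 := by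
  refine ⟨(1 - r⁻¹)⁻¹, ?_⟩
  rw [inv_inv, add_tsub_cancel_of_le (by simpa using hr)]

/-- For a finite nonzero exponent this is Tonelli. At `∞`, the norm is at most `c` exactly when the
section of `{c < f}` is null, and the measure of a section depends measurably on the point. -/
theorem measurable_eLpNorm [SFinite μ] {f : α → β → ℝ≥0∞} (hf : Measurable (Function.uncurry f))
    (p : ℝ≥0∞) : Measurable fun y => eLpNorm (fun x => f x y) p μ := by
  rcases eq_or_ne p 0 with rfl | h0
  · simp
  rcases eq_or_ne p ∞ with rfl | ht
  · refine measurable_of_Iic fun c => ?_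
    have hs : MeasurableSet {z : β × α | c < f z.2 z.1} :=
      measurableSet_lt measurable_const (hf.comp measurable_swap)
    convert measurable_measure_prodMk_left (ν := μ) hs (measurableSet_singleton 0) using 1
    ext y
    simp only [Set.mem_preimage, Set.mem_Iic, eLpNorm_ennreal_top_le_iff, ae_iff, not_le,
      Set.mem_singleton_iff]
    exact Iff.rfl
  · simp only [eLpNorm_ennreal_eq h0 ht]
    exact ((hf.comp measurable_swap).pow_const p.toReal).lintegral_prod_right'.pow_const _

/-- Minkowski's integral inequality. -/
theorem eLpNorm_lintegral_le [SigmaFinite μ] [SFinite ν] {r : ℝ≥0∞} (hr : 1 ≤ r)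
    {f : α → β → ℝ≥0∞} (hf : Measurable (Function.uncurry f)) :
    eLpNorm (fun x => ∫⁻ y, f x y ∂ν) r μ ≤ ∫⁻ y, eLpNorm (fun x => f x y) r μ ∂ν := by
  obtain ⟨r', hr'⟩ := exists_conjExponent hr
  -- By duality it suffices to pair with `g`; Tonelli then reduces the claim to Hölder for each
  -- fixed `y`.
  refine eLpNorm_le_of_forall_lintegral_mul_le hr' hf.lintegral_prod_right' fun g hg => ?_
  have hfx : ∀ x, Measurable (f x) := fun x => hf.comp measurable_prodMk_left
  have hfy : ∀ y, Measurable fun x => f x y := fun y => hf.comp measurable_prodMk_right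
  calc ∫⁻ x, (∫⁻ y, f x y ∂ν) * g x ∂μ
      = ∫⁻ x, ∫⁻ y, f x y * g x ∂ν ∂μ := by
        simp only [lintegral_mul_const _ (hfx _)]
    _ = ∫⁻ y, ∫⁻ x, f x y * g x ∂μ ∂ν :=
        lintegral_lintegral_swap (hf.mul (hg.comp measurable_fst)).aemeasurable
    _ ≤ ∫⁻ y, eLpNorm (fun x => f x y) r μ * eLpNorm g r' μ ∂ν :=
        lintegral_mono fun y => lintegral_mul_le_eLpNorm_mul_eLpNorm hr'
          (hfy y).aemeasurable hg.aemeasurable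
    _ ≤ _ := by
        rw [lintegral_mul_const _ (measurable_eLpNorm hf r)]

end Lebesgue

/-! ### Young's inequality, plain and for mixed norms -/

section Convolution

variable {G : Type*} [MeasurableSpace G] [AddCommGroup G] [MeasurableAdd₂ G] [MeasurableNeg G]
  {μ : Measure G} [SigmaFinite μ] [μ.IsAddLeftInvariant] [μ.IsNegInvariant]

/-- Young's convolution inequality. -/
theorem eLpNorm_lconvolution_le {a b r : ℝ≥0∞} (ha : 1 ≤ a) (hb : 1 ≤ b)
    (habr : a⁻¹ + b⁻¹ = 1 + r⁻¹) {f g : G → ℝ≥0∞} (hf : Measurable f) (hg : Measurable g) :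
    eLpNorm (fun x => ∫⁻ y, f (x - y) * g y ∂μ) r μ ≤ eLpNorm f a μ * eLpNorm g b μ := by
  have hfs : ∀ x, Measurable fun y => f (x - y) := fun x =>
    hf.comp (measurable_const.sub measurable_id)
  rcases eq_or_ne r ∞ with rfl | hr
  · rw [eLpNorm_ennreal_top_le_iff]
    refine Filter.Eventually.of_forall fun x => ?_
    refine (lintegral_mul_le_eLpNorm_mul_eLpNorm (p := a) (q := b) (by simpa using habr)
      (hfs x).aemeasurable hg.aemeasurable).trans_eq ?_
    congr 1
    exact eLpNorm_comp_measurePreserving hf.aestronglyMeasurable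
      (Measure.measurePreserving_sub_left μ x)
  have ha1 : a⁻¹ ≤ 1 := by simpa using ha
  have hb1 : b⁻¹ ≤ 1 := by simpa using hb
  have hr0 : r ≠ 0 := by
    rintro rfl
    have : a⁻¹ + b⁻¹ ≤ 1 + 1 := add_le_add ha1 hb1
    rw [habr] at this
    simp at this
  have hra : r⁻¹ ≤ a⁻¹ := by
    have : 1 + r⁻¹ ≤ 1 + a⁻¹ := by rw [← habr, add_comm]; gcongr
    exact (ENNReal.add_le_add_iff_left (by simp)).1 this
  have hrb : r⁻¹ ≤ b⁻¹ := by
    have : 1 + r⁻¹ ≤ 1 + b⁻¹ := by rw [← habr]; gcongr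
    exact (ENNReal.add_le_add_iff_left (by simp)).1 this
  have hat : a ≠ ∞ := by rintro rfl; simp at hra; exact hr hra
  have hbt : b ≠ ∞ := by rintro rfl; simp at hrb; exact hr hrb
  have ha0 : a ≠ 0 := (zero_lt_one.trans_le ha).ne'
  have hb0 : b ≠ 0 := (zero_lt_one.trans_le hb).ne'
  have hA : 0 < a.toReal := ENNReal.toReal_pos ha0 hat
  have hB : 0 < b.toReal := ENNReal.toReal_pos hb0 hbt
  have hR : 0 < r.toReal := ENNReal.toReal_pos hr0 hr
  have hRA : r.toReal⁻¹ ≤ a.toReal⁻¹ := by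
    rw [← ENNReal.toReal_inv, ← ENNReal.toReal_inv]
    exact ENNReal.toReal_mono (by simpa) hra
  have hRB : r.toReal⁻¹ ≤ b.toReal⁻¹ := by
    rw [← ENNReal.toReal_inv, ← ENNReal.toReal_inv]
    exact ENNReal.toReal_mono (by simpa) hrb
  have hsum : a.toReal⁻¹ + b.toReal⁻¹ = 1 + r.toReal⁻¹ := by
    rw [← ENNReal.toReal_inv, ← ENNReal.toReal_inv, ← ENNReal.toReal_inv,
      ← ENNReal.toReal_add (by simpa) (by simpa), habr, ENNReal.toReal_add (by simp) (by simpa),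
      ENNReal.toReal_one]
  rw [eLpNorm_ennreal_eq hr0 hr, eLpNorm_ennreal_eq ha0 hat, eLpNorm_ennreal_eq hb0 hbt]
  set A := a.toReal
  set B := b.toReal
  set R := r.toReal
  set X := ∫⁻ x, f x ^ A ∂μ with hX
  set Y := ∫⁻ x, g x ^ B ∂μ with hY
  let c : G → ℝ≥0∞ := fun x => ∫⁻ y, f (x - y) ^ A * g y ^ B ∂μ
  have hXs : ∀ x, ∫⁻ y, f (x - y) ^ A ∂μ = X := fun x =>
    lintegral_sub_left_eq_self (fun z => f z ^ A) x
  have hpt : ∀ x, ∫⁻ y, f (x - y) * g y ∂μ ≤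
      c x ^ R⁻¹ * (X ^ (A⁻¹ - R⁻¹) * Y ^ (B⁻¹ - R⁻¹)) := by
    intro x
    -- Three-factor Hölder for `f g = (f^A g^B)^(1/R) (f^A)^(1/A - 1/R) (g^B)^(1/B - 1/R)`. The
    -- weights sum to `1/A + 1/B - 1/R = 1`.
    have h := ENNReal.lintegral_prod_norm_pow_le (μ := μ) (Finset.univ : Finset (Fin 3))
      (f := ![fun y => f (x - y) ^ A * g y ^ B, fun y => f (x - y) ^ A, fun y => g y ^ B])
      (p := ![R⁻¹, A⁻¹ - R⁻¹, B⁻¹ - R⁻¹]) (by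
        intro i _
        fin_cases i
        · exact (((hfs x).pow_const A).mul (hg.pow_const B)).aemeasurable
        · exact ((hfs x).pow_const A).aemeasurable
        · exact (hg.pow_const B).aemeasurable)
      (by simp [Fin.sum_univ_three]; linarith)
      (by
        intro i _
        fin_cases i
        · exact (inv_pos.2 hR).le
        · exact sub_nonneg.2 hRA
        · exact sub_nonneg.2 hRB)
    simp only [Fin.prod_univ_three, Matrix.cons_val_zero, Matrix.cons_val_one,
      Matrix.cons_val, hXs] at h
    rw [mul_assoc] at h
    refine le_trans (lintegral_mono fun y => le_of_eq ?_) h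
    have key : ∀ (w : ℝ≥0∞) {T : ℝ}, 0 < T → R⁻¹ ≤ T⁻¹ →
        (w ^ T) ^ R⁻¹ * (w ^ T) ^ (T⁻¹ - R⁻¹) = w := by
      intro w T hT hRT
      rw [← ENNReal.rpow_add_of_nonneg _ _ (inv_pos.2 hR).le (sub_nonneg.2 hRT),
        add_sub_cancel, ENNReal.rpow_rpow_inv hT.ne']
    rw [ENNReal.mul_rpow_of_nonneg _ _ (inv_pos.2 hR).le]
    nth_rewrite 1 [← key (f (x - y)) hA hRA, ← key (g y) hB hRB]
    ring
  have hc : ∫⁻ x, c x ∂μ = X * Y := by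
    have hm : Measurable (fun z : G × G => f (z.1 - z.2) ^ A * g z.2 ^ B) :=
      ((hf.comp (measurable_fst.sub measurable_snd)).pow_const A).mul
        ((hg.comp measurable_snd).pow_const B)
    rw [lintegral_lintegral_swap hm.aemeasurable]
    have : ∀ y, ∫⁻ x, f (x - y) ^ A * g y ^ B ∂μ = X * g y ^ B := fun y => by
      have hfy : Measurable fun x => f (x - y) ^ A := (hf.comp (measurable_sub_const y)).pow_const A
      rw [lintegral_mul_const _ hfy,
        lintegral_sub_right_eq_self (fun z => f z ^ A) y]
    simp only [this]
    rw [lintegral_const_mul _ (hg.pow_const B)]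
  have hcm : Measurable c := by
    have hm : Measurable (fun z : G × G => f (z.1 - z.2) ^ A * g z.2 ^ B) :=
      ((hf.comp (measurable_fst.sub measurable_snd)).pow_const A).mul
        ((hg.comp measurable_snd).pow_const B)
    exact hm.lintegral_prod_right'
  set M := X ^ (A⁻¹ - R⁻¹) * Y ^ (B⁻¹ - R⁻¹) with hM
  calc (∫⁻ x, (∫⁻ y, f (x - y) * g y ∂μ) ^ R ∂μ) ^ (1 / R)
      ≤ (∫⁻ x, c x * M ^ R ∂μ) ^ (1 / R) := by
        gcongr with x
        refine (ENNReal.rpow_le_rpow (hpt x) hR.le).trans_eq ?_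
        rw [ENNReal.mul_rpow_of_nonneg _ _ hR.le, ENNReal.rpow_inv_rpow hR.ne']
    _ = (X * Y * M ^ R) ^ (1 / R) := by rw [lintegral_mul_const _ hcm, hc]
    _ = X ^ (1 / A) * Y ^ (1 / B) := by
        have hRi : 0 ≤ 1 / R := by positivity
        rw [ENNReal.mul_rpow_of_nonneg _ _ hRi, ENNReal.mul_rpow_of_nonneg _ _ hRi, one_div,
          ENNReal.rpow_rpow_inv hR.ne', hM]
        have e1 : X ^ (1 / A) = X ^ R⁻¹ * X ^ (A⁻¹ - R⁻¹) := by
          rw [← ENNReal.rpow_add_of_nonneg _ _ (inv_pos.2 hR).le (sub_nonneg.2 hRA),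
            add_sub_cancel, one_div]
        have e2 : Y ^ (1 / B) = Y ^ R⁻¹ * Y ^ (B⁻¹ - R⁻¹) := by
          rw [← ENNReal.rpow_add_of_nonneg _ _ (inv_pos.2 hR).le (sub_nonneg.2 hRB),
            add_sub_cancel, one_div]
        rw [e1, e2]
        ring

variable {H : Type*} [MeasurableSpace H] [AddCommGroup H] [MeasurableAdd₂ H] [MeasurableNeg H]
  {ν : Measure H} [SigmaFinite ν] [ν.IsAddLeftInvariant] [ν.IsNegInvariant]

/-- Young's convolution inequality for mixed norms. -/
theorem mixed_lconvolution_le {a₁ b₁ r₁ a₂ b₂ r₂ : ℝ≥0∞} (ha₁ : 1 ≤ a₁) (hb₁ : 1 ≤ b₁)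
    (hr₁ : 1 ≤ r₁) (h₁ : a₁⁻¹ + b₁⁻¹ = 1 + r₁⁻¹) (ha₂ : 1 ≤ a₂) (hb₂ : 1 ≤ b₂)
    (h₂ : a₂⁻¹ + b₂⁻¹ = 1 + r₂⁻¹) {f g : G → H → ℝ≥0∞}
    (hf : Measurable (Function.uncurry f)) (hg : Measurable (Function.uncurry g)) :
    eLpNorm (fun ξ => eLpNorm (fun x => ∫⁻ η, ∫⁻ y, f (x - y) (ξ - η) * g y η ∂μ ∂ν) r₁ μ) r₂ ν ≤
      eLpNorm (fun ξ => eLpNorm (fun x => f x ξ) a₁ μ) a₂ ν *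
        eLpNorm (fun ξ => eLpNorm (fun x => g x ξ) b₁ μ) b₂ ν := by
  have hfs : ∀ ξ, Measurable fun x => f x ξ := fun ξ => hf.comp measurable_prodMk_right
  have hgs : ∀ ξ, Measurable fun x => g x ξ := fun ξ => hg.comp measurable_prodMk_right
  -- Minkowski takes the `η`-integral out of the inner norm, and Young on `G` applies for each `η`.
  -- What remains is a convolution on `H` of the inner norms, to which Young applies once more.
  have hconv : ∀ ξ, eLpNorm (fun x => ∫⁻ η, ∫⁻ y, f (x - y) (ξ - η) * g y η ∂μ ∂ν) r₁ μ ≤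
      ∫⁻ η, eLpNorm (fun x => f x (ξ - η)) a₁ μ * eLpNorm (fun x => g x η) b₁ μ ∂ν := by
    intro ξ
    have hm1 : Measurable fun w : (G × H) × G => f (w.1.1 - w.2) (ξ - w.1.2) :=
      hf.comp (f := fun w : (G × H) × G => (w.1.1 - w.2, ξ - w.1.2)) (by fun_prop)
    have hm2 : Measurable fun w : (G × H) × G => g w.2 w.1.2 :=
      hg.comp (f := fun w : (G × H) × G => (w.2, w.1.2)) (by fun_prop)
    have hm : Measurable (Function.uncurry fun x η => ∫⁻ y, f (x - y) (ξ - η) * g y η ∂μ) :=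
      (hm1.mul hm2).lintegral_prod_right'
    refine (eLpNorm_lintegral_le hr₁ hm).trans (lintegral_mono fun η => ?_)
    exact eLpNorm_lconvolution_le (f := fun x => f x (ξ - η)) (g := fun x => g x η) (μ := μ)
      ha₁ hb₁ h₁ (hfs (ξ - η)) (hgs η)
  have hfm := measurable_eLpNorm (μ := μ) hf a₁
  have hgm := measurable_eLpNorm (μ := μ) hg b₁
  have hY := eLpNorm_lconvolution_le (μ := ν) ha₂ hb₂ h₂ hfm hgm
  exact (eLpNorm_mono_ennreal hconv).trans hY

end Convolution

end TFA

namespace TFA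

open scoped ContDiff LineDeriv BoundedContinuousFunction

/-! ### Tensor products of Schwartz functions -/

section Tensor

variable {E F : Type*} [NormedAddCommGroup E] [NormedSpace ℝ E]
  [NormedAddCommGroup F] [NormedSpace ℝ F]

theorem norm_iteratedFDeriv_comp_le_of_norm_le_one (φ : 𝓢(F, ℂ)) (L : E →L[ℝ] F) (hL : ‖L‖ ≤ 1)
    (n : ℕ) (z : E) :
    ‖iteratedFDeriv ℝ n (fun z => φ (L z)) z‖ ≤ ‖iteratedFDeriv ℝ n φ (L z)‖ := by
  have e : (fun z => φ (L z)) = φ ∘ L := rfl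
  rw [e, ContinuousLinearMap.iteratedFDeriv_comp_right _ (φ.smooth n) z le_rfl]
  refine (ContinuousMultilinearMap.norm_compContinuousLinearMap_le _ _).trans ?_
  exact mul_le_of_le_one_right (norm_nonneg _)
    (Finset.prod_le_one (fun _ _ => norm_nonneg _) fun _ _ => hL)

/-- The tensor product `(x, y) ↦ φ x * ψ y` of two Schwartz functions. -/
noncomputable def tensor (φ : 𝓢(E, ℂ)) (ψ : 𝓢(F, ℂ)) : 𝓢(E × F, ℂ) where
  toFun z := φ z.1 * ψ z.2
  smooth' := ((φ.smooth ⊤).comp contDiff_fst).mul ((ψ.smooth ⊤).comp contDiff_snd)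
  decay' k n := by
    let s := fun k n => SchwartzMap.seminorm ℝ k n φ
    let t := fun k n => SchwartzMap.seminorm ℝ k n ψ
    -- Leibniz bound. The product norm is a maximum, so `‖z‖ ^ k` is at most the sum of the two
    -- separate powers, and each of these is absorbed by one factor.
    refine ⟨∑ i ∈ Finset.range (n + 1), (n.choose i : ℝ) *
      (s k i * t 0 (n - i) + s 0 i * t k (n - i)), fun z => ?_⟩
    have h1 : ContDiff ℝ n fun z : E × F => φ z.1 := (φ.smooth n).comp contDiff_fst
    have h2 : ContDiff ℝ n fun z : E × F => ψ z.2 := (ψ.smooth n).comp contDiff_snd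
    have hz : ‖z‖ ^ k ≤ ‖z.1‖ ^ k + ‖z.2‖ ^ k := by
      rw [Prod.norm_def]
      rcases max_cases ‖z.1‖ ‖z.2‖ with ⟨e, _⟩ | ⟨e, _⟩ <;> rw [e] <;> simp
    calc ‖z‖ ^ k * ‖iteratedFDeriv ℝ n (fun z : E × F => φ z.1 * ψ z.2) z‖
        ≤ ‖z‖ ^ k * ∑ i ∈ Finset.range (n + 1), (n.choose i : ℝ) *
            ‖iteratedFDeriv ℝ i (fun z : E × F => φ z.1) z‖ *
            ‖iteratedFDeriv ℝ (n - i) (fun z : E × F => ψ z.2) z‖ := by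
          gcongr
          exact norm_iteratedFDeriv_mul_le h1 h2 z le_rfl
      _ = ∑ i ∈ Finset.range (n + 1), (n.choose i : ℝ) *
            (‖z‖ ^ k * (‖iteratedFDeriv ℝ i (fun z : E × F => φ z.1) z‖ *
            ‖iteratedFDeriv ℝ (n - i) (fun z : E × F => ψ z.2) z‖)) := by
          rw [Finset.mul_sum]
          exact Finset.sum_congr rfl fun i _ => by ring
      _ ≤ _ := by
          refine Finset.sum_le_sum fun i _ => ?_
          gcongr
          have a1 : ‖iteratedFDeriv ℝ i (fun z : E × F => φ z.1) z‖ ≤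
              ‖iteratedFDeriv ℝ i φ z.1‖ :=
            norm_iteratedFDeriv_comp_le_of_norm_le_one φ (ContinuousLinearMap.fst ℝ E F)
              (ContinuousLinearMap.norm_fst_le ℝ E F) i z
          have a2 : ‖iteratedFDeriv ℝ (n - i) (fun z : E × F => ψ z.2) z‖ ≤
              ‖iteratedFDeriv ℝ (n - i) ψ z.2‖ :=
            norm_iteratedFDeriv_comp_le_of_norm_le_one ψ (ContinuousLinearMap.snd ℝ E F)
              (ContinuousLinearMap.norm_snd_le ℝ E F) (n - i) z
          have b1 := φ.le_seminorm ℝ k i z.1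
          have b2 := φ.norm_iteratedFDeriv_le_seminorm ℝ i z.1
          have b3 := ψ.le_seminorm ℝ k (n - i) z.2
          have b4 := ψ.norm_iteratedFDeriv_le_seminorm ℝ (n - i) z.2
          calc ‖z‖ ^ k * (‖iteratedFDeriv ℝ i (fun z : E × F => φ z.1) z‖ *
              ‖iteratedFDeriv ℝ (n - i) (fun z : E × F => ψ z.2) z‖)
              ≤ (‖z.1‖ ^ k + ‖z.2‖ ^ k) * (‖iteratedFDeriv ℝ i φ z.1‖ *
                ‖iteratedFDeriv ℝ (n - i) ψ z.2‖) := by gcongr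
            _ = (‖z.1‖ ^ k * ‖iteratedFDeriv ℝ i φ z.1‖) * ‖iteratedFDeriv ℝ (n - i) ψ z.2‖ +
                ‖iteratedFDeriv ℝ i φ z.1‖ * (‖z.2‖ ^ k * ‖iteratedFDeriv ℝ (n - i) ψ z.2‖) := by
              ring
            _ ≤ s k i * t 0 (n - i) + s 0 i * t k (n - i) := by
              gcongr

@[simp]
theorem tensor_apply (φ : 𝓢(E, ℂ)) (ψ : 𝓢(F, ℂ)) (z : E × F) :
    tensor φ ψ z = φ z.1 * ψ z.2 := rfl

end Tensor

/-! ### Algebra and growth of characters -/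

section Character

variable {E : Type*} [NormedAddCommGroup E] [InnerProductSpace ℝ E]
  {V : Type*} [NormedAddCommGroup V] [NormedSpace ℝ V]

/-- The pairing enters only through the inner product, so this is the one-dimensional character
composed with a bilinear map. Frequency and time may vary together, as `shiftFamily` requires. -/
theorem character_comp_hasTemperateGrowth (L M : V →L[ℝ] E) :
    (fun w => character (L w) (M w)).HasTemperateGrowth := by
  have h1 : (fun w => inner ℝ (L w) (M w)).HasTemperateGrowth :=
    (innerSL ℝ (E := E)).bilinear_hasTemperateGrowth L.hasTemperateGrowth M.hasTemperateGrowth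
  have h2 := (character_hasTemperateGrowth (1 : ℝ)).comp h1
  convert h2 using 1
  funext w
  simp [character]

theorem character_add_left (ξ η t : E) : character (ξ + η) t = character ξ t * character η t := by
  simp only [character, inner_add_left, ← Complex.exp_add]
  congr 1
  push_cast
  ring

theorem character_add_right (ξ s t : E) : character ξ (s + t) = character ξ s * character ξ t := by
  simp only [character, inner_add_right, ← Complex.exp_add]
  congr 1
  push_cast
  ring

theorem character_comm (ξ t : E) : character ξ t = character t ξ := by
  simp only [character, real_inner_comm]

theorem character_neg_left (ξ t : E) : character (-ξ) t = (starRingEnd ℂ) (character ξ t) := by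
  simp only [character, inner_neg_left, ← Complex.exp_conj]
  congr 1
  simp [map_ofNat (starRingEnd ℂ) 2]

theorem character_neg_right (ξ t : E) : character ξ (-t) = (starRingEnd ℂ) (character ξ t) := by
  rw [character_comm, character_neg_left, character_comm]

end Character

/-! ### Tempered distributions commute with parameter integrals -/

section Fubini

variable {W F : Type*} [NormedAddCommGroup W] [NormedSpace ℝ W]
  [NormedAddCommGroup F] [NormedSpace ℝ F]

/-- Moving the parameter amounts to translating `Ψ` in its first variable, so every seminorm of the
difference is controlled by the Taylor remainder `translation_remainder` and the first derivative.
-/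
theorem continuous_slice (Ψ : 𝓢(W × F, ℂ)) : Continuous fun w => slice w Ψ := by
  rw [continuous_iff_continuousAt]
  intro w
  rw [ContinuousAt, (schwartz_withSeminorms ℂ F ℂ).tendsto_nhds]
  rintro ⟨k, n⟩ ε hε
  obtain ⟨C, hC, hrem⟩ := translation_remainder Ψ k n
  have hlim : Filter.Tendsto (fun v : W => C * ‖v - w‖ ^ 2 +
      ‖v - w‖ * SchwartzMap.seminorm ℂ k (n + 1) Ψ) (nhds w) (nhds 0) := by
    have : Continuous (fun v : W => C * ‖v - w‖ ^ 2 +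
      ‖v - w‖ * SchwartzMap.seminorm ℂ k (n + 1) Ψ) := by fun_prop
    simpa using this.tendsto w
  filter_upwards [hlim.eventually_lt_const hε, Metric.closedBall_mem_nhds w one_pos] with v hv hv1
  refine lt_of_le_of_lt ?_ hv
  have hva : ‖v - w‖ ≤ 1 := by simpa [dist_eq_norm] using hv1
  set a : W × F := (v - w, 0)
  have ha : ‖a‖ = ‖v - w‖ := by simp [a, Prod.norm_def]
  have e : slice v Ψ - slice w Ψ = slice w (compSubConstCLM ℂ (-a) Ψ - Ψ) := by
    rw [map_sub, ← slice_add, add_sub_cancel]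
  rw [e, schwartzSeminormFamily_apply]
  have h1 := norm_pow_mul_seminorm_slice_le 0 k n w (compSubConstCLM ℂ (-a) Ψ - Ψ)
  rw [pow_zero, one_mul, zero_add] at h1
  refine h1.trans ?_
  have e2 : compSubConstCLM ℂ (-a) Ψ - Ψ =
      (compSubConstCLM ℂ (-a) Ψ - Ψ - ∂_{a} Ψ) + ∂_{a} Ψ := by abel
  rw [e2]
  refine (map_add_le_add _ _ _).trans (add_le_add ?_ ?_)
  · rw [← ha]
    exact hrem a (ha.trans_le hva)
  · rw [← ha]
    exact seminorm_lineDeriv_le Ψ a k n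

/-- The Banach space of bounded continuous functions with values in `n`-linear forms. -/
def DerivSpace (F : Type*) [NormedAddCommGroup F] [NormedSpace ℝ F] (n : ℕ) : Type _ :=
  F →ᵇ F [×n]→L[ℝ] ℂ

noncomputable instance (n : ℕ) : NormedAddCommGroup (DerivSpace F n) :=
  inferInstanceAs (NormedAddCommGroup (F →ᵇ F [×n]→L[ℝ] ℂ))

noncomputable instance (n : ℕ) : NormedSpace ℂ (DerivSpace F n) :=
  inferInstanceAs (NormedSpace ℂ (F →ᵇ F [×n]→L[ℝ] ℂ))

instance (n : ℕ) : CompleteSpace (DerivSpace F n) :=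
  inferInstanceAs (CompleteSpace (F →ᵇ F [×n]→L[ℝ] ℂ))

/-- Evaluation of a function with values in `n`-linear forms at a point and `n` vectors. -/
noncomputable def derivEval {n : ℕ} (t : F) (m : Fin n → F) : DerivSpace F n →L[ℂ] ℂ :=
  LinearMap.mkContinuous
    { toFun := fun u : F →ᵇ F [×n]→L[ℝ] ℂ => u t m
      map_add' := fun u v => rfl
      map_smul' := fun c u => rfl } (∏ i, ‖m i‖) fun u => by
    rw [mul_comm]
    exact (((show F →ᵇ F [×n]→L[ℝ] ℂ from u) t).le_opNorm m).trans
      (mul_le_mul_of_nonneg_right (BoundedContinuousFunction.norm_coe_le_norm _ t) (by positivity))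

theorem derivSpace_ext {n : ℕ} {u v : DerivSpace F n}
    (h : ∀ t m, derivEval t m u = derivEval t m v) :
    u = v :=
  BoundedContinuousFunction.ext fun t => ContinuousMultilinearMap.ext fun m => h t m

/-- The weighted `n`-th derivative `t ↦ ‖t‖ ^ k • D^n φ(t)` of a Schwartz function, as a bounded
continuous function. -/
noncomputable def weightedDerivFun (k n : ℕ) (φ : 𝓢(F, ℂ)) : DerivSpace F n :=
  BoundedContinuousFunction.ofNormedAddCommGroup
    (fun t => (‖t‖ ^ k) • iteratedFDeriv ℝ n φ t)
    ((continuous_norm.pow k).smul ((φ.smooth n).continuous_iteratedFDeriv le_rfl))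
    (SchwartzMap.seminorm ℂ k n φ) fun t => by
      rw [norm_smul, norm_pow, norm_norm]
      exact φ.le_seminorm ℂ k n t

theorem derivEval_weightedDerivFun (k n : ℕ) (φ : 𝓢(F, ℂ)) (t : F) (m : Fin n → F) :
    derivEval t m (weightedDerivFun k n φ) = (‖t‖ ^ k : ℝ) • (∂^{m} φ) t := by
  rw [iteratedLineDerivOp_eq_iteratedFDeriv]
  rfl

theorem norm_weightedDerivFun_le (k n : ℕ) (φ : 𝓢(F, ℂ)) :
    ‖weightedDerivFun k n φ‖ ≤ SchwartzMap.seminorm ℂ k n φ :=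
  BoundedContinuousFunction.norm_ofNormedAddCommGroup_le _ (apply_nonneg _ _) _

/-- The weighted `n`-th derivative as a continuous linear map. -/
noncomputable def weightedDeriv (F : Type*) [NormedAddCommGroup F] [NormedSpace ℝ F] (k n : ℕ) :
    𝓢(F, ℂ) →L[ℂ] DerivSpace F n :=
  letI : NormedSpace ℝ (DerivSpace F n) := NormedSpace.restrictScalars ℝ ℂ _
  mkCLMtoNormedSpace (σ := RingHom.id ℂ) (weightedDerivFun k n)
    (fun φ ψ => derivSpace_ext fun t m => by
      simp only [map_add, derivEval_weightedDerivFun, LineDeriv.iteratedLineDerivOp_add, add_apply,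
        smul_add])
    (fun c φ => derivSpace_ext fun t m => by
      simp only [map_smul, derivEval_weightedDerivFun, LineDeriv.iteratedLineDerivOp_smul,
        smul_apply, RingHom.id_apply, smul_comm c])
    ⟨{(k, n)}, 1, zero_le_one, fun φ => by
      rw [one_mul, Finset.sup_singleton]
      exact norm_weightedDerivFun_le k n φ⟩

theorem derivEval_weightedDeriv (k n : ℕ) (φ : 𝓢(F, ℂ)) (t : F) (m : Fin n → F) :
    derivEval t m (weightedDeriv F k n φ) = (‖t‖ ^ k : ℝ) • (∂^{m} φ) t :=
  derivEval_weightedDerivFun k n φ t m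

theorem seminorm_le_norm_weightedDeriv (k n : ℕ) (φ : 𝓢(F, ℂ)) :
    SchwartzMap.seminorm ℂ k n φ ≤ ‖weightedDeriv F k n φ‖ := by
  refine seminorm_le_bound ℂ k n φ (norm_nonneg (weightedDeriv F k n φ)) fun t => ?_
  have : ‖(‖t‖ ^ k) • iteratedFDeriv ℝ n φ t‖ ≤ ‖weightedDeriv F k n φ‖ :=
    BoundedContinuousFunction.norm_coe_le_norm (weightedDeriv F k n φ : F →ᵇ F [×n]→L[ℝ] ℂ) t
  rwa [norm_smul, norm_pow, norm_norm] at this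

theorem hasDerivAt_line (φ : 𝓢(F, ℂ)) (t a : F) (r : ℝ) :
    HasDerivAt (fun r : ℝ => φ (t + r • a)) ((∂_{a} φ) (t + r • a)) r := by
  rw [lineDerivOp_apply_eq_fderiv]
  have h1 : HasDerivAt (fun r : ℝ => t + r • a) a r := by
    simpa using ((hasDerivAt_id r).smul_const a).const_add t
  exact (φ.hasFDerivAt (t + r • a)).comp_hasDerivAt r h1

theorem slice_lineDeriv (w : W) (a : F) (Ψ : 𝓢(W × F, ℂ)) :
    slice w (∂_{((0 : W), a)} Ψ) = ∂_{a} (slice w Ψ) := by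
  ext t
  have h1 := hasDerivAt_line (slice w Ψ) t a 0
  have h2 := hasDerivAt_line Ψ (w, t) (0, a) 0
  have e : (fun r : ℝ => Ψ ((w, t) + r • ((0 : W), a))) = fun r => slice w Ψ (t + r • a) := by
    funext r
    simp
  rw [e] at h2
  simpa using h2.unique h1

theorem slice_iteratedLineDeriv (w : W) {n : ℕ} (m : Fin n → F) (Ψ : 𝓢(W × F, ℂ)) :
    slice w (∂^{fun i => ((0 : W), m i)} Ψ) = ∂^{m} (slice w Ψ) := by
  induction n with
  | zero => simp
  | succ n ih =>
    rw [LineDeriv.iteratedLineDerivOp_succ_left, LineDeriv.iteratedLineDerivOp_succ_left,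
      slice_lineDeriv]
    congr 1
    exact ih (Fin.tail m)

variable [MeasurableSpace W] [BorelSpace W] [SecondCountableTopology W] {μ : Measure W}
  [μ.HasTemperateGrowth]

/-- Continuity bounds `‖L φ‖` by finitely many Schwartz seminorms, and those of `slice w Ψ` decay
faster than any power of `‖w‖`. A measure of temperate growth integrates such a function. -/
theorem integrable_clm_slice {B : Type*} [NormedAddCommGroup B] [NormedSpace ℂ B]
    (L : 𝓢(F, ℂ) →L[ℂ] B) (Ψ : 𝓢(W × F, ℂ)) : Integrable (fun w => L (slice w Ψ)) μ := by
  obtain ⟨s, C, -, h⟩ := Seminorm.bound_of_continuous (schwartz_withSeminorms ℂ F ℂ)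
    ((normSeminorm ℂ B).comp (L : 𝓢(F, ℂ) →ₗ[ℂ] B)) (continuous_norm.comp L.continuous)
  have hb : ∀ (j : ℕ) (w : W), ‖w‖ ^ j * ‖L (slice w Ψ)‖ ≤
      C * ∑ i ∈ s, SchwartzMap.seminorm ℂ (j + i.1) i.2 Ψ := by
    intro j w
    calc ‖w‖ ^ j * ‖L (slice w Ψ)‖
        ≤ ‖w‖ ^ j * (C * ∑ i ∈ s, SchwartzMap.seminorm ℂ i.1 i.2 (slice w Ψ)) := by
          refine mul_le_mul_of_nonneg_left ((h _).trans ?_) (by positivity)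
          refine mul_le_mul_of_nonneg_left ?_ C.2
          have := Seminorm.finset_sup_le_sum (schwartzSeminormFamily ℂ F ℂ) s (slice w Ψ)
          rwa [sum_apply] at this
      _ = C * ∑ i ∈ s, ‖w‖ ^ j * SchwartzMap.seminorm ℂ i.1 i.2 (slice w Ψ) := by
          rw [← Finset.mul_sum]; ring
      _ ≤ _ := by
          gcongr with i hi
          exact norm_pow_mul_seminorm_slice_le j i.1 i.2 w Ψ
  have hm : AEStronglyMeasurable (fun w => L (slice w Ψ)) μ :=
    (L.continuous.comp (continuous_slice Ψ)).aestronglyMeasurable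
  have := integrable_of_le_of_pow_mul_le (k := 0) (fun w => by simpa using hb 0 w)
    (hb (0 + μ.integrablePower)) hm
  simp only [pow_zero, one_mul] at this
  exact (integrable_norm_iff hm).1 this

/-- A linear functional dominated by the norm of a linear map `L` to a normed space factors through
`L`. -/
theorem exists_factor_of_le {V B : Type*} [AddCommGroup V] [Module ℂ V] [NormedAddCommGroup B]
    [NormedSpace ℂ B] (L : V →ₗ[ℂ] B) (hL : Function.Injective L) (f : V →ₗ[ℂ] ℂ) (C : ℝ)
    (h : ∀ v, ‖f v‖ ≤ C * ‖L v‖) : ∃ G : StrongDual ℂ B, ∀ v, G (L v) = f v := by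
  let e := LinearEquiv.ofInjective L hL
  let f₀ : StrongDual ℂ (LinearMap.range L) :=
    LinearMap.mkContinuous (f ∘ₗ e.symm.toLinearMap) C (by
      intro x
      obtain ⟨φ, rfl⟩ := e.surjective x
      simpa [e] using h φ)
  obtain ⟨G, hG, -⟩ := exists_extension_norm_eq _ f₀
  refine ⟨G, fun v => (hG (e v)).trans ?_⟩
  change f (e.symm (e v)) = f v
  rw [e.symm_apply_apply]

/-- The Schwartz space is not normed, so the Bochner integral is taken in `B`. There a continuous
functional extending `f` passes through the integral. -/
theorem dist_integral_slice_of_le {B : Type*} [NormedAddCommGroup B] [NormedSpace ℂ B]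
    [CompleteSpace B] (f : 𝓢'(F, ℂ)) (L : 𝓢(F, ℂ) →L[ℂ] B) (hL : Function.Injective L) (C : ℝ)
    (hC : ∀ φ, ‖f φ‖ ≤ C * ‖L φ‖) (Ψ : 𝓢(W × F, ℂ)) (Θ : 𝓢(F, ℂ))
    (h : L Θ = ∫ w, L (slice w Ψ) ∂μ) : f Θ = ∫ w, f (slice w Ψ) ∂μ := by
  obtain ⟨G, hG⟩ := exists_factor_of_le L.toLinearMap hL (f : 𝓢(F, ℂ) →ₗ[ℂ] ℂ) C hC
  have hG' : ∀ φ, G (L φ) = f φ := hG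
  rw [← hG', h, ← G.integral_comp_comm (integrable_clm_slice L Ψ)]
  simp only [hG']

/-- Differentiation under the integral sign. The dominating function is the sup norm of the slice of
the differentiated family, integrable by `integrable_clm_slice`. -/
theorem lineDeriv_integral_slice (Ψ : 𝓢(W × F, ℂ)) (Θ : 𝓢(F, ℂ))
    (h : ∀ t, Θ t = ∫ w, Ψ (w, t) ∂μ) (a t : F) :
    (∂_{a} Θ) t = ∫ w, (∂_{((0 : W), a)} Ψ) (w, t) ∂μ := by
  let T := toBoundedContinuousFunctionCLM ℂ F ℂ
  have hint : ∀ (Ξ : 𝓢(W × F, ℂ)) t, Integrable (fun w => Ξ (w, t)) μ := fun Ξ t => by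
    have := integrable_clm_slice (μ := μ) ((BoundedContinuousFunction.evalCLM ℂ t) ∘L T) Ξ
    exact this.congr (Filter.Eventually.of_forall fun w => slice_apply w Ξ t)
  have h1 := (hasDerivAt_integral_of_dominated_loc_of_deriv_le (μ := μ) (𝕜 := ℝ) (x₀ := 0)
    (F := fun r w => Ψ (w, t + r • a)) (F' := fun r w => (∂_{((0 : W), a)} Ψ) (w, t + r • a))
    (s := Set.univ) (bound := fun w => ‖T (slice w (∂_{((0 : W), a)} Ψ))‖) Filter.univ_mem
    (Filter.Eventually.of_forall fun r => (hint _ _).aestronglyMeasurable) (hint _ _)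
    (hint _ _).aestronglyMeasurable (Filter.Eventually.of_forall fun w r _ => ?_)
    (integrable_clm_slice T _).norm (Filter.Eventually.of_forall fun w r _ => ?_)).2
  · have h2 := hasDerivAt_line Θ t a 0
    simp only [h] at h2
    simpa using h2.unique h1
  · have := (T (slice w (∂_{((0 : W), a)} Ψ))).norm_coe_le_norm (t + r • a)
    simpa [T] using this
  · have := hasDerivAt_line (slice w Ψ) t a r
    rw [← slice_lineDeriv] at this
    simpa using this

theorem iteratedLineDeriv_integral_slice (Ψ : 𝓢(W × F, ℂ)) (Θ : 𝓢(F, ℂ))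
    (h : ∀ t, Θ t = ∫ w, Ψ (w, t) ∂μ) {n : ℕ} (m : Fin n → F) (t : F) :
    (∂^{m} Θ) t = ∫ w, (∂^{m} (slice w Ψ)) t ∂μ := by
  simp only [← slice_iteratedLineDeriv, slice_apply]
  induction n generalizing t with
  | zero => simpa using h t
  | succ n ih =>
    simp only [LineDeriv.iteratedLineDerivOp_succ_left]
    exact lineDeriv_integral_slice _ _ (fun t => ih (Fin.tail m) t) (m 0) t

/-- Tempered distributions commute with integrals depending on a parameter. -/
theorem dist_integral_slice (f : 𝓢'(F, ℂ)) (Ψ : 𝓢(W × F, ℂ)) (Θ : 𝓢(F, ℂ))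
    (h : ∀ t, Θ t = ∫ w, Ψ (w, t) ∂μ) : f Θ = ∫ w, f (slice w Ψ) ∂μ := by
  obtain ⟨s, C, -, hf⟩ := Seminorm.bound_of_continuous (schwartz_withSeminorms ℂ F ℂ)
    ((normSeminorm ℂ ℂ).comp (f : 𝓢(F, ℂ) →ₗ[ℂ] ℂ)) (continuous_norm.comp (map_continuous f))
  -- The index `(0, 0)` is added only to make `L` injective: its component records the values of the
  -- function.
  let s' := insert (0, 0) s
  let L : 𝓢(F, ℂ) →L[ℂ] (Π i : s', DerivSpace F i.1.2) :=
    ContinuousLinearMap.pi fun i => weightedDeriv F i.1.1 i.1.2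
  have hLs : ∀ φ, ‖f φ‖ ≤ C * ‖L φ‖ := by
    intro φ
    refine (hf φ).trans (mul_le_mul_of_nonneg_left ?_ C.2)
    refine Seminorm.finset_sup_apply_le (norm_nonneg (L φ)) fun i hi => ?_
    exact (seminorm_le_norm_weightedDeriv i.1 i.2 φ).trans
      (norm_le_pi_norm (L φ) ⟨i, Finset.mem_insert_of_mem hi⟩)
  have hinj : Function.Injective L := by
    intro φ ψ hφ
    ext t
    have h1 := congrFun hφ ⟨(0, 0), Finset.mem_insert_self _ _⟩
    have h2 : derivEval t 0 (weightedDeriv F 0 0 φ) = derivEval t 0 (weightedDeriv F 0 0 ψ) :=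
      congrArg (derivEval t 0) h1
    simpa [derivEval_weightedDeriv] using h2
  refine dist_integral_slice_of_le f L hinj C hLs Ψ Θ ?_
  have hint := integrable_clm_slice (μ := μ) L Ψ
  -- The identity in the Banach space is checked under the evaluations `derivEval`, which are
  -- continuous and therefore pass through the Bochner integral.
  funext i
  refine derivSpace_ext fun t m => ?_
  let ev : (Π i : s', DerivSpace F i.1.2) →L[ℂ] ℂ := derivEval t m ∘L ContinuousLinearMap.proj i
  have e1 : ev (∫ w, L (slice w Ψ) ∂μ) = ∫ w, ev (L (slice w Ψ)) ∂μ :=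
    (ev.integral_comp_comm hint).symm
  have e2 : ∀ φ, ev (L φ) = (‖t‖ ^ i.1.1 : ℝ) • (∂^{m} φ) t := fun φ =>
    derivEval_weightedDeriv i.1.1 i.1.2 φ t m
  change ev (L Θ) = ev (∫ w, L (slice w Ψ) ∂μ)
  rw [e1]
  simp only [e2]
  rw [integral_smul, iteratedLineDeriv_integral_slice Ψ Θ h]

end Fubini

end TFA

namespace TFA

open scoped ContDiff FourierTransform

/-! ### Reproducing formula and change of window -/

section Window

variable {E : Type*} [NormedAddCommGroup E] [InnerProductSpace ℝ E]

/-- The shear `(y, s) ↦ (s - y, s)`. -/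
noncomputable def shear (E : Type*) [NormedAddCommGroup E] [InnerProductSpace ℝ E] :
    (E × E) ≃L[ℝ] E × E where
  toFun w := (w.2 - w.1, w.2)
  invFun w := (w.2 - w.1, w.2)
  map_add' w w' := by ext <;> simp; abel
  map_smul' c w := by ext <;> simp [smul_sub]
  left_inv w := by ext <;> simp
  right_inv w := by ext <;> simp
  continuous_toFun := by fun_prop
  continuous_invFun := by fun_prop

/-- The shear `(w, t) ↦ (w, t - w.1)`. -/
noncomputable def phaseShear (E : Type*) [NormedAddCommGroup E] [InnerProductSpace ℝ E] :
    ((E × E) × E) ≃L[ℝ] (E × E) × E where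
  toFun z := (z.1, z.2 - z.1.1)
  invFun z := (z.1, z.2 + z.1.1)
  map_add' w w' := by ext <;> simp; abel
  map_smul' c w := by ext <;> simp [smul_sub]
  left_inv w := by ext <;> simp
  right_inv w := by ext <;> simp
  continuous_toFun := by fun_prop
  continuous_invFun := by fun_prop

/-- The Schwartz function `((y, η), t) ↦ A(y, η) conj (g (t - y)) exp (-2πi η·t)`. -/
noncomputable def shiftFamily (g : 𝓢(E, ℂ)) (A : 𝓢(E × E, ℂ)) : 𝓢((E × E) × E, ℂ) :=
  smulLeftCLM ℂ (fun z : (E × E) × E => character z.1.2 z.2)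
    (compCLMOfContinuousLinearEquiv ℂ (phaseShear E) (tensor A (conjSchwartz g)))

/-- The shifted windows alone do not decay in `w`. With the amplitude `A` they become slices of one
Schwartz function, so that `dist_integral_slice` and `continuous_slice` apply to them. -/
theorem slice_shiftFamily (g : 𝓢(E, ℂ)) (A : 𝓢(E × E, ℂ)) (w : E × E) :
    slice w (shiftFamily g A) = A w • conjShift g w.1 w.2 := by
  ext t
  have h : (fun z : (E × E) × E => character z.1.2 z.2).HasTemperateGrowth :=
    character_comp_hasTemperateGrowth
      (ContinuousLinearMap.snd ℝ E E ∘L ContinuousLinearMap.fst ℝ (E × E) E)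
      (ContinuousLinearMap.snd ℝ (E × E) E)
  rw [slice_apply, shiftFamily, smulLeftCLM_apply_apply h, smul_apply, conjShift_apply]
  change character w.2 t * (A w * (starRingEnd ℂ) (g (t - w.1))) = _
  simp only [smul_eq_mul]
  ring

theorem shiftFamily_apply (g : 𝓢(E, ℂ)) (A : 𝓢(E × E, ℂ)) (w : E × E) (t : E) :
    shiftFamily g A (w, t) = A w * conjShift g w.1 w.2 t := by
  rw [← slice_apply, slice_shiftFamily]
  rfl

theorem slice_shear_tensor (g k : 𝓢(E, ℂ)) (y s : E) :
    slice y (compCLMOfContinuousLinearEquiv ℂ (shear E) (tensor g k)) s = g (s - y) * k s := by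
  rw [slice_apply]
  rfl

variable [FiniteDimensional ℝ E]

/-- Near `w₀` the transform is a quotient: a bump `A` times it is `f (slice w (shiftFamily g A))`,
which is continuous, and `A` does not vanish there. -/
theorem continuous_stft (g : 𝓢(E, ℂ)) (f : 𝓢'(E, ℂ)) :
    Continuous fun w : E × E => stft g f w.1 w.2 := by
  rw [continuous_iff_continuousAt]
  intro w₀
  let b : ContDiffBump w₀ := default
  let A : 𝓢(E × E, ℂ) := HasCompactSupport.toSchwartzMap (f := fun w => (b w : ℂ))
    (b.hasCompactSupport.comp_left (g := fun r : ℝ => (r : ℂ)) (by simp))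
    (Complex.ofRealCLM.contDiff.comp b.contDiff)
  have hA : A w₀ ≠ 0 := by
    change ((b w₀ : ℝ) : ℂ) ≠ 0
    exact_mod_cast (b.pos_of_mem_ball (Metric.mem_ball_self b.rOut_pos)).ne'
  have h1 : Continuous fun w => f (slice w (shiftFamily g A)) :=
    (map_continuous f).comp (continuous_slice _)
  have h2 : ContinuousAt (fun w => f (slice w (shiftFamily g A)) / A w) w₀ :=
    h1.continuousAt.div A.continuous.continuousAt hA
  refine h2.congr ?_
  filter_upwards [A.continuous.continuousAt.eventually_ne hA] with w hw
  rw [slice_shiftFamily, map_smul, smul_eq_mul, mul_div_cancel_left₀ _ hw]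
  rfl

variable [MeasurableSpace E] [BorelSpace E]

instance : (volume : Measure (E × E)).IsAddHaarMeasure :=
  inferInstanceAs (Measure.prod volume volume : Measure (E × E)).IsAddHaarMeasure

theorem fourier_schwartz_apply (φ : 𝓢(E, ℂ)) (ξ : E) :
    𝓕 φ ξ = ∫ t, φ t * character t ξ := by
  rw [fourier_coe, Real.fourier_eq']
  refine integral_congr_ae (Filter.Eventually.of_forall fun t => ?_)
  simp only [character, smul_eq_mul]
  rw [mul_comm]
  congr 2
  push_cast
  ring

theorem fourierInv_schwartz_apply (φ : 𝓢(E, ℂ)) (η : E) :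
    𝓕⁻ φ η = ∫ s, φ s * (starRingEnd ℂ) (character s η) := by
  rw [fourierInv_apply_eq]
  change 𝓕 φ (-η) = _
  rw [fourier_schwartz_apply]
  simp only [character_neg_right]

/-- The Schwartz function `(y, η) ↦ ∫ g(s - y) k(s) exp (2πi η·s) ds`. -/
noncomputable def crossKernel (g k : 𝓢(E, ℂ)) : 𝓢(E × E, ℂ) :=
  partialCLM (FourierTransform.fourierInvCLM ℂ 𝓢(E, ℂ))
    (compCLMOfContinuousLinearEquiv ℂ (shear E) (tensor g k))

theorem crossKernel_eq_fourierInv (g k : 𝓢(E, ℂ)) (y η : E) :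
    crossKernel g k (y, η) =
      𝓕⁻ (slice y (compCLMOfContinuousLinearEquiv ℂ (shear E) (tensor g k))) η := rfl

theorem crossKernel_apply (g k : 𝓢(E, ℂ)) (y η : E) :
    crossKernel g k (y, η) = ∫ s, g (s - y) * k s * (starRingEnd ℂ) (character s η) := by
  rw [crossKernel_eq_fourierInv, fourierInv_schwartz_apply]
  simp only [slice_shear_tensor]

theorem integrable_slice_left {W F : Type*} [NormedAddCommGroup W] [NormedSpace ℝ W]
    [NormedAddCommGroup F] [NormedSpace ℝ F] [MeasurableSpace W] [BorelSpace W]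
    [SecondCountableTopology W] {μ : Measure W} [μ.HasTemperateGrowth] (Ψ : 𝓢(W × F, ℂ)) (t : F) :
    Integrable (fun w => Ψ (w, t)) μ := by
  have := integrable_clm_slice (μ := μ) ((BoundedContinuousFunction.evalCLM ℂ t) ∘L
    toBoundedContinuousFunctionCLM ℂ F ℂ) Ψ
  exact this.congr (Filter.Eventually.of_forall fun w => slice_apply w Ψ t)

/-- The reproducing formula for the short-time Fourier transform. -/
theorem integral_crossKernel_mul_conjShift (g k : 𝓢(E, ℂ)) (t : E) :
    ∫ w : E × E, crossKernel g k w * conjShift g w.1 w.2 t = (∫ s, ‖g s‖ ^ 2 : ℝ) * k t := by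
  have hint : Integrable (fun w : E × E => crossKernel g k w * conjShift g w.1 w.2 t)
      (volume.prod volume) := by
    have := integrable_slice_left (μ := (volume : Measure (E × E)))
      (shiftFamily g (crossKernel g k)) t
    simp only [shiftFamily_apply] at this
    exact this
  -- For fixed `y`, the kernel is the inverse Fourier transform of `s ↦ g(s - y) k(s)`, and the
  -- `η`-integral is the Fourier transform back, evaluated at `t`. Integrating `|g(t - y)|²` over
  -- `y` then gives the constant.
  have h1 : ∀ y, ∫ η, crossKernel g k (y, η) * conjShift g y η t =
      ((‖g (t - y)‖ ^ 2 : ℝ) : ℂ) * k t := by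
    intro y
    set φ := slice y (compCLMOfContinuousLinearEquiv ℂ (shear E) (tensor g k)) with hφ
    have e : ∀ η, crossKernel g k (y, η) * conjShift g y η t =
        (starRingEnd ℂ) (g (t - y)) * (𝓕⁻ φ η * character η t) := by
      intro η
      rw [conjShift_apply, crossKernel_eq_fourierInv]
      ring
    simp only [e]
    rw [integral_const_mul, ← fourier_schwartz_apply, FourierTransform.fourier_fourierInv_eq, hφ,
      slice_shear_tensor, ← mul_assoc, mul_comm ((starRingEnd ℂ) _), Complex.mul_conj']
    push_cast
    rfl
  change ∫ w, crossKernel g k w * conjShift g w.1 w.2 t ∂(volume.prod volume) = _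
  rw [integral_prod _ hint]
  simp only [h1]
  rw [integral_mul_const]
  congr 1
  refine (integral_complex_ofReal (f := fun y => ‖g (t - y)‖ ^ 2)).trans ?_
  congr 1
  exact integral_sub_left_eq_self (fun s => ‖g s‖ ^ 2) volume t

/-- This is `f` applied to the reproducing formula, with `dist_integral_slice` moving `f` inside: a
distribution is determined by its short-time Fourier transform. -/
theorem dist_eq_integral_crossKernel (g k : 𝓢(E, ℂ)) (f : 𝓢'(E, ℂ)) :
    (∫ s, ‖g s‖ ^ 2 : ℝ) * f k = ∫ w : E × E, crossKernel g k w * stft g f w.1 w.2 := by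
  have h := dist_integral_slice (μ := (volume : Measure (E × E))) f
    (shiftFamily g (crossKernel g k)) (((∫ s, ‖g s‖ ^ 2 : ℝ) : ℂ) • k) (fun t => by
      simp only [shiftFamily_apply]
      rw [integral_crossKernel_mul_conjShift]
      rfl)
  rw [map_smul, smul_eq_mul] at h
  rw [h]
  refine integral_congr_ae (Filter.Eventually.of_forall fun w => ?_)
  simp only [slice_shiftFamily, map_smul, smul_eq_mul]
  rfl

/-- Translating the integration variable by `x` leaves only unimodular factors. The modulus thus
depends on `(y - x, η - ξ)` alone, and the change of window becomes a convolution. -/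
theorem norm_crossKernel_conjShift (g h : 𝓢(E, ℂ)) (x ξ y η : E) :
    ‖crossKernel g (conjShift h x ξ) (y, η)‖ =
      ‖crossKernel g (conjSchwartz h) (y - x, η - ξ)‖ := by
  rw [crossKernel_apply, crossKernel_apply,
    ← integral_add_right_eq_self
      (fun s => g (s - y) * conjShift h x ξ s * (starRingEnd ℂ) (character s η)) x]
  have e : ∀ s, g (s + x - y) * conjShift h x ξ (s + x) *
      (starRingEnd ℂ) (character (s + x) η) =
      (character ξ x * (starRingEnd ℂ) (character x η)) *
      (g (s - (y - x)) * conjSchwartz h s * (starRingEnd ℂ) (character s (η - ξ))) := by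
    intro s
    have e1 : s + x - y = s - (y - x) := by abel
    rw [conjShift_apply, e1, add_sub_cancel_right, character_add_right, character_add_left,
      sub_eq_add_neg η, character_add_right, character_neg_right, map_mul, map_mul,
      Complex.conj_conj, character_comm s ξ, conjSchwartz_apply]
    ring
  simp only [e]
  rw [integral_const_mul, norm_mul, norm_mul, RCLike.norm_conj, norm_character, norm_character]
  simp

theorem integral_norm_sq_pos {g : 𝓢(E, ℂ)} (hg : g ≠ 0) : 0 < ∫ s, ‖g s‖ ^ 2 := by
  have hc : Continuous fun s => ‖g s‖ ^ 2 := g.continuous.norm.pow 2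
  obtain ⟨x, hx⟩ : ∃ x, g x ≠ 0 := by
    by_contra! h
    exact hg (SchwartzMap.ext h)
  refine integral_pos_of_integrable_nonneg_nonzero (x := x) hc ?_ (fun s => by positivity)
    (by simpa using hx)
  exact (g.memLp 2).integrable_norm_pow (by simp)

/-- The short-time Fourier transforms with respect to two windows are related by a convolution
inequality with a rapidly decreasing kernel. -/
theorem enorm_stft_le (g h : 𝓢(E, ℂ)) (f : 𝓢'(E, ℂ)) (x ξ : E) :
    ENNReal.ofReal (∫ s, ‖g s‖ ^ 2) * ‖stft h f x ξ‖ₑ ≤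
      ∫⁻ η, ∫⁻ y, ‖crossKernel g (conjSchwartz h) (y - x, η - ξ)‖ₑ * ‖stft g f y η‖ₑ := by
  have h0 : 0 ≤ ∫ s, ‖g s‖ ^ 2 := integral_nonneg fun s => by positivity
  -- The choice `k = conjShift h x ξ` makes `f k` the value of the transform with window `h`.
  have h1 := congrArg enorm (dist_eq_integral_crossKernel g (conjShift h x ξ) f)
  rw [enorm_mul, ← ofReal_norm (((∫ s, ‖g s‖ ^ 2 : ℝ) : ℂ)), Complex.norm_real,
    Real.norm_of_nonneg h0] at h1
  have hm : Measurable fun w : E × E =>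
      ‖crossKernel g (conjSchwartz h) (w.1 - x, w.2 - ξ)‖ₑ * ‖stft g f w.1 w.2‖ₑ := by
    have h1 : Measurable fun w : E × E => ‖stft g f w.1 w.2‖ₑ :=
      (continuous_stft g f).enorm.measurable
    have h2 : Measurable fun w : E × E =>
        ‖crossKernel g (conjSchwartz h) (w.1 - x, w.2 - ξ)‖ₑ :=
      ((crossKernel g (conjSchwartz h)).continuous.comp (by fun_prop)).enorm.measurable
    exact h2.mul h1
  refine h1.trans_le ((enorm_integral_le_lintegral_enorm _).trans_eq ?_)
  have e : ∀ w : E × E, ‖crossKernel g (conjShift h x ξ) w * stft g f w.1 w.2‖ₑ =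
      ‖crossKernel g (conjSchwartz h) (w.1 - x, w.2 - ξ)‖ₑ * ‖stft g f w.1 w.2‖ₑ := by
    intro w
    rw [enorm_mul, ← ofReal_norm (crossKernel _ _ w),
      ← ofReal_norm (crossKernel g (conjSchwartz h) _),
      ← norm_crossKernel_conjShift]
  simp only [e]
  exact lintegral_prod_symm' _ hm

end Window

end TFA

namespace TFA

open scoped FourierTransform

/-! ### Polynomial weights -/

section Weights

variable {Z : Type*} [NormedAddCommGroup Z]

theorem one_le_polyWeight_base (z : Z) : 1 ≤ 1 + ‖z‖ ^ 2 := by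
  have := sq_nonneg ‖z‖
  linarith

theorem polyWeight_pos (s : ℝ) (z : Z) : 0 < polyWeight s z :=
  Real.rpow_pos_of_pos (zero_lt_one.trans_le (one_le_polyWeight_base z)) _

theorem polyWeight_neg (s : ℝ) (z : Z) : polyWeight s (-z) = polyWeight s z := by
  simp [polyWeight]

theorem continuous_polyWeight (s : ℝ) : Continuous (polyWeight s : Z → ℝ) := by
  unfold polyWeight
  refine Continuous.rpow_const (by fun_prop) fun z => Or.inl ?_
  exact (zero_lt_one.trans_le (one_le_polyWeight_base z)).ne'

theorem one_add_norm_sq_le (z w : Z) :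
    1 + ‖z‖ ^ 2 ≤ 2 * ((1 + ‖w‖ ^ 2) * (1 + ‖z - w‖ ^ 2)) := by
  have h : ‖z‖ ≤ ‖w‖ + ‖z - w‖ := norm_le_norm_add_norm_sub' z w
  have h2 : ‖z‖ ^ 2 ≤ (‖w‖ + ‖z - w‖) ^ 2 := by gcongr
  nlinarith [sq_nonneg (‖w‖ - ‖z - w‖), sq_nonneg (‖w‖ * ‖z - w‖), sq_nonneg ‖w‖,
    sq_nonneg ‖z - w‖]

/-- Peetre's inequality. -/
theorem polyWeight_le (s : ℝ) (z w : Z) :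
    polyWeight s z ≤ 2 ^ (|s| / 2) * (polyWeight s w * polyWeight |s| (z - w)) := by
  have h0 : ∀ z : Z, 0 < 1 + ‖z‖ ^ 2 := fun z =>
    zero_lt_one.trans_le (one_le_polyWeight_base z)
  unfold polyWeight
  rcases le_total 0 s with hs | hs
  · rw [abs_of_nonneg hs, ← Real.mul_rpow (h0 _).le (h0 _).le,
      ← Real.mul_rpow (by norm_num) (mul_nonneg (h0 _).le (h0 _).le)]
    exact Real.rpow_le_rpow (h0 _).le (one_add_norm_sq_le z w) (by linarith)
  -- For negative `s` the bound is the inverse of the positive case with `z` and `w` exchanged.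
  · have e : s / 2 = -(|s| / 2) := by rw [abs_of_nonpos hs]; ring
    have hs' : 0 ≤ |s| / 2 := by positivity
    rw [e, Real.rpow_neg (h0 _).le, Real.rpow_neg (h0 _).le]
    have h := Real.rpow_le_rpow (h0 _).le (one_add_norm_sq_le w z) hs'
    rw [Real.mul_rpow (by norm_num) (mul_nonneg (h0 _).le (h0 _).le),
      Real.mul_rpow (h0 _).le (h0 _).le, norm_sub_rev] at h
    have p1 := Real.rpow_pos_of_pos (h0 z) (|s| / 2)
    have p2 := Real.rpow_pos_of_pos (h0 w) (|s| / 2)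
    rw [inv_le_iff_one_le_mul₀ p1]
    calc (1 : ℝ) = ((1 + ‖w‖ ^ 2) ^ (|s| / 2))⁻¹ * (1 + ‖w‖ ^ 2) ^ (|s| / 2) :=
          (inv_mul_cancel₀ p2.ne').symm
      _ ≤ ((1 + ‖w‖ ^ 2) ^ (|s| / 2))⁻¹ * (2 ^ (|s| / 2) * ((1 + ‖z‖ ^ 2) ^ (|s| / 2) *
          (1 + ‖z - w‖ ^ 2) ^ (|s| / 2))) := by gcongr
      _ = _ := by ring

/-- A natural exponent is wasteful but lets the weight be absorbed by Schwartz seminorms. -/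
theorem polyWeight_abs_le (s : ℝ) (z : Z) : polyWeight |s| z ≤ (1 + ‖z‖) ^ ⌈|s|⌉₊ := by
  have hz := norm_nonneg z
  unfold polyWeight
  calc (1 + ‖z‖ ^ 2) ^ (|s| / 2) ≤ ((1 + ‖z‖) ^ (2 : ℝ)) ^ (|s| / 2) := by
        gcongr
        rw [Real.rpow_two]
        nlinarith
    _ = (1 + ‖z‖) ^ |s| := by
        rw [← Real.rpow_mul (by positivity)]
        congr 1
        ring
    _ ≤ (1 + ‖z‖) ^ ((⌈|s|⌉₊ : ℕ) : ℝ) :=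
        Real.rpow_le_rpow_of_exponent_le (by linarith) (Nat.le_ceil _)
    _ = _ := Real.rpow_natCast _ _

end Weights

/-! ### Window independence and inclusions of modulation spaces -/

section Moderate

variable {E : Type*} [NormedAddCommGroup E]

/-- Continuous nonnegative weights of moderate polynomial growth on phase space. -/
structure IsModerate (m : E → E → ℝ) : Prop where
  continuous : Continuous (Function.uncurry m)
  nonneg : ∀ x ξ, 0 ≤ m x ξ
  le_mul : ∃ (C : ℝ) (N : ℕ), ∀ x ξ y η,
    m x ξ ≤ C * ((1 + ‖x - y‖) ^ N * (1 + ‖ξ - η‖) ^ N) * m y η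

theorem isModerate_phaseWeight (s : ℝ) : IsModerate (phaseWeight s : E → E → ℝ) where
  continuous := (continuous_polyWeight s).comp (by fun_prop)
  nonneg _ _ := (polyWeight_pos _ _).le
  le_mul := by
    refine ⟨2 ^ (|s| / 2), ⌈|s|⌉₊, fun x ξ y η => ?_⟩
    refine (polyWeight_le s _ (WithLp.toLp 2 (y, η))).trans ?_
    rw [mul_assoc, mul_comm (polyWeight s _)]
    have h0 := (polyWeight_pos s (WithLp.toLp 2 (y, η))).le
    refine mul_le_mul_of_nonneg_left (mul_le_mul_of_nonneg_right ?_ h0) (by positivity)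
    refine (polyWeight_abs_le s _).trans ?_
    rw [← mul_pow]
    gcongr
    have : ‖WithLp.toLp 2 (x, ξ) - WithLp.toLp 2 (y, η)‖ ≤ ‖x - y‖ + ‖ξ - η‖ := by
      rw [WithLp.prod_norm_eq_of_L2]
      refine Real.sqrt_le_iff.2 ⟨by positivity, ?_⟩
      change ‖x - y‖ ^ 2 + ‖ξ - η‖ ^ 2 ≤ _
      nlinarith [norm_nonneg (x - y), norm_nonneg (ξ - η)]
    nlinarith [norm_nonneg (x - y), norm_nonneg (ξ - η)]

theorem isModerate_freqWeight (s : ℝ) : IsModerate (freqWeight s : E → E → ℝ) where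
  continuous := (continuous_polyWeight s).comp (by fun_prop)
  nonneg _ _ := (polyWeight_pos _ _).le
  le_mul := by
    refine ⟨2 ^ (|s| / 2), ⌈|s|⌉₊, fun x ξ y η => ?_⟩
    refine (polyWeight_le s _ η).trans ?_
    rw [mul_assoc, mul_comm (polyWeight s _)]
    have h0 := (polyWeight_pos s η).le
    refine mul_le_mul_of_nonneg_left (mul_le_mul_of_nonneg_right ?_ h0) (by positivity)
    refine (polyWeight_abs_le s _).trans ?_
    refine le_mul_of_one_le_left (by positivity) (one_le_pow₀ ?_)
    linarith [norm_nonneg (x - y)]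

theorem isModerate_one : IsModerate (fun _ _ : E => (1 : ℝ)) where
  continuous := continuous_const
  nonneg _ _ := zero_le_one
  le_mul := ⟨1, 0, fun x ξ y η => by simp⟩

variable [InnerProductSpace ℝ E] [FiniteDimensional ℝ E] [MeasurableSpace E] [BorelSpace E]

theorem mixedNorm_eq {m : E → E → ℝ} (hm : ∀ x ξ, 0 ≤ m x ξ) (p q : ℝ≥0∞) (F : E → E → ℂ) :
    mixedNorm p q m F = eLpNorm (fun ξ => eLpNorm
      (fun x => ‖F x ξ‖ₑ * ENNReal.ofReal (m x ξ)) p volume) q volume := by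
  unfold mixedNorm
  congr 1
  funext ξ
  rw [← eLpNorm_enorm]
  congr 1
  funext x
  rw [enorm_mul]
  congr 1
  rw [← ofReal_norm]
  simp [abs_of_nonneg (hm x ξ)]

theorem eLpNorm_const_mul_le {α : Type*} [MeasurableSpace α] {μ : Measure α} {p c : ℝ≥0∞}
    (hc : c ≠ ∞) (f : α → ℝ≥0∞) :
    eLpNorm (fun x => c * f x) p μ ≤ c * eLpNorm f p μ := by
  lift c to ℝ≥0 using hc
  refine (eLpNorm_le_nnreal_smul_eLpNorm_of_ae_le_mul' (f := fun x => c * f x) (g := f) (c := c)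
    (Filter.Eventually.of_forall fun x => ?_) p).trans_eq ?_
  · simp
  · rfl

/-- Rapidly decreasing functions have finite mixed norms. -/
theorem mixed_schwartz_lt_top (κ : 𝓢(E × E, ℂ)) (N : ℕ) (a b : ℝ≥0∞) :
    eLpNorm (fun v : E => eLpNorm (fun u : E => ENNReal.ofReal
      (‖κ (u, v)‖ * ((1 + ‖u‖) ^ N * (1 + ‖v‖) ^ N))) a volume) b volume < ∞ := by
  obtain ⟨k, hk⟩ := Measure.HasTemperateGrowth.exists_eLpNorm_lt_top a
    (μ := (volume : Measure E)) inferInstance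
  obtain ⟨l, hl⟩ := Measure.HasTemperateGrowth.exists_eLpNorm_lt_top b
    (μ := (volume : Measure E)) inferInstance
  rw [← eLpNorm_enorm] at hk hl
  -- Twice `N` powers pay for the two weights; the remaining `k` and `l` leave the negative powers
  -- of finite `L^a` and `L^b` norm.
  obtain ⟨M, hbd⟩ : ∃ M : ℝ, ∀ w : E × E, (1 + ‖w‖) ^ (N + k + (N + l)) * ‖κ w‖ ≤ M :=
    ⟨2 ^ (N + k + (N + l)) * ((Finset.Iic (N + k + (N + l), 0)).sup
      fun m => SchwartzMap.seminorm ℂ m.1 m.2) κ, fun w => by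
      simpa only [norm_iteratedFDeriv_zero] using one_add_le_sup_seminorm_apply (𝕜 := ℂ)
        (m := (N + k + (N + l), 0)) (n := 0) le_rfl le_rfl κ w⟩
  have key : ∀ u v : E, ENNReal.ofReal (‖κ (u, v)‖ * ((1 + ‖u‖) ^ N * (1 + ‖v‖) ^ N)) ≤
      (ENNReal.ofReal M * ‖(1 + ‖v‖) ^ (-l : ℝ)‖ₑ) * ‖(1 + ‖u‖) ^ (-k : ℝ)‖ₑ := by
    intro u v
    have hu : 0 < 1 + ‖u‖ := by positivity
    have hv : 0 < 1 + ‖v‖ := by positivity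
    rw [Real.enorm_of_nonneg (by positivity), Real.enorm_of_nonneg (by positivity),
      mul_assoc, ← ENNReal.ofReal_mul (by positivity), ← ENNReal.ofReal_mul' (by positivity)]
    refine ENNReal.ofReal_le_ofReal ?_
    rw [Real.rpow_neg hu.le, Real.rpow_neg hv.le, Real.rpow_natCast, Real.rpow_natCast,
      ← mul_inv, ← div_eq_mul_inv, le_div_iff₀ (by positivity)]
    refine le_trans ?_ (hbd (u, v))
    have h1 : ‖u‖ ≤ ‖(u, v)‖ := norm_fst_le (u, v)
    have h2 : ‖v‖ ≤ ‖(u, v)‖ := norm_snd_le (u, v)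
    calc ‖κ (u, v)‖ * ((1 + ‖u‖) ^ N * (1 + ‖v‖) ^ N) * ((1 + ‖v‖) ^ l * (1 + ‖u‖) ^ k)
        = (1 + ‖u‖) ^ (N + k) * (1 + ‖v‖) ^ (N + l) * ‖κ (u, v)‖ := by ring
      _ ≤ (1 + ‖(u, v)‖) ^ (N + k) * (1 + ‖(u, v)‖) ^ (N + l) * ‖κ (u, v)‖ := by gcongr
      _ = _ := by rw [← pow_add]
  set A := eLpNorm (fun u : E => ‖(1 + ‖u‖) ^ (-k : ℝ)‖ₑ) a volume
  set B := eLpNorm (fun v : E => ‖(1 + ‖v‖) ^ (-l : ℝ)‖ₑ) b volume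
  calc _ ≤ eLpNorm (fun v : E => (ENNReal.ofReal M * A) * ‖(1 + ‖v‖) ^ (-l : ℝ)‖ₑ) b volume := by
        refine eLpNorm_mono_ennreal fun v => ?_
        refine (eLpNorm_mono_ennreal fun u => key u v).trans
          ((eLpNorm_const_mul_le (ENNReal.mul_ne_top ENNReal.ofReal_ne_top enorm_ne_top) _).trans_eq
          (by ring))
    _ ≤ (ENNReal.ofReal M * A) * B :=
        eLpNorm_const_mul_le (ENNReal.mul_ne_top ENNReal.ofReal_ne_top hk.ne) _
    _ < ∞ := ENNReal.mul_lt_top (ENNReal.mul_lt_top ENNReal.ofReal_lt_top hk) hl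

/-- Convolution with `L^a` maps `L^p` to `L^P` for `1/a = 1 + 1/P - 1/p`. This is at most `1`
because `p ≤ P`, and the subtraction does not truncate because `1 ≤ p`. -/
theorem exists_young_exponent {p P : ℝ≥0∞} (hp : 1 ≤ p) (hP : p ≤ P) :
    ∃ a : ℝ≥0∞, 1 ≤ a ∧ a⁻¹ + p⁻¹ = 1 + P⁻¹ := by
  have h1 : p⁻¹ ≤ 1 := by simpa using hp
  have h2 : P⁻¹ ≤ p⁻¹ := by simpa using hP
  refine ⟨(1 + P⁻¹ - p⁻¹)⁻¹, ?_, ?_⟩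
  · rw [ENNReal.one_le_inv, tsub_le_iff_right]
    gcongr
  · rw [inv_inv, tsub_add_cancel_of_le (h1.trans le_self_add)]

/-- Independence of the modulation space norm of the window, together with the embedding of
modulation spaces for increasing exponents. -/
theorem exists_modNorm_le {g : 𝓢(E, ℂ)} (hg : g ≠ 0) (h : 𝓢(E, ℂ)) {m : E → E → ℝ}
    (hm : IsModerate m) {p q P Q : ℝ≥0∞} (hp : 1 ≤ p) (hq : 1 ≤ q) (hP : p ≤ P) (hQ : q ≤ Q) :
    ∃ C : ℝ≥0, ∀ f : 𝓢'(E, ℂ), modNorm h P Q m f ≤ C * modNorm g p q m f := by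
  obtain ⟨C, N, hC⟩ := hm.le_mul
  obtain ⟨a, ha, haP⟩ := exists_young_exponent hp hP
  obtain ⟨b, hb, hbQ⟩ := exists_young_exponent hq hQ
  set c := ∫ s, ‖g s‖ ^ 2
  have hc : 0 < c := integral_norm_sq_pos hg
  -- The kernel of the change of window, reflected to put the integral in convolution form and
  -- scaled by `|C| / c`, which collects the moderateness constant and the squared `L²` norm of `g`.
  let κ : 𝓢(E × E, ℂ) := ((|C| / c : ℝ) : ℂ) • compCLMOfContinuousLinearEquiv ℂ
    (ContinuousLinearEquiv.neg ℝ) (crossKernel g (conjSchwartz h))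
  have hκ : ∀ u v, ‖κ (u, v)‖ = |C| / c * ‖crossKernel g (conjSchwartz h) (-u, -v)‖ := by
    intro u v
    change ‖((|C| / c : ℝ) : ℂ) • crossKernel g (conjSchwartz h) (-(u, v))‖ = _
    rw [norm_smul, Complex.norm_real, Real.norm_of_nonneg (by positivity)]
    rfl
  let K : E → E → ℝ≥0∞ := fun u v =>
    ENNReal.ofReal (‖κ (u, v)‖ * ((1 + ‖u‖) ^ N * (1 + ‖v‖) ^ N))
  have hK : Measurable (Function.uncurry K) := by
    refine ENNReal.measurable_ofReal.comp (Continuous.measurable ?_)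
    exact κ.continuous.norm.mul (by fun_prop)
  refine ⟨(eLpNorm (fun v => eLpNorm (fun u => K u v) a volume) b volume).toNNReal, fun f => ?_⟩
  rw [ENNReal.coe_toNNReal (mixed_schwartz_lt_top κ N a b).ne]
  unfold modNorm
  rw [mixedNorm_eq hm.nonneg, mixedNorm_eq hm.nonneg]
  have hG : Measurable (Function.uncurry
      fun y η => ‖stft g f y η‖ₑ * ENNReal.ofReal (m y η)) :=
    (continuous_stft g f).measurable.enorm.mul
      (ENNReal.measurable_ofReal.comp hm.continuous.measurable)
  refine le_trans ?_ (mixed_lconvolution_le (μ := volume) (ν := volume) ha hp (hp.trans hP) haP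
    hb hq hbQ hK hG)
  refine eLpNorm_mono_ennreal fun ξ => eLpNorm_mono_ennreal fun x => ?_
  have h0 := enorm_stft_le g h f x ξ
  have hc0 : ENNReal.ofReal c ≠ 0 := by simpa using hc
  -- Multiplying by `c` matches the normalization in `enorm_stft_le`. Moderateness then moves the
  -- weight from `(x, ξ)` to `(y, η)` under the integral, at the price of the powers contained in
  -- `K`.
  rw [← ENNReal.mul_le_mul_iff_right hc0 ENNReal.ofReal_ne_top, ← mul_assoc]
  refine (mul_le_mul_left h0 _).trans ?_
  rw [← lintegral_mul_const' _ _ ENNReal.ofReal_ne_top,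
    ← lintegral_const_mul' _ _ ENNReal.ofReal_ne_top]
  refine lintegral_mono fun η => ?_
  rw [← lintegral_mul_const' _ _ ENNReal.ofReal_ne_top,
    ← lintegral_const_mul' _ _ ENNReal.ofReal_ne_top]
  refine lintegral_mono fun y => ?_
  simp only [hκ, neg_sub]
  set k := crossKernel g (conjSchwartz h) (y - x, η - ξ)
  rw [← ofReal_norm k]
  have e1 : ENNReal.ofReal ‖k‖ * ‖stft g f y η‖ₑ * ENNReal.ofReal (m x ξ) =
      ENNReal.ofReal (‖k‖ * m x ξ) * ‖stft g f y η‖ₑ := by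
    rw [ENNReal.ofReal_mul (norm_nonneg _)]
    ring
  have e2 : ∀ r : ℝ, 0 ≤ r → ENNReal.ofReal c * (ENNReal.ofReal r *
      (‖stft g f y η‖ₑ * ENNReal.ofReal (m y η))) =
      ENNReal.ofReal (c * r * m y η) * ‖stft g f y η‖ₑ := by
    intro r hr
    rw [ENNReal.ofReal_mul (by positivity), ENNReal.ofReal_mul hc.le]
    ring
  rw [e1, e2 _ (by positivity)]
  refine mul_le_mul_left (ENNReal.ofReal_le_ofReal ?_) _
  have hx : m x ξ ≤ |C| * ((1 + ‖x - y‖) ^ N * (1 + ‖ξ - η‖) ^ N) * m y η := by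
    refine (hC x ξ y η).trans ?_
    have := hm.nonneg y η
    gcongr
    exact le_abs_self C
  calc ‖k‖ * m x ξ ≤ ‖k‖ * (|C| * ((1 + ‖x - y‖) ^ N * (1 + ‖ξ - η‖) ^ N) * m y η) := by gcongr
    _ = _ := by field_simp

end Moderate

end TFA

namespace TFA

open scoped FourierTransform

/-! ### The product formula for the cross-Wigner distribution -/

section ProductFormula

variable {E : Type*} [NormedAddCommGroup E] [InnerProductSpace ℝ E]

theorem character_zero_left (t : E) : character 0 t = 1 := by simp [character]

theorem character_half_smul_add (ζ u v : E) :
    character ζ ((1 / 2 : ℝ) • (u + v)) =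
      character ((1 / 2 : ℝ) • ζ) u * character ((1 / 2 : ℝ) • ζ) v := by
  rw [← character_add_right]
  simp only [character, real_inner_smul_left, real_inner_smul_right]

theorem character_toLp (ζ : WithLp 2 (E × E)) (x ξ : E) :
    character ζ (WithLp.toLp 2 (x, ξ)) = character ζ.fst x * character ζ.snd ξ := by
  have h : inner ℝ ζ (WithLp.toLp 2 (x, ξ)) = inner ℝ ζ.fst x + inner ℝ ζ.snd ξ :=
    WithLp.prod_inner_apply _ _
  simp only [character, h, ← Complex.exp_add]
  congr 1
  push_cast
  ring

/-- The Schwartz function `(x, t) ↦ g(x + t/2) conj (g (x - t/2))`. -/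
noncomputable def wignerProduct (g : 𝓢(E, ℂ)) : 𝓢(E × E, ℂ) :=
  compCLMOfContinuousLinearEquiv ℂ (midpointDiff E).symm (tensor g (conjSchwartz g))

theorem wignerProduct_apply (g : 𝓢(E, ℂ)) (x t : E) :
    wignerProduct g (x, t) =
      g (x + (1 / 2 : ℝ) • t) * (starRingEnd ℂ) (g (x - (1 / 2 : ℝ) • t)) := by
  change tensor g (conjSchwartz g) (x + (1 / 2 : ℝ) • t, x - (1 / 2 : ℝ) • t) = _
  rw [tensor_apply, conjSchwartz_apply]

variable [FiniteDimensional ℝ E]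

theorem pairSnd_tensor (f : 𝓢'(E, ℂ)) (φ ψ : 𝓢(E, ℂ)) :
    pairSnd f (tensor φ ψ) = f ψ • φ := by
  ext x
  have : slice x (tensor φ ψ) = φ x • ψ := by
    ext y
    rw [slice_apply, tensor_apply]
    rfl
  rw [pairSnd_apply, this, map_smul, smul_apply, smul_eq_mul, smul_eq_mul, mul_comm]

variable [MeasurableSpace E] [BorelSpace E]

/-- The Wigner distribution of a Schwartz function, as a Schwartz function on phase space. -/
noncomputable def wignerSchwartz (g : 𝓢(E, ℂ)) : 𝓢(WithLp 2 (E × E), ℂ) :=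
  compCLMOfContinuousLinearEquiv ℂ (WithLp.prodContinuousLinearEquiv 2 ℝ E E)
    (partialCLM (fourierTransformCLM ℂ) (wignerProduct g))

theorem wignerSchwartz_apply (g : 𝓢(E, ℂ)) (x ξ : E) :
    wignerSchwartz g (WithLp.toLp 2 (x, ξ)) = 𝓕 (slice x (wignerProduct g)) ξ := rfl

/-- The `ξ`-integral undoes the Fourier transform that defines `W(g, g)`, leaving a value of `g ⊗
ḡ`. The character of `(u + v) / 2` splits into one of `u` and one of `v`, so the kernel has rank
one; this is why the transform factorizes. -/
theorem wignerKernel_conjShift (g : 𝓢(E, ℂ)) (z ζ : WithLp 2 (E × E)) :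
    wignerKernel (conjShift (wignerSchwartz g) z ζ) = character ζ.snd z.snd •
      tensor (conjShift g (z.fst - (1 / 2 : ℝ) • ζ.snd) (z.snd + (1 / 2 : ℝ) • ζ.fst))
        (conjSchwartz (conjShift g (z.fst + (1 / 2 : ℝ) • ζ.snd)
          (z.snd - (1 / 2 : ℝ) • ζ.fst))) := by
  ext ⟨u, v⟩
  -- These are the midpoint and difference coordinates after the shift; `a ± τ / 2` are the
  -- arguments of the two copies of `g`.
  set a := (1 / 2 : ℝ) • (u + v) - z.fst with ha
  set τ := ζ.snd + (u - v) with hτ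
  have hint : ∀ ξ, conjShift (wignerSchwartz g) z ζ
        (WithLp.toLp 2 ((1 / 2 : ℝ) • (u + v), ξ + z.snd)) * character (ξ + z.snd) (u - v) =
      (character ζ.fst ((1 / 2 : ℝ) • (u + v)) * character ζ.snd z.snd * character z.snd (u - v)) *
        (starRingEnd ℂ) (𝓕 (slice a (wignerProduct g)) ξ * (starRingEnd ℂ) (character ξ τ)) := by
    intro ξ
    have e : WithLp.toLp 2 ((1 / 2 : ℝ) • (u + v), ξ + z.snd) - z = WithLp.toLp 2 (a, ξ) := by
      rw [ha]
      refine (WithLp.ofLp_injective 2) ?_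
      ext
      · rfl
      · exact add_sub_cancel_right _ _
    rw [conjShift_apply, e, wignerSchwartz_apply, character_toLp, character_add_right,
      character_add_left, map_mul, Complex.conj_conj, hτ, character_add_right ξ,
      character_comm ξ ζ.snd]
    ring
  rw [wignerKernel_apply, ← integral_add_right_eq_self _ z.snd]
  simp only [hint]
  rw [integral_const_mul, integral_conj, ← fourierInv_schwartz_apply,
    FourierTransform.fourierInv_fourier_eq, slice_apply, wignerProduct_apply, smul_apply,
    tensor_apply, conjSchwartz_apply, conjShift_apply, conjShift_apply]
  have e1 : a + (1 / 2 : ℝ) • τ = u - (z.fst - (1 / 2 : ℝ) • ζ.snd) := by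
    rw [ha, hτ]; module
  have e2 : a - (1 / 2 : ℝ) • τ = v - (z.fst + (1 / 2 : ℝ) • ζ.snd) := by
    rw [ha, hτ]; module
  rw [e1, e2, character_half_smul_add, sub_eq_add_neg u v, character_add_right z.snd,
    character_neg_right, character_add_left, sub_eq_add_neg z.snd, character_add_left,
    character_neg_left]
  simp only [map_mul, Complex.conj_conj, smul_eq_mul]
  ring

/-- The short-time Fourier transform of a cross-Wigner distribution with the window `W(g, g)` is a
product of short-time Fourier transforms with the window `g`. -/
theorem stft_crossWigner (g : 𝓢(E, ℂ)) (f₁ f₂ : 𝓢'(E, ℂ)) (z ζ : WithLp 2 (E × E)) :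
    stft (wignerSchwartz g) (crossWigner f₁ f₂) z ζ = character ζ.snd z.snd *
      (stft g f₁ (z.fst - (1 / 2 : ℝ) • ζ.snd) (z.snd + (1 / 2 : ℝ) • ζ.fst) *
        (starRingEnd ℂ) (stft g f₂ (z.fst + (1 / 2 : ℝ) • ζ.snd)
          (z.snd - (1 / 2 : ℝ) • ζ.fst))) := by
  unfold stft
  have hcc : ∀ ψ : 𝓢(E, ℂ), conjSchwartz (conjSchwartz ψ) = ψ := fun ψ => by
    ext t
    simp
  rw [crossWigner_apply, wignerKernel_conjShift, map_smul, pairSnd_tensor, map_smul, map_smul,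
    conjDist_apply, hcc, smul_eq_mul, smul_eq_mul]
  ring

theorem enorm_stft_crossWigner (g : 𝓢(E, ℂ)) (f₁ f₂ : 𝓢'(E, ℂ)) (z ζ : WithLp 2 (E × E)) :
    ‖stft (wignerSchwartz g) (crossWigner f₁ f₂) z ζ‖ₑ =
      ‖stft g f₁ (z.fst - (1 / 2 : ℝ) • ζ.snd) (z.snd + (1 / 2 : ℝ) • ζ.fst)‖ₑ *
        ‖stft g f₂ (z.fst + (1 / 2 : ℝ) • ζ.snd) (z.snd - (1 / 2 : ℝ) • ζ.fst)‖ₑ := by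
  rw [stft_crossWigner, enorm_mul, enorm_mul, ← ofReal_norm (character _ _), norm_character,
    ENNReal.ofReal_one, one_mul, ← ofReal_norm ((starRingEnd ℂ) _), RCLike.norm_conj, ofReal_norm]

theorem stft_self_zero (g : 𝓢(E, ℂ)) :
    stft g (toTemperedDistributionCLM E ℂ volume g) 0 0 = ((∫ s, ‖g s‖ ^ 2 : ℝ) : ℂ) := by
  rw [stft, toTemperedDistributionCLM_apply_apply volume g]
  rw [← integral_complex_ofReal]
  refine integral_congr_ae (Filter.Eventually.of_forall fun t => ?_)
  simp only [conjShift_apply, sub_zero, character_zero_left, mul_one, smul_eq_mul]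
  rw [Complex.conj_mul']
  push_cast
  rfl

/-- For `f₁ = f₂ = g` the product formula at the origin gives `(∫ |g|²)²`, which is positive, while
the zero window has zero transform. -/
theorem wignerSchwartz_ne_zero {g : 𝓢(E, ℂ)} (hg : g ≠ 0) : wignerSchwartz g ≠ 0 := by
  intro h0
  have h := stft_crossWigner g (toTemperedDistributionCLM E ℂ volume g)
    (toTemperedDistributionCLM E ℂ volume g) 0 0
  have e : conjShift (0 : 𝓢(WithLp 2 (E × E), ℂ)) 0 0 = 0 := by
    ext t
    simp [conjShift_apply]
  rw [h0, stft, e, map_zero] at h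
  have hz : ∀ r : ℝ, (0 : E) - r • 0 = 0 ∧ (0 : E) + r • 0 = 0 := fun r => by simp
  simp only [WithLp.zero_fst, WithLp.zero_snd, hz, character_zero_left, one_mul,
    stft_self_zero, Complex.conj_ofReal] at h
  have hp := (integral_norm_sq_pos hg).ne'
  rw [eq_comm, mul_self_eq_zero, Complex.ofReal_eq_zero] at h
  exact hp h

end ProductFormula

end TFA

namespace TFA

/-! ### Enlarging the exponents to the equality case -/

section Exponents

/-- Write `S = 1/p + 1/q`, `α = 1/P₁` and `1/P₂ = S - α`. The requirements become `max (1/q) (S -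
1/p₂) ≤ α ≤ min (1/p₁) (1/p)`. The four comparisons making this interval nonempty are the four
hypotheses, and `α` is taken at the lower end. -/
theorem exists_exponents {p q p₁ p₂ : ℝ≥0∞} (hpq : p ≤ q) (h₁ : p₁ ≤ q) (h₂ : p₂ ≤ q)
    (h : p⁻¹ + q⁻¹ ≤ p₁⁻¹ + p₂⁻¹) :
    ∃ P₁ P₂ : ℝ≥0∞, p₁ ≤ P₁ ∧ p₂ ≤ P₂ ∧ p ≤ P₁ ∧ p ≤ P₂ ∧ P₁⁻¹ + P₂⁻¹ = p⁻¹ + q⁻¹ := by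
  have hpq' : q⁻¹ ≤ p⁻¹ := ENNReal.inv_le_inv.2 hpq
  have h₁' : q⁻¹ ≤ p₁⁻¹ := ENNReal.inv_le_inv.2 h₁
  have h₂' : q⁻¹ ≤ p₂⁻¹ := ENNReal.inv_le_inv.2 h₂
  set S := p⁻¹ + q⁻¹ with hS
  set α := max q⁻¹ (S - p₂⁻¹) with hα
  have a1 : α ≤ p₁⁻¹ := max_le h₁' (tsub_le_iff_right.2 h)
  have a2 : α ≤ p⁻¹ := max_le hpq' (tsub_le_iff_right.2 (by rw [hS]; gcongr))
  have a3 : α ≤ S := max_le le_add_self tsub_le_self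
  have b1 : S - α ≤ p₂⁻¹ := by
    refine tsub_le_iff_left.2 ((le_tsub_add (b := S) (a := p₂⁻¹)).trans ?_)
    gcongr
    exact le_max_right _ _
  have b2 : S - α ≤ p⁻¹ := by
    refine tsub_le_iff_left.2 ?_
    rw [hS, add_comm]
    gcongr
    exact le_max_left _ _
  refine ⟨α⁻¹, (S - α)⁻¹, ?_, ?_, ?_, ?_, ?_⟩
  · rwa [ENNReal.le_inv_iff_le_inv]
  · rwa [ENNReal.le_inv_iff_le_inv]
  · rwa [ENNReal.le_inv_iff_le_inv]
  · rwa [ENNReal.le_inv_iff_le_inv]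
  · rw [inv_inv, inv_inv, add_tsub_cancel_of_le a3]

/-- Multiplying the relation by `p` turns it into Young's relation for `p`-th powers. -/
theorem div_young_exponent {p q P₁ P₂ : ℝ≥0∞} (h0 : p ≠ 0) (ht : p ≠ ∞)
    (h : P₁⁻¹ + P₂⁻¹ = p⁻¹ + q⁻¹) : (P₁ / p)⁻¹ + (P₂ / p)⁻¹ = 1 + (q / p)⁻¹ := by
  have e : ∀ P : ℝ≥0∞, (P / p)⁻¹ = p * P⁻¹ := fun P => by
    rw [ENNReal.inv_div (Or.inl ht) (Or.inl h0), div_eq_mul_inv]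
  rw [e, e, e, ← mul_add, h, mul_add, ENNReal.mul_inv_cancel h0 ht]

end Exponents

/-! ### The convolution estimate behind boundedness -/

section Lebesgue

variable {α β : Type*} [MeasurableSpace α] [MeasurableSpace β] {μ : Measure α} {ν : Measure β}

theorem eLpNorm_rpow (f : α → ℝ≥0∞) {p P : ℝ≥0∞} (h0 : p ≠ 0) (ht : p ≠ ∞) :
    eLpNorm (fun x => f x ^ p.toReal) (P / p) μ = eLpNorm f P μ ^ p.toReal := by
  have h := eLpNorm_enorm_rpow (p := P / p) (μ := μ) f (ENNReal.toReal_pos h0 ht)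
  rwa [ENNReal.ofReal_toReal ht, ENNReal.div_mul_cancel h0 ht] at h

theorem mixed_rpow (f : α → β → ℝ≥0∞) {p P Q : ℝ≥0∞} (h0 : p ≠ 0) (ht : p ≠ ∞) :
    eLpNorm (fun y => eLpNorm (fun x => f x y ^ p.toReal) (P / p) μ) (Q / p) ν =
      eLpNorm (fun y => eLpNorm (fun x => f x y) P μ) Q ν ^ p.toReal := by
  simp only [eLpNorm_rpow _ h0 ht]

theorem eLpNorm_prod_eq [SFinite μ] [SFinite ν] {f : α → β → ℝ≥0∞}
    (hf : Measurable (Function.uncurry f)) {r : ℝ≥0∞} (hr : r ≠ 0) :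
    eLpNorm (Function.uncurry f) r (μ.prod ν) =
      eLpNorm (fun y => eLpNorm (fun x => f x y) r μ) r ν := by
  rcases eq_or_ne r ∞ with rfl | ht
  · have key : ∀ c, eLpNorm (Function.uncurry f) ∞ (μ.prod ν) ≤ c ↔
        eLpNorm (fun y => eLpNorm (fun x => f x y) ∞ μ) ∞ ν ≤ c := by
      intro c
      simp only [eLpNorm_ennreal_top_le_iff]
      rw [← Measure.prod_swap,
        ae_map_iff measurable_swap.aemeasurable (measurableSet_le hf measurable_const)]
      exact Measure.ae_prod_iff_ae_ae (measurableSet_le (hf.comp measurable_swap) measurable_const)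
    exact le_antisymm ((key _).2 le_rfl) ((key _).1 le_rfl)
  · rw [eLpNorm_ennreal_eq hr ht, eLpNorm_ennreal_eq hr ht,
      lintegral_prod_symm _ (hf.pow_const _).aemeasurable]
    simp only [eLpNorm_rpow_eq_lintegral hr ht]
    rfl

variable {E : Type*} [NormedAddCommGroup E] [InnerProductSpace ℝ E]
  [FiniteDimensional ℝ E] [MeasurableSpace E] [BorelSpace E]

theorem eLpNorm_toLp (f : WithLp 2 (E × E) → ℝ≥0∞) (p : ℝ≥0∞) :
    eLpNorm f p volume = eLpNorm (fun w : E × E => f (WithLp.toLp 2 w)) p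
      ((volume : Measure E).prod (volume : Measure E)) := by
  rw [← (WithLp.volume_preserving_toLp E E).map_eq]
  exact (MeasurableEquiv.toLp 2 (E × E)).measurableEmbedding.eLpNorm_map_measure

theorem mixed_comp_neg {f : E → E → ℝ≥0∞} (hf : Measurable (Function.uncurry f)) (P Q : ℝ≥0∞) :
    eLpNorm (fun ξ => eLpNorm (fun x => f (-x) (-ξ)) P volume) Q volume =
      eLpNorm (fun ξ => eLpNorm (fun x => f x ξ) P volume) Q volume := by
  have e1 : ∀ ξ, eLpNorm (fun x => f (-x) (-ξ)) P volume =
      eLpNorm (fun x => f x (-ξ)) P volume := fun ξ =>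
    eLpNorm_comp_measurePreserving (g := fun x => f x (-ξ))
      (hf.comp measurable_prodMk_right).aestronglyMeasurable
      (Measure.measurePreserving_neg volume)
  simp only [e1]
  exact eLpNorm_comp_measurePreserving
    (g := fun ξ => eLpNorm (fun x => f x ξ) P volume)
    (measurable_eLpNorm hf P).aestronglyMeasurable (Measure.measurePreserving_neg volume)

theorem measurePreserving_rotate : MeasurePreserving (fun w : E × E => (w.2, -w.1))
    ((volume : Measure E).prod (volume : Measure E))
    ((volume : Measure E).prod (volume : Measure E)) :=
  ((MeasurePreserving.id volume).prod (Measure.measurePreserving_neg volume)).comp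
    Measure.measurePreserving_swap

/-- Substituting `z = (y - ζ₂/2, η + ζ₁/2)` frees `B` of `ζ` and puts `A` at `(y - ζ₂, η + ζ₁)`.
This is a convolution with reflected `A`, evaluated at `(ζ₂, -ζ₁)`. -/
theorem eLpNorm_product_rpow_eq {A B : E → E → ℝ≥0∞} (hA : Measurable (Function.uncurry A))
    (hB : Measurable (Function.uncurry B)) {p : ℝ≥0∞} (h0 : p ≠ 0) (ht : p ≠ ∞)
    (ζ : WithLp 2 (E × E)) :
    eLpNorm (fun z : WithLp 2 (E × E) =>
      A (z.fst - (1 / 2 : ℝ) • ζ.snd) (z.snd + (1 / 2 : ℝ) • ζ.fst) *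
        B (z.fst + (1 / 2 : ℝ) • ζ.snd) (z.snd - (1 / 2 : ℝ) • ζ.fst)) p volume ^ p.toReal =
      ∫⁻ η, ∫⁻ y, A (-(ζ.snd - y)) (-(-ζ.fst - η)) ^ p.toReal * B y η ^ p.toReal := by
  rw [eLpNorm_toLp, eLpNorm_rpow_eq_lintegral h0 ht]
  rw [lintegral_prod_symm]
  · rw [← lintegral_add_right_eq_self _ ((1 / 2 : ℝ) • ζ.fst)]
    refine lintegral_congr fun η => ?_
    rw [← lintegral_sub_right_eq_self _ ((1 / 2 : ℝ) • ζ.snd)]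
    refine lintegral_congr fun y => ?_
    set a := (1 / 2 : ℝ) • ζ.snd with ha
    set b := (1 / 2 : ℝ) • ζ.fst with hb
    have e1 : y - a - a = -(ζ.snd - y) := by rw [ha]; module
    have e2 : η + b + b = -(-ζ.fst - η) := by rw [hb]; module
    change (A (y - a - a) (η + b + b) * B (y - a + a) (η + b - b)) ^ p.toReal =
      A (-(ζ.snd - y)) (-(-ζ.fst - η)) ^ p.toReal * B y η ^ p.toReal
    rw [e1, e2, sub_add_cancel, add_sub_cancel_right,
      ENNReal.mul_rpow_of_nonneg _ _ ENNReal.toReal_nonneg]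
  · refine (Measurable.pow_const ?_ _).aemeasurable
    exact (hA.comp (f := fun w : E × E => (w.1 - (1 / 2 : ℝ) • ζ.snd,
      w.2 + (1 / 2 : ℝ) • ζ.fst)) (by fun_prop)).mul (hB.comp (f := fun w : E × E =>
      (w.1 + (1 / 2 : ℝ) • ζ.snd, w.2 - (1 / 2 : ℝ) • ζ.fst)) (by fun_prop))

theorem measurable_lconvolution {f g : E → E → ℝ≥0∞}
    (hf : Measurable (Function.uncurry f)) (hg : Measurable (Function.uncurry g)) :
    Measurable (Function.uncurry fun x ξ => ∫⁻ η, ∫⁻ y, f (x - y) (ξ - η) * g y η) := by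
  have h1 : Measurable fun w : ((E × E) × E) × E =>
      f (w.1.1.1 - w.2) (w.1.1.2 - w.1.2) * g w.2 w.1.2 :=
    (hf.comp (f := fun w : ((E × E) × E) × E => (w.1.1.1 - w.2, w.1.1.2 - w.1.2))
      (by fun_prop)).mul (hg.comp (f := fun w : ((E × E) × E) × E => (w.2, w.1.2))
      (by fun_prop))
  have h2 : Measurable fun w : (E × E) × E => ∫⁻ y, f (w.1.1 - y) (w.1.2 - w.2) * g y w.2 :=
    h1.lintegral_prod_right'
  exact h2.lintegral_prod_right'

/-- The rotation exchanges the two variables, so it is harmless only because the same exponent `r`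
governs both. -/
theorem eLpNorm_rotate {F : E → E → ℝ≥0∞} (hF : Measurable (Function.uncurry F)) (r : ℝ≥0∞) :
    eLpNorm (fun ζ : WithLp 2 (E × E) => F ζ.snd (-ζ.fst)) r volume =
      eLpNorm (Function.uncurry F) r ((volume : Measure E).prod (volume : Measure E)) := by
  have h := eLpNorm_comp_measurePreserving (p := r) (f := fun w : E × E => (w.2, -w.1))
    hF.aestronglyMeasurable (measurePreserving_rotate (E := E))
  exact (eLpNorm_toLp (fun ζ => F ζ.snd (-ζ.fst)) r).trans h

theorem eLpNorm_rotated_lconvolution_le {f g : E → E → ℝ≥0∞}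
    (hf : Measurable (Function.uncurry f)) (hg : Measurable (Function.uncurry g))
    {a₁ b₁ a₂ b₂ r : ℝ≥0∞} (ha₁ : 1 ≤ a₁) (hb₁ : 1 ≤ b₁) (hr : 1 ≤ r)
    (h₁ : a₁⁻¹ + b₁⁻¹ = 1 + r⁻¹) (ha₂ : 1 ≤ a₂) (hb₂ : 1 ≤ b₂) (h₂ : a₂⁻¹ + b₂⁻¹ = 1 + r⁻¹) :
    eLpNorm (fun ζ : WithLp 2 (E × E) =>
      ∫⁻ η, ∫⁻ y, f (ζ.snd - y) (-ζ.fst - η) * g y η) r volume ≤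
      eLpNorm (fun ξ => eLpNorm (fun x => f x ξ) a₁ volume) a₂ volume *
        eLpNorm (fun ξ => eLpNorm (fun x => g x ξ) b₁ volume) b₂ volume := by
  have hF := measurable_lconvolution hf hg
  refine (eLpNorm_rotate hF r).trans_le ?_
  rw [eLpNorm_prod_eq hF (zero_lt_one.trans_le hr).ne']
  exact mixed_lconvolution_le (μ := volume) (ν := volume) (f := f) (g := g) ha₁ hb₁ hr h₁ ha₂ hb₂
    h₂ hf hg

/-- The Lebesgue estimate behind the boundedness of the cross-Wigner distribution. -/
theorem mixed_product_le {A B : E → E → ℝ≥0∞} (hA : Measurable (Function.uncurry A))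
    (hB : Measurable (Function.uncurry B)) {p q P₁ P₂ Q₁ Q₂ : ℝ≥0∞} (hp : 1 ≤ p) (ht : p ≠ ∞)
    (hpq : p ≤ q) (hP₁ : p ≤ P₁) (hP₂ : p ≤ P₂) (hP : P₁⁻¹ + P₂⁻¹ = p⁻¹ + q⁻¹)
    (hQ₁ : p ≤ Q₁) (hQ₂ : p ≤ Q₂) (hQ : Q₁⁻¹ + Q₂⁻¹ = p⁻¹ + q⁻¹) :
    eLpNorm (fun ζ : WithLp 2 (E × E) => eLpNorm (fun z : WithLp 2 (E × E) =>
      A (z.fst - (1 / 2 : ℝ) • ζ.snd) (z.snd + (1 / 2 : ℝ) • ζ.fst) *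
        B (z.fst + (1 / 2 : ℝ) • ζ.snd) (z.snd - (1 / 2 : ℝ) • ζ.fst)) p volume) q volume ≤
      eLpNorm (fun ξ => eLpNorm (fun x => A x ξ) P₁ volume) Q₁ volume *
        eLpNorm (fun ξ => eLpNorm (fun x => B x ξ) P₂ volume) Q₂ volume := by
  have h0 : p ≠ 0 := (zero_lt_one.trans_le hp).ne'
  have hp' := ENNReal.toReal_pos h0 ht
  have hone : ∀ {P : ℝ≥0∞}, p ≤ P → 1 ≤ P / p := fun h =>
    (ENNReal.le_div_iff_mul_le (Or.inl h0) (Or.inl ht)).2 (by simpa using h)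
  have hf : Measurable (Function.uncurry fun u v => A u v ^ p.toReal) := hA.pow_const _
  have hf' : Measurable (Function.uncurry fun u v => A (-u) (-v) ^ p.toReal) :=
    hf.comp (measurable_fst.neg.prodMk measurable_snd.neg)
  have hg : Measurable (Function.uncurry fun u v => B u v ^ p.toReal) := hB.pow_const _
  -- After taking `p`-th powers all exponents are divided by `p`. The assumptions `p ≤ P₁, P₂, Q₁,
  -- Q₂, q` make them at least `1`, as Young requires.
  refine (ENNReal.rpow_le_rpow_iff hp').1 ?_
  rw [← eLpNorm_rpow _ h0 ht]
  simp only [eLpNorm_product_rpow_eq hA hB h0 ht]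
  have key := eLpNorm_rotated_lconvolution_le hf' hg (hone hP₁) (hone hP₂) (hone hpq)
    (div_young_exponent h0 ht hP) (hone hQ₁) (hone hQ₂) (div_young_exponent h0 ht hQ)
  rw [mixed_comp_neg hf, mixed_rpow _ h0 ht, mixed_rpow _ h0 ht,
    ← ENNReal.mul_rpow_of_nonneg _ _ hp'.le] at key
  exact key

/-- For a continuous function the essential supremum bounds every value, since nonempty open sets
have positive measure. -/
theorem le_mixed_top {A : E → E → ℝ≥0∞} (hA : Continuous (Function.uncurry A)) (x ξ : E) :
    A x ξ ≤ eLpNorm (fun ξ => eLpNorm (fun x => A x ξ) ∞ volume) ∞ volume := by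
  rw [← eLpNorm_prod_eq hA.measurable (by simp)]
  set c := eLpNorm (Function.uncurry A) ∞ ((volume : Measure E).prod (volume : Measure E))
  by_contra! hlt
  have ho : IsOpen {w : E × E | c < Function.uncurry A w} := isOpen_lt continuous_const hA
  have h0 := ae_iff.1 (ae_le_eLpNorm_top (μ := (volume : Measure E).prod (volume : Measure E))
    (Function.uncurry A))
  simp only [not_le] at h0
  exact (ho.measure_pos _ ⟨(x, ξ), hlt⟩).ne' h0

/-- At `p = ∞` there are no `p`-th powers to convolve; pointwise bounds on the two factors suffice.
-/
theorem mixed_product_top_le {A B : E → E → ℝ≥0∞} (hA : Continuous (Function.uncurry A))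
    (hB : Continuous (Function.uncurry B)) :
    eLpNorm (fun ζ : WithLp 2 (E × E) => eLpNorm (fun z : WithLp 2 (E × E) =>
      A (z.fst - (1 / 2 : ℝ) • ζ.snd) (z.snd + (1 / 2 : ℝ) • ζ.fst) *
        B (z.fst + (1 / 2 : ℝ) • ζ.snd) (z.snd - (1 / 2 : ℝ) • ζ.fst)) ∞ volume) ∞ volume ≤
      eLpNorm (fun ξ => eLpNorm (fun x => A x ξ) ∞ volume) ∞ volume *
        eLpNorm (fun ξ => eLpNorm (fun x => B x ξ) ∞ volume) ∞ volume := by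
  refine eLpNorm_ennreal_top_le_iff.2 (Filter.Eventually.of_forall fun ζ => ?_)
  refine eLpNorm_ennreal_top_le_iff.2 (Filter.Eventually.of_forall fun z => ?_)
  exact mul_le_mul' (le_mixed_top hA _ _) (le_mixed_top hB _ _)

end Lebesgue

end TFA

namespace TFA

/-! ### Weights and boundedness -/

section Sufficiency

variable {E : Type*} [NormedAddCommGroup E] [InnerProductSpace ℝ E]

/-- The two evaluation points satisfy `b - a = (ζ₂, -ζ₁)`, hence `|ζ| = |b - a|`. Peetre's
inequality compares `b - a` with `b`, and the remaining factor is `v_{|s|}(-a)`, so the first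
function carries `|s|`. -/
theorem freqWeight_le (s : ℝ) (z ζ : WithLp 2 (E × E)) :
    freqWeight s z ζ ≤ 2 ^ (|s| / 2) *
      (phaseWeight |s| (z.fst - (1 / 2 : ℝ) • ζ.snd) (z.snd + (1 / 2 : ℝ) • ζ.fst) *
        phaseWeight s (z.fst + (1 / 2 : ℝ) • ζ.snd) (z.snd - (1 / 2 : ℝ) • ζ.fst)) := by
  set a := WithLp.toLp 2 (z.fst - (1 / 2 : ℝ) • ζ.snd, z.snd + (1 / 2 : ℝ) • ζ.fst)
  set b := WithLp.toLp 2 (z.fst + (1 / 2 : ℝ) • ζ.snd, z.snd - (1 / 2 : ℝ) • ζ.fst)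
  have hab : ‖b - a‖ = ‖ζ‖ := by
    have e : b - a = WithLp.toLp 2 (ζ.snd, -ζ.fst) := by
      refine (WithLp.ofLp_injective 2) (Prod.ext ?_ ?_)
      · change z.fst + (1 / 2 : ℝ) • ζ.snd - (z.fst - (1 / 2 : ℝ) • ζ.snd) = ζ.snd
        module
      · change z.snd - (1 / 2 : ℝ) • ζ.fst - (z.snd + (1 / 2 : ℝ) • ζ.fst) = -ζ.fst
        module
    rw [e, WithLp.prod_norm_eq_of_L2, WithLp.prod_norm_eq_of_L2]
    change √(‖ζ.snd‖ ^ 2 + ‖-ζ.fst‖ ^ 2) = √(‖ζ.fst‖ ^ 2 + ‖ζ.snd‖ ^ 2)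
    rw [norm_neg, add_comm]
  have h := polyWeight_le s (b - a) b
  have e1 : polyWeight s (b - a) = polyWeight s ζ := by simp only [polyWeight, hab]
  have e2 : b - a - b = -a := by abel
  rw [e1, e2, polyWeight_neg] at h
  refine h.trans_eq ?_
  rw [mul_comm (polyWeight s b)]
  rfl

variable [FiniteDimensional ℝ E]

theorem continuous_weighted_stft (g : 𝓢(E, ℂ)) (f : 𝓢'(E, ℂ)) {m : E → E → ℝ}
    (hm : IsModerate m) :
    Continuous (Function.uncurry fun x ξ => ‖stft g f x ξ‖ₑ * ENNReal.ofReal (m x ξ)) := by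
  have h : (Function.uncurry fun x ξ => ‖stft g f x ξ‖ₑ * ENNReal.ofReal (m x ξ)) =
      fun w : E × E => ENNReal.ofReal (‖stft g f w.1 w.2‖ * Function.uncurry m w) := by
    funext w
    rw [ENNReal.ofReal_mul (norm_nonneg _), ofReal_norm]
    rfl
  rw [h]
  exact ENNReal.continuous_ofReal.comp ((continuous_stft g f).norm.mul hm.continuous)

variable [MeasurableSpace E] [BorelSpace E]

/-- Boundedness of the cross-Wigner distribution for the window `W(g, g)`, in the extremal case. -/
theorem modNorm_crossWigner_le (g : 𝓢(E, ℂ)) (s : ℝ) {p q P₁ P₂ Q₁ Q₂ : ℝ≥0∞} (hp : 1 ≤ p)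
    (hpq : p ≤ q) (hP₁ : p ≤ P₁) (hP₂ : p ≤ P₂) (hP : P₁⁻¹ + P₂⁻¹ = p⁻¹ + q⁻¹)
    (hQ₁ : p ≤ Q₁) (hQ₂ : p ≤ Q₂) (hQ : Q₁⁻¹ + Q₂⁻¹ = p⁻¹ + q⁻¹) (f₁ f₂ : 𝓢'(E, ℂ)) :
    modNorm (wignerSchwartz g) p q (freqWeight s) (crossWigner f₁ f₂) ≤
      ENNReal.ofReal (2 ^ (|s| / 2)) * (modNorm g P₁ Q₁ (phaseWeight |s|) f₁ *
        modNorm g P₂ Q₂ (phaseWeight s) f₂) := by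
  set A : E → E → ℝ≥0∞ := fun x ξ => ‖stft g f₁ x ξ‖ₑ * ENNReal.ofReal (phaseWeight |s| x ξ)
    with hA
  set B : E → E → ℝ≥0∞ := fun x ξ => ‖stft g f₂ x ξ‖ₑ * ENNReal.ofReal (phaseWeight s x ξ)
    with hB
  have hAc : Continuous (Function.uncurry A) :=
    continuous_weighted_stft g f₁ (isModerate_phaseWeight |s|)
  have hBc : Continuous (Function.uncurry B) :=
    continuous_weighted_stft g f₂ (isModerate_phaseWeight s)
  unfold modNorm
  rw [mixedNorm_eq (isModerate_freqWeight s).nonneg,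
    mixedNorm_eq (isModerate_phaseWeight |s|).nonneg,
    mixedNorm_eq (isModerate_phaseWeight s).nonneg]
  have key : eLpNorm (fun ζ : WithLp 2 (E × E) => eLpNorm (fun z : WithLp 2 (E × E) =>
      A (z.fst - (1 / 2 : ℝ) • ζ.snd) (z.snd + (1 / 2 : ℝ) • ζ.fst) *
        B (z.fst + (1 / 2 : ℝ) • ζ.snd) (z.snd - (1 / 2 : ℝ) • ζ.fst)) p volume) q volume ≤
      eLpNorm (fun ξ => eLpNorm (fun x => A x ξ) P₁ volume) Q₁ volume *
        eLpNorm (fun ξ => eLpNorm (fun x => B x ξ) P₂ volume) Q₂ volume := by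
    rcases eq_or_ne p ∞ with rfl | ht
    · rw [top_le_iff] at hpq hP₁ hP₂ hQ₁ hQ₂
      rw [hpq, hP₁, hP₂, hQ₁, hQ₂]
      exact mixed_product_top_le hAc hBc
    · exact mixed_product_le hAc.measurable hBc.measurable hp ht hpq hP₁ hP₂ hP hQ₁ hQ₂ hQ
  refine le_trans ?_ (mul_le_mul_right key _)
  refine le_trans ?_ (eLpNorm_const_mul_le ENNReal.ofReal_ne_top _)
  refine eLpNorm_mono_ennreal fun ζ => ?_
  refine le_trans ?_ (eLpNorm_const_mul_le ENNReal.ofReal_ne_top _)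
  refine eLpNorm_mono_ennreal fun z => ?_
  rw [enorm_stft_crossWigner]
  have hw := ENNReal.ofReal_le_ofReal (freqWeight_le s z ζ)
  rw [ENNReal.ofReal_mul (by positivity), ENNReal.ofReal_mul
    ((isModerate_phaseWeight |s|).nonneg _ _)] at hw
  refine (mul_le_mul_right hw _).trans_eq ?_
  simp only [hA, hB]
  ring

theorem exists_modNorm_crossWigner_le {g : 𝓢(E, ℂ)} (hg : g ≠ 0) (Φ : 𝓢(WithLp 2 (E × E), ℂ))
    (s : ℝ) {p₁ q₁ p₂ q₂ p q : ℝ≥0∞} (hp₁ : 1 ≤ p₁) (hq₁ : 1 ≤ q₁) (hp₂ : 1 ≤ p₂) (hq₂ : 1 ≤ q₂)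
    (hp : 1 ≤ p) (hq : 1 ≤ q) (h₁ : p₁ ≤ q ∧ q₁ ≤ q ∧ p₂ ≤ q ∧ q₂ ≤ q)
    (h₂ : p⁻¹ + q⁻¹ ≤ p₁⁻¹ + p₂⁻¹ ∧ p⁻¹ + q⁻¹ ≤ q₁⁻¹ + q₂⁻¹) :
    ∃ C : ℝ≥0, ∀ f₁ f₂ : 𝓢'(E, ℂ), modNorm Φ p q (freqWeight s) (crossWigner f₁ f₂) ≤
      C * modNorm g p₁ q₁ (phaseWeight |s|) f₁ * modNorm g p₂ q₂ (phaseWeight s) f₂ := by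
  obtain ⟨hpq₁, hqq₁, hpq₂, hqq₂⟩ := h₁
  -- If `q ≤ p`, the condition becomes `2/q ≤ 1/a + 1/b`, which already follows from `a, b ≤ q`.
  have hmin : ∀ {a b : ℝ≥0∞}, a ≤ q → b ≤ q → p⁻¹ + q⁻¹ ≤ a⁻¹ + b⁻¹ →
      (min p q)⁻¹ + q⁻¹ ≤ a⁻¹ + b⁻¹ := by
    intro a b ha hb h
    rcases le_total p q with h' | h'
    · rwa [min_eq_left h']
    · rw [min_eq_right h']
      exact add_le_add (ENNReal.inv_le_inv.2 ha) (ENNReal.inv_le_inv.2 hb)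
  have hp₀ : 1 ≤ min p q := le_min hp hq
  obtain ⟨P₁, P₂, a1, a2, a3, a4, a5⟩ := exists_exponents (min_le_right p q) hpq₁ hpq₂
    (hmin hpq₁ hpq₂ h₂.1)
  obtain ⟨Q₁, Q₂, b1, b2, b3, b4, b5⟩ := exists_exponents (min_le_right p q) hqq₁ hqq₂
    (hmin hqq₁ hqq₂ h₂.2)
  -- On the left, this changes the window from `W(g, g)` to `Φ` and the exponent from `min p q` to
  -- `p`. On the right, `C₁` and `C₂` pay for enlarging the given exponents.
  obtain ⟨C₀, hC₀⟩ := exists_modNorm_le (wignerSchwartz_ne_zero hg) Φ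
    (isModerate_freqWeight (E := WithLp 2 (E × E)) s) hp₀ hq (min_le_left p q) le_rfl
  obtain ⟨C₁, hC₁⟩ := exists_modNorm_le hg g (isModerate_phaseWeight |s|) hp₁ hq₁ a1 b1
  obtain ⟨C₂, hC₂⟩ := exists_modNorm_le hg g (isModerate_phaseWeight s) hp₂ hq₂ a2 b2
  refine ⟨C₀ * (2 ^ (|s| / 2) : ℝ).toNNReal * C₁ * C₂, fun f₁ f₂ => ?_⟩
  have h := modNorm_crossWigner_le g s hp₀ (min_le_right p q) a3 a4 a5 b3 b4 b5 f₁ f₂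
  calc modNorm Φ p q (freqWeight s) (crossWigner f₁ f₂)
      ≤ C₀ * (ENNReal.ofReal (2 ^ (|s| / 2)) * ((C₁ * modNorm g p₁ q₁ (phaseWeight |s|) f₁) *
        (C₂ * modNorm g p₂ q₂ (phaseWeight s) f₂))) := by
        refine (hC₀ _).trans (mul_le_mul_right (h.trans ?_) _)
        gcongr
        · exact hC₁ f₁
        · exact hC₂ f₂
    _ = _ := by
        rw [ENNReal.ofReal]
        push_cast
        ring

end Sufficiency

end TFA

namespace TFA

/-! ### Gaussians and their short-time Fourier transforms -/

section Gaussian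

variable {E : Type*} [NormedAddCommGroup E]

/-- The Gaussian `t ↦ exp (-π a |t|²)` with values in `[0, ∞]`. -/
noncomputable def egaussian (a : ℝ) (t : E) : ℝ≥0∞ :=
  ENNReal.ofReal (Real.exp (-(Real.pi * a * ‖t‖ ^ 2)))

theorem continuous_egaussian (a : ℝ) : Continuous (egaussian a : E → ℝ≥0∞) := by
  exact ENNReal.continuous_ofReal.comp (by fun_prop)

theorem egaussian_ne_zero (a : ℝ) (t : E) : egaussian a t ≠ 0 := by
  simp [egaussian, Real.exp_pos]

theorem egaussian_ne_top (a : ℝ) (t : E) : egaussian a t ≠ ∞ := ENNReal.ofReal_ne_top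

theorem exists_pow_mul_exp_neg_le {a : ℝ} (ha : 0 < a) (k : ℕ) :
    ∃ C : ℝ, ∀ r : ℝ, 0 ≤ r → (1 + r) ^ k * Real.exp (-(a * r ^ 2)) ≤ C := by
  refine ⟨2 ^ k * (k.factorial / a ^ k * Real.exp a), fun r hr => ?_⟩
  have h1 : (1 + r) ^ k ≤ 2 ^ k * (1 + r ^ 2) ^ k := by
    rw [← mul_pow]
    gcongr
    nlinarith [sq_nonneg (r - 1)]
  have h2 : (1 + r ^ 2) ^ k ≤ k.factorial / a ^ k * Real.exp (a * (1 + r ^ 2)) := by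
    have h := Real.pow_div_factorial_le_exp (x := a * (1 + r ^ 2)) (by positivity) k
    rw [mul_pow, div_le_iff₀ (by positivity)] at h
    rw [div_mul_eq_mul_div, le_div_iff₀ (by positivity)]
    linarith
  calc (1 + r) ^ k * Real.exp (-(a * r ^ 2))
      ≤ 2 ^ k * (k.factorial / a ^ k * Real.exp (a * (1 + r ^ 2))) * Real.exp (-(a * r ^ 2)) := by
        gcongr
        exact h1.trans (by gcongr)
    _ = 2 ^ k * (k.factorial / a ^ k * Real.exp a) := by
        rw [mul_assoc, mul_assoc, ← Real.exp_add]
        ring_nf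

variable [InnerProductSpace ℝ E]

/-- The Gaussian `t ↦ exp (-a |t|²)` as a real Schwartz function. -/
noncomputable def realGaussian {a : ℝ} (ha : 0 < a) : 𝓢(E, ℝ) where
  toFun := Real.exp ∘ fun t => -(a * ‖t‖ ^ 2)
  smooth' := Real.contDiff_exp.comp (contDiff_const.mul (contDiff_norm_sq ℝ)).neg
  decay' := by
    intro k n
    have hq : (fun t : E => -(a * ‖t‖ ^ 2)).HasTemperateGrowth :=
      ((Function.HasTemperateGrowth.const a).mul (Function.hasTemperateGrowth_norm_sq E)).neg
    obtain ⟨l, C, hC, h⟩ := hq.norm_iteratedFDeriv_le_uniform n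
    obtain ⟨C', hexp⟩ := exists_pow_mul_exp_neg_le ha (k + l * n)
    refine ⟨n.factorial * (1 + C) ^ n * C', fun x => ?_⟩
    have hx : 0 ≤ ‖x‖ := norm_nonneg x
    -- Every derivative of `exp` is `exp`, which gives the bound `C`. Taking `1 + C` in `D` makes
    -- the base at least `1`, so it is below its `i`-th power for `i ≥ 1`.
    have hb := norm_iteratedFDeriv_comp_le (𝕜 := ℝ) (g := Real.exp)
      (f := fun t : E => -(a * ‖t‖ ^ 2)) (n := n) (N := n) Real.contDiff_exp
      ((contDiff_const.mul (contDiff_norm_sq ℝ)).neg) le_rfl x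
      (C := Real.exp (-(a * ‖x‖ ^ 2))) (D := (1 + C) * (1 + ‖x‖) ^ l)
      (fun i _ => by
        rw [norm_iteratedFDeriv_eq_norm_iteratedDeriv, iteratedDeriv_eq_iterate,
          Real.iter_deriv_exp, Real.norm_eq_abs, Real.abs_exp])
      (fun i hi hin => by
        have h1 : 1 ≤ (1 + C) * (1 + ‖x‖) ^ l :=
          one_le_mul_of_one_le_of_one_le (by linarith) (one_le_pow₀ (by linarith))
        refine (h i hin x).trans (le_trans ?_ (le_self_pow₀ h1 (by omega)))
        gcongr
        linarith)
    calc ‖x‖ ^ k * ‖iteratedFDeriv ℝ n (Real.exp ∘ fun t => -(a * ‖t‖ ^ 2)) x‖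
        ≤ (1 + ‖x‖) ^ k * (n.factorial * Real.exp (-(a * ‖x‖ ^ 2)) *
          ((1 + C) * (1 + ‖x‖) ^ l) ^ n) := by
          gcongr
          linarith
      _ = n.factorial * (1 + C) ^ n * ((1 + ‖x‖) ^ (k + l * n) *
          Real.exp (-(a * ‖x‖ ^ 2))) := by
          rw [mul_pow, ← pow_mul, pow_add]
          ring
      _ ≤ _ := by
          gcongr
          exact hexp _ hx

/-- The Gaussian `t ↦ exp (-π a |t|²)` as a Schwartz function. -/
noncomputable def gaussian {a : ℝ} (ha : 0 < a) : 𝓢(E, ℂ) :=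
  postcompCLM (𝕜 := ℝ) Complex.ofRealCLM (realGaussian (mul_pos Real.pi_pos ha))

theorem gaussian_apply {a : ℝ} (ha : 0 < a) (t : E) :
    gaussian ha t = ((Real.exp (-(Real.pi * a * ‖t‖ ^ 2)) : ℝ) : ℂ) := rfl

theorem gaussian_ne_zero {a : ℝ} (ha : 0 < a) : (gaussian ha : 𝓢(E, ℂ)) ≠ 0 := by
  intro h
  have : (gaussian ha : 𝓢(E, ℂ)) 0 = 0 := by rw [h]; rfl
  rw [gaussian_apply] at this
  simp at this

/-- As a function of the integration variable, `‖· - x‖² + l‖·‖²` has its minimum at `x / (1 + l)`;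
centring there removes the cross term. -/
theorem completing_square (t x : E) {l : ℝ} (hl : 0 < l) :
    ‖t + (1 / (1 + l)) • x - x‖ ^ 2 + l * ‖t + (1 / (1 + l)) • x‖ ^ 2 =
      (1 + l) * ‖t‖ ^ 2 + l / (1 + l) * ‖x‖ ^ 2 := by
  have e : t + (1 / (1 + l)) • x - x = t - (l / (1 + l)) • x := by
    have : (l / (1 + l)) = 1 - 1 / (1 + l) := by field_simp; ring
    rw [this]
    module
  rw [e, norm_add_sq_real, norm_sub_sq_real, norm_smul, norm_smul, real_inner_smul_right,
    real_inner_smul_right, mul_pow, mul_pow, Real.norm_eq_abs, Real.norm_eq_abs, sq_abs, sq_abs]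
  field_simp
  ring

variable [FiniteDimensional ℝ E] [MeasurableSpace E] [BorelSpace E]

/-- Window times function is a Gaussian centred at `x / (1 + l)`, and the centre contributes only a
unimodular factor to its Fourier transform. The two resulting parameters sum to `1`. The constant
depends on `l`, harmlessly, since it occurs on both sides of the tested inequality. -/
theorem exists_enorm_stft_gaussian {l : ℝ} (hl : 0 < l) :
    ∃ c : ℝ, 0 < c ∧ ∀ x ξ : E,
      ‖stft (gaussian one_pos) (toTemperedDistributionCLM E ℂ volume (gaussian hl)) x ξ‖ₑ =
        ENNReal.ofReal c * (egaussian (l / (1 + l)) x * egaussian (1 / (1 + l)) ξ) := by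
  have hl' : 0 < 1 + l := by positivity
  set b : ℂ := ((Real.pi * (1 + l) : ℝ) : ℂ) with hb
  have hb0 : 0 < b.re := by rw [hb, Complex.ofReal_re]; positivity
  have hbne : b ≠ 0 := by
    rw [hb]
    exact_mod_cast (by positivity : Real.pi * (1 + l) ≠ 0)
  set c₀ : ℂ := (Real.pi / b) ^ (Module.finrank ℝ E / 2 : ℂ) with hc₀
  have hc : c₀ ≠ 0 := by
    rw [hc₀, Complex.cpow_ne_zero_iff]
    exact Or.inl (div_ne_zero (by exact_mod_cast Real.pi_ne_zero) hbne)
  refine ⟨‖c₀‖, by simpa using hc, fun x ξ => ?_⟩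
  set x' := (1 / (1 + l)) • x with hx'
  rw [stft, toTemperedDistributionCLM_apply_apply volume (gaussian hl),
    ← integral_add_right_eq_self _ x']
  have e : ∀ t, conjShift (gaussian one_pos) x ξ (t + x') • (gaussian hl : 𝓢(E, ℂ)) (t + x') =
      (((Real.exp (-(Real.pi * (l / (1 + l)) * ‖x‖ ^ 2)) : ℝ) : ℂ) * character ξ x') *
        Complex.exp (-b * ‖t‖ ^ 2 + (-(2 * Real.pi * Complex.I)) * (inner ℝ ξ t : ℝ)) := by
    intro t
    rw [conjShift_apply, gaussian_apply, gaussian_apply, Complex.conj_ofReal, smul_eq_mul,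
      character_add_right, Complex.exp_add]
    have h1 : Real.exp (-(Real.pi * 1 * ‖t + x' - x‖ ^ 2)) *
        Real.exp (-(Real.pi * l * ‖t + x'‖ ^ 2)) =
        Real.exp (-(Real.pi * (l / (1 + l)) * ‖x‖ ^ 2)) *
          Real.exp (-(Real.pi * (1 + l)) * ‖t‖ ^ 2) := by
      rw [← Real.exp_add, ← Real.exp_add]
      congr 1
      have := completing_square t x hl
      rw [← hx'] at this
      linear_combination (-Real.pi) * this
    have h2 : Complex.exp (-b * ‖t‖ ^ 2) =
        ((Real.exp (-(Real.pi * (1 + l)) * ‖t‖ ^ 2) : ℝ) : ℂ) := by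
      rw [hb]
      push_cast
      rfl
    have h1' := congrArg (fun r : ℝ => (r : ℂ)) h1
    simp only [Complex.ofReal_mul] at h1'
    rw [h2]
    change _ = _ * (_ * character ξ t)
    linear_combination (character ξ t * character ξ x') * h1'
  simp only [e]
  rw [integral_const_mul, GaussianFourier.integral_cexp_neg_mul_sq_norm_add hb0, enorm_mul,
    enorm_mul, enorm_mul, ← ofReal_norm (character _ _), norm_character, ENNReal.ofReal_one,
    mul_one, ← ofReal_norm c₀]
  have h3 : (-(2 * Real.pi * Complex.I)) ^ 2 * ‖ξ‖ ^ 2 / (4 * b) =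
      ((-(Real.pi * (1 / (1 + l)) * ‖ξ‖ ^ 2) : ℝ) : ℂ) := by
    rw [hb]
    have : ((1 + l : ℝ) : ℂ) ≠ 0 := by exact_mod_cast hl'.ne'
    have hpi : (Real.pi : ℂ) ≠ 0 := by exact_mod_cast Real.pi_ne_zero
    push_cast at this ⊢
    rw [neg_sq, mul_pow, mul_pow, Complex.I_sq]
    field_simp
    ring
  rw [h3, ← Complex.ofReal_exp]
  have h4 : ∀ r : ℝ, ‖((Real.exp r : ℝ) : ℂ)‖ₑ = ENNReal.ofReal (Real.exp r) := fun r => by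
    rw [← ofReal_norm, Complex.norm_real, Real.norm_eq_abs, Real.abs_exp]
  rw [h4, h4]
  simp only [egaussian]
  ring

theorem eLpNorm_const_mul_eq {α : Type*} [MeasurableSpace α] {μ : Measure α} {p c : ℝ≥0∞}
    (hc0 : c ≠ 0) (hc : c ≠ ∞) (f : α → ℝ≥0∞) :
    eLpNorm (fun x => c * f x) p μ = c * eLpNorm f p μ := by
  refine le_antisymm (eLpNorm_const_mul_le hc f) ?_
  have h := eLpNorm_const_mul_le (p := p) (μ := μ) (ENNReal.inv_ne_top.2 hc0) fun x => c * f x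
  simp only [← mul_assoc, ENNReal.inv_mul_cancel hc0 hc, one_mul] at h
  calc c * eLpNorm f p μ ≤ c * (c⁻¹ * eLpNorm (fun x => c * f x) p μ) := by gcongr
    _ = _ := by rw [← mul_assoc, ENNReal.mul_inv_cancel hc0 hc, one_mul]

theorem eLpNorm_egaussian_one_ne_top (p : ℝ≥0∞) :
    eLpNorm (egaussian 1 : E → ℝ≥0∞) p volume ≠ ∞ := by
  have h := (gaussian one_pos : 𝓢(E, ℂ)).eLpNorm_lt_top p (volume : Measure E)
  rw [← eLpNorm_enorm] at h
  refine (lt_of_eq_of_lt ?_ h).ne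
  congr 1
  funext t
  rw [gaussian_apply, ← ofReal_norm, Complex.norm_real, Real.norm_eq_abs, Real.abs_exp]
  rfl

theorem eLpNorm_egaussian_one_ne_zero {p : ℝ≥0∞} (hp : p ≠ 0) :
    eLpNorm (egaussian 1 : E → ℝ≥0∞) p volume ≠ 0 := by
  intro h
  rw [eLpNorm_eq_zero_iff (continuous_egaussian 1).measurable.aestronglyMeasurable hp] at h
  have h' : ∀ᵐ _ : E, False := h.mono fun t ht => egaussian_ne_zero 1 t ht
  rw [ae_iff] at h'
  simp only [not_false_eq_true, Set.ofPred_true] at h'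
  exact (Measure.measure_univ_ne_zero.2 (NeZero.ne (volume : Measure E))) h'

/-- Dilation by `√a`. The exponent vanishes at `p = ∞` because `(1 / ∞).toReal = 0`. This scaling
law produces all the necessary conditions. -/
theorem eLpNorm_egaussian {a : ℝ} (ha : 0 < a) (p : ℝ≥0∞) :
    eLpNorm (egaussian a : E → ℝ≥0∞) p volume =
      ENNReal.ofReal (a ^ (-((Module.finrank ℝ E / 2 : ℝ) * (1 / p).toReal))) *
        eLpNorm (egaussian 1 : E → ℝ≥0∞) p volume := by
  have hs : √a ≠ 0 := (Real.sqrt_pos.2 ha).ne'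
  have e : (egaussian a : E → ℝ≥0∞) = egaussian 1 ∘ (√a • ·) := by
    funext t
    simp only [egaussian, Function.comp_apply, norm_smul, mul_pow, Real.norm_eq_abs, sq_abs,
      Real.sq_sqrt ha.le, mul_one, mul_assoc]
  have hm := Measure.map_addHaar_smul (volume : Measure E) hs
  have hc : ENNReal.ofReal |(√a ^ Module.finrank ℝ E)⁻¹| ≠ 0 := by
    rw [Ne, ENNReal.ofReal_eq_zero, not_le]
    positivity
  have h := eLpNorm_map_measure (p := p) (μ := (volume : Measure E)) (f := (√a • · : E → E))
    (continuous_egaussian 1 : Continuous (egaussian 1 : E → ℝ≥0∞)).measurable.aestronglyMeasurable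
    (by fun_prop)
  rw [e, ← h, hm, eLpNorm_smul_measure_of_ne_zero hc, smul_eq_mul]
  congr 1
  rw [ENNReal.ofReal_rpow_of_pos (by positivity)]
  congr 1
  rw [abs_of_pos (by positivity), Real.sqrt_eq_rpow, ← Real.rpow_natCast, ← Real.rpow_mul ha.le,
    ← Real.rpow_neg ha.le, ← Real.rpow_mul ha.le]
  congr 1
  ring

end Gaussian

end TFA

namespace TFA

/-! ### Comparing powers in the Gaussian inequality -/

section Exponents

theorem le_of_rpow_neg_le {u v C : ℝ}
    (h : ∀ x : ℝ, 0 < x → x ≤ 1 / 2 → x ^ (-u) ≤ C * x ^ (-v)) : u ≤ v := by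
  by_contra! hlt
  have ht := (tendsto_rpow_atTop (sub_pos.2 hlt)).eventually_gt_atTop C
  obtain ⟨y, hy, hy2⟩ := (ht.and (Filter.eventually_ge_atTop 2)).exists
  have hy0 : 0 < y := by linarith
  have hx := h y⁻¹ (inv_pos.2 hy0) (by
    rw [one_div]
    exact inv_anti₀ (by norm_num) hy2)
  rw [Real.inv_rpow hy0.le, Real.inv_rpow hy0.le, ← Real.rpow_neg hy0.le, ← Real.rpow_neg hy0.le,
    neg_neg, neg_neg] at hx
  rw [Real.rpow_sub hy0, lt_div_iff₀ (Real.rpow_pos_of_pos hy0 v)] at hy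
  linarith

theorem rpow_neg_anti {x y u : ℝ} (hx : 0 < x) (hxy : x ≤ y) (hu : 0 ≤ u) :
    y ^ (-u) ≤ x ^ (-u) :=
  Real.rpow_le_rpow_of_nonpos hx hxy (by linarith)

/-- Necessary conditions on the exponents in a homogeneous inequality. -/
theorem exponents_of_bound {u v a₁ b₁ a₂ b₂ C : ℝ} (hu : 0 ≤ u) (hv : 0 ≤ v) (hb₁ : 0 ≤ b₁)
    (hb₂ : 0 ≤ b₂) (hC : 0 ≤ C)
    (H : ∀ α β γ δ : ℝ, 0 < α → 0 < β → 0 < γ → 0 < δ → α + γ = 1 → β + δ = 1 →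
      (α + β) ^ (-u) * (γ + δ) ^ (-u) * ((α * β / (α + β)) ^ (-v) * (γ * δ / (γ + δ)) ^ (-v)) ≤
        C * (α ^ (-a₁) * γ ^ (-b₁)) * (β ^ (-a₂) * δ ^ (-b₂))) :
    v ≤ a₁ ∧ u + v ≤ a₁ + a₂ := by
  have lower : ∀ {x w : ℝ}, 0 < x → x ≤ 2 → 0 ≤ w → (2 : ℝ) ^ (-w) ≤ x ^ (-w) :=
    fun hx hx2 hw => rpow_neg_anti hx hx2 hw
  have upper : ∀ {x w : ℝ}, 1 / 2 ≤ x → 0 ≤ w → x ^ (-w) ≤ (1 / 2 : ℝ) ^ (-w) :=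
    fun hx hw => rpow_neg_anti (by norm_num) hx hw
  -- A lower bound for the factors on the left that do not degenerate: their bases stay at most `2`.
  set c : ℝ := (2 : ℝ) ^ (-u) * (2 : ℝ) ^ (-u) * (2 : ℝ) ^ (-v) with hc
  have hc0 : 0 < c := by positivity
  have hfrac : ∀ y z : ℝ, 0 < y → 0 < z → z ≤ 1 → y * z / (y + z) ≤ 2 := by
    intro y z hy hz hz1
    rw [div_le_iff₀ (by positivity)]
    nlinarith
  constructor
  · refine le_of_rpow_neg_le
      (C := C * ((1 / 2 : ℝ) ^ (-b₁) * ((1 / 2 : ℝ) ^ (-a₂) * (1 / 2 : ℝ) ^ (-b₂))) / c)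
      fun x hx hx2 => ?_
    -- Only `α` tends to zero. On the left just `αβ / (α + β)` degenerates, on the right just `α`;
    -- `x ≤ 1/2` keeps `γ` at least `1/2`.
    have h := H x (1 / 2) (1 - x) (1 / 2) hx (by norm_num) (by linarith) (by norm_num)
      (by ring) (by norm_num)
    rw [div_mul_eq_mul_div, le_div_iff₀ hc0]
    have h1 : x * (1 / 2) / (x + 1 / 2) ≤ x := by
      rw [div_le_iff₀ (by positivity)]
      nlinarith
    calc x ^ (-v) * c = (2 : ℝ) ^ (-u) * (2 : ℝ) ^ (-u) * (x ^ (-v) * (2 : ℝ) ^ (-v)) := by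
          rw [hc]; ring
      _ ≤ (x + 1 / 2) ^ (-u) * (1 - x + 1 / 2) ^ (-u) * ((x * (1 / 2) / (x + 1 / 2)) ^ (-v) *
          ((1 - x) * (1 / 2) / (1 - x + 1 / 2)) ^ (-v)) := by
          have hx1 : 0 < 1 - x := by linarith
          gcongr ?_ * ?_ * (?_ * ?_)
          · exact lower (by positivity) (by linarith) hu
          · exact lower (by positivity) (by linarith) hu
          · exact rpow_neg_anti (by positivity) h1 hv
          · exact lower (by positivity) (hfrac _ _ hx1 (by norm_num) (by norm_num)) hv
      _ ≤ _ := h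
      _ ≤ C * (x ^ (-a₁) * (1 / 2 : ℝ) ^ (-b₁)) * ((1 / 2 : ℝ) ^ (-a₂) * (1 / 2 : ℝ) ^ (-b₂)) := by
          gcongr C * (_ * ?_) * _
          exact upper (by linarith) hb₁
      _ = _ := by ring
  · refine le_of_rpow_neg_le (C := C * ((1 / 2 : ℝ) ^ (-b₁) * (1 / 2 : ℝ) ^ (-b₂)) / c)
      fun x hx hx2 => ?_
    have hx1 : 0 < 1 - x := by linarith
    -- With `α = β = x` both `α + β = 2x` and `αβ / (α + β) = x / 2` degenerate, which brings in `u`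
    -- as well as `v`.
    have h := H x x (1 - x) (1 - x) hx hx hx1 hx1 (by ring) (by ring)
    rw [div_mul_eq_mul_div, le_div_iff₀ hc0]
    have h1 : x * x / (x + x) ≤ x := by
      rw [div_le_iff₀ (by positivity)]
      nlinarith
    calc x ^ (-(u + v)) * c = ((2 : ℝ) ^ (-u) * x ^ (-u)) * (2 : ℝ) ^ (-u) *
          (x ^ (-v) * (2 : ℝ) ^ (-v)) := by
          rw [hc, neg_add, Real.rpow_add hx]; ring
      _ ≤ (x + x) ^ (-u) * (1 - x + (1 - x)) ^ (-u) * ((x * x / (x + x)) ^ (-v) *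
          ((1 - x) * (1 - x) / (1 - x + (1 - x))) ^ (-v)) := by
          gcongr ?_ * ?_ * (?_ * ?_)
          · rw [← two_mul, Real.mul_rpow (by norm_num) hx.le]
          · exact lower (by positivity) (by linarith) hu
          · exact rpow_neg_anti (by positivity) h1 hv
          · exact lower (by positivity) (hfrac _ _ hx1 hx1 (by linarith)) hv
      _ ≤ _ := h
      _ ≤ C * (x ^ (-a₁) * (1 / 2 : ℝ) ^ (-b₁)) * (x ^ (-a₂) * (1 / 2 : ℝ) ^ (-b₂)) := by
          gcongr C * (_ * ?_) * (_ * ?_)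
          · exact upper (by linarith) hb₁
          · exact upper (by linarith) hb₂
      _ = _ := by rw [neg_add, Real.rpow_add hx]; ring

end Exponents

/-! ### Exact norms of Gaussian transforms -/

section GaussianNorms

variable {E : Type*} [NormedAddCommGroup E] [InnerProductSpace ℝ E]

/-- Completing the square in `x` separates the variables up to a translation linear in `y`, which
translation-invariant norms in `x` ignore. -/
theorem egaussian_mul_egaussian {α β : ℝ} (hα : 0 < α) (hβ : 0 < β) (x y : E) :
    egaussian α (x - (1 / 2 : ℝ) • y) * egaussian β (x + (1 / 2 : ℝ) • y) =
      egaussian (α + β) (x + ((β - α) / (2 * (α + β))) • y) *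
        egaussian (α * β / (α + β)) y := by
  have hs : α + β ≠ 0 := by positivity
  simp only [egaussian]
  rw [← ENNReal.ofReal_mul (Real.exp_nonneg _), ← ENNReal.ofReal_mul (Real.exp_nonneg _),
    ← Real.exp_add, ← Real.exp_add]
  congr 2
  rw [norm_add_sq_real, norm_add_sq_real, norm_sub_sq_real, norm_smul, norm_smul,
    real_inner_smul_right, real_inner_smul_right, mul_pow, mul_pow, Real.norm_eq_abs,
    Real.norm_eq_abs, sq_abs, sq_abs]
  field_simp
  ring

variable [FiniteDimensional ℝ E] [MeasurableSpace E] [BorelSpace E]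

theorem eLpNorm_egaussian_ne_top {a : ℝ} (ha : 0 < a) (p : ℝ≥0∞) :
    eLpNorm (egaussian a : E → ℝ≥0∞) p volume ≠ ∞ := by
  rw [eLpNorm_egaussian ha]
  exact ENNReal.mul_ne_top ENNReal.ofReal_ne_top (eLpNorm_egaussian_one_ne_top p)

theorem eLpNorm_egaussian_ne_zero {a : ℝ} (ha : 0 < a) {p : ℝ≥0∞} (hp : p ≠ 0) :
    eLpNorm (egaussian a : E → ℝ≥0∞) p volume ≠ 0 := by
  rw [eLpNorm_egaussian ha]
  refine mul_ne_zero ?_ (eLpNorm_egaussian_one_ne_zero hp)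
  rw [Ne, ENNReal.ofReal_eq_zero, not_le]
  positivity

theorem eLpNorm_egaussian_mul {a b : ℝ} (ha : 0 < a) {p : ℝ≥0∞} (hp : p ≠ 0) (v w : E) :
    eLpNorm (fun z : WithLp 2 (E × E) => egaussian a (z.fst + v) * egaussian b (z.snd + w))
      p volume = eLpNorm (egaussian a : E → ℝ≥0∞) p volume *
        eLpNorm (egaussian b : E → ℝ≥0∞) p volume := by
  have hc : ∀ a : ℝ, Continuous (egaussian a : E → ℝ≥0∞) := continuous_egaussian
  have htr : ∀ (a : ℝ) (v : E), eLpNorm (fun x => egaussian a (x + v)) p volume =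
      eLpNorm (egaussian a : E → ℝ≥0∞) p volume := fun a v =>
    eLpNorm_comp_measurePreserving (hc a).measurable.aestronglyMeasurable
      (measurePreserving_add_right volume v)
  have hm : Measurable (Function.uncurry fun x y : E =>
      egaussian a (x + v) * egaussian b (y + w)) :=
    ((hc a).measurable.comp (measurable_fst.add_const v)).mul
      ((hc b).measurable.comp (measurable_snd.add_const w))
  refine (eLpNorm_toLp _ p).trans ((eLpNorm_prod_eq hm hp).trans ?_)
  have h1 : ∀ y : E, eLpNorm (fun x => egaussian a (x + v) * egaussian b (y + w)) p volume =
      eLpNorm (egaussian a : E → ℝ≥0∞) p volume * egaussian b (y + w) := by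
    intro y
    rw [← htr a v, mul_comm, ← eLpNorm_const_mul_eq (egaussian_ne_zero _ _)
      (egaussian_ne_top _ _)]
    simp only [mul_comm]
  simp only [h1]
  rw [eLpNorm_const_mul_eq (eLpNorm_egaussian_ne_zero ha hp) (eLpNorm_egaussian_ne_top ha p), htr]

theorem modNorm_of_enorm_stft_eq {g : 𝓢(E, ℂ)} {f : 𝓢'(E, ℂ)} {c α γ : ℝ} (hc : 0 < c)
    (hα : 0 < α) {p : ℝ≥0∞} (hp : p ≠ 0) (q : ℝ≥0∞)
    (hf : ∀ x ξ : E, ‖stft g f x ξ‖ₑ = ENNReal.ofReal c * (egaussian α x * egaussian γ ξ)) :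
    modNorm g p q (fun _ _ => 1) f = ENNReal.ofReal c *
      (eLpNorm (egaussian α : E → ℝ≥0∞) p volume * eLpNorm (egaussian γ : E → ℝ≥0∞) q volume) := by
  have hc0 : ENNReal.ofReal c ≠ 0 := by simpa using hc
  unfold modNorm
  rw [mixedNorm_eq (fun _ _ => zero_le_one)]
  simp only [hf, ENNReal.ofReal_one, mul_one]
  have h1 : ∀ ξ : E, eLpNorm (fun x : E => ENNReal.ofReal c * (egaussian α x * egaussian γ ξ)) p
      volume = ENNReal.ofReal c * (eLpNorm (egaussian α : E → ℝ≥0∞) p volume * egaussian γ ξ) := by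
    intro ξ
    rw [eLpNorm_const_mul_eq hc0 ENNReal.ofReal_ne_top, mul_comm (eLpNorm _ _ _),
      ← eLpNorm_const_mul_eq (egaussian_ne_zero _ _) (egaussian_ne_top _ _)]
    simp only [mul_comm]
  simp only [h1]
  rw [eLpNorm_const_mul_eq hc0 ENNReal.ofReal_ne_top,
    eLpNorm_const_mul_eq (eLpNorm_egaussian_ne_zero hα hp) (eLpNorm_egaussian_ne_top hα p)]

theorem modNorm_crossWigner_of_enorm_stft_eq {g : 𝓢(E, ℂ)} {f₁ f₂ : 𝓢'(E, ℂ)}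
    {c₁ c₂ α β γ δ : ℝ} (hc₁ : 0 < c₁) (hc₂ : 0 < c₂) (hα : 0 < α) (hβ : 0 < β) (hγ : 0 < γ)
    (hδ : 0 < δ) {p q : ℝ≥0∞} (hp : p ≠ 0) (hq : q ≠ 0)
    (hf₁ : ∀ x ξ : E, ‖stft g f₁ x ξ‖ₑ = ENNReal.ofReal c₁ * (egaussian α x * egaussian γ ξ))
    (hf₂ : ∀ x ξ : E, ‖stft g f₂ x ξ‖ₑ = ENNReal.ofReal c₂ * (egaussian β x * egaussian δ ξ)) :
    modNorm (wignerSchwartz g) p q (fun _ _ => 1) (crossWigner f₁ f₂) =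
      ENNReal.ofReal c₁ * ENNReal.ofReal c₂ *
        ((eLpNorm (egaussian (α + β) : E → ℝ≥0∞) p volume *
          eLpNorm (egaussian (γ + δ) : E → ℝ≥0∞) p volume) *
        (eLpNorm (egaussian (α * β / (α + β)) : E → ℝ≥0∞) q volume *
          eLpNorm (egaussian (γ * δ / (γ + δ)) : E → ℝ≥0∞) q volume)) := by
  set c := ENNReal.ofReal c₁ * ENNReal.ofReal c₂ with hc
  have hc0 : c ≠ 0 := mul_ne_zero (by simpa using hc₁) (by simpa using hc₂)
  have hct : c ≠ ∞ := ENNReal.mul_ne_top ENNReal.ofReal_ne_top ENNReal.ofReal_ne_top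
  unfold modNorm
  rw [mixedNorm_eq (fun _ _ => zero_le_one)]
  have h1 : ∀ z ζ : WithLp 2 (E × E),
      ‖stft (wignerSchwartz g) (crossWigner f₁ f₂) z ζ‖ₑ * ENNReal.ofReal 1 =
      c * ((egaussian (γ * δ / (γ + δ)) ζ.fst * egaussian (α * β / (α + β)) ζ.snd) *
        (egaussian (α + β) (z.fst + ((β - α) / (2 * (α + β))) • ζ.snd) *
          egaussian (γ + δ) (z.snd + ((γ - δ) / (2 * (δ + γ))) • ζ.fst))) := by
    intro z ζ
    have e1 := egaussian_mul_egaussian hα hβ z.fst ζ.snd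
    -- In the frequency variable the signs are reversed, so the parameter of `f₂` comes first.
    have e2 := egaussian_mul_egaussian hδ hγ z.snd ζ.fst
    rw [mul_comm δ γ, add_comm δ γ] at e2
    rw [add_comm δ γ, enorm_stft_crossWigner, hf₁, hf₂, ENNReal.ofReal_one, mul_one, hc]
    calc _ = ENNReal.ofReal c₁ * ENNReal.ofReal c₂ *
        ((egaussian α (z.fst - (1 / 2 : ℝ) • ζ.snd) * egaussian β (z.fst + (1 / 2 : ℝ) • ζ.snd)) *
        (egaussian δ (z.snd - (1 / 2 : ℝ) • ζ.fst) *
          egaussian γ (z.snd + (1 / 2 : ℝ) • ζ.fst))) := by ring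
      _ = _ := by
        rw [e1, e2]
        ring
  have hne : ∀ (a b : ℝ) (x y : E), egaussian a x * egaussian b y ≠ 0 := fun a b x y =>
    mul_ne_zero (egaussian_ne_zero _ _) (egaussian_ne_zero _ _)
  have hnt : ∀ (a b : ℝ) (x y : E), egaussian a x * egaussian b y ≠ ∞ := fun a b x y =>
    ENNReal.mul_ne_top (egaussian_ne_top _ _) (egaussian_ne_top _ _)
  set N := eLpNorm (egaussian (α + β) : E → ℝ≥0∞) p volume *
    eLpNorm (egaussian (γ + δ) : E → ℝ≥0∞) p volume with hN
  have hN0 : N ≠ 0 := mul_ne_zero (eLpNorm_egaussian_ne_zero (by positivity) hp)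
    (eLpNorm_egaussian_ne_zero (by positivity) hp)
  have hNt : N ≠ ∞ := ENNReal.mul_ne_top (eLpNorm_egaussian_ne_top (by positivity) p)
    (eLpNorm_egaussian_ne_top (by positivity) p)
  have h2 : ∀ ζ : WithLp 2 (E × E), eLpNorm (fun z : WithLp 2 (E × E) =>
      ‖stft (wignerSchwartz g) (crossWigner f₁ f₂) z ζ‖ₑ * ENNReal.ofReal 1) p volume =
      c * (N * (egaussian (γ * δ / (γ + δ)) ζ.fst * egaussian (α * β / (α + β)) ζ.snd)) := by
    intro ζ
    simp only [h1]
    rw [eLpNorm_const_mul_eq hc0 hct, eLpNorm_const_mul_eq (hne _ _ _ _) (hnt _ _ _ _),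
      eLpNorm_egaussian_mul (by positivity) hp, mul_comm N]
  simp only [h2]
  rw [eLpNorm_const_mul_eq hc0 hct, eLpNorm_const_mul_eq hN0 hNt]
  have h3 := eLpNorm_egaussian_mul (E := E) (a := γ * δ / (γ + δ)) (b := α * β / (α + β))
    (by positivity) hq 0 0
  simp only [add_zero] at h3
  rw [h3, mul_comm (eLpNorm (egaussian (γ * δ / (γ + δ))) q volume)]

end GaussianNorms

end TFA

namespace TFA

/-! ### Necessary conditions from Gaussian tests -/

section Necessity

variable {E : Type*} [NormedAddCommGroup E] [InnerProductSpace ℝ E]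
  [FiniteDimensional ℝ E] [MeasurableSpace E] [BorelSpace E]

theorem eLpNorm_egaussian_eq_ofReal {a : ℝ} (ha : 0 < a) (p : ℝ≥0∞) :
    eLpNorm (egaussian a : E → ℝ≥0∞) p volume =
      ENNReal.ofReal (a ^ (-((Module.finrank ℝ E / 2 : ℝ) * (1 / p).toReal)) *
        (eLpNorm (egaussian 1 : E → ℝ≥0∞) p volume).toReal) := by
  rw [eLpNorm_egaussian ha, ENNReal.ofReal_mul (by positivity),
    ENNReal.ofReal_toReal (eLpNorm_egaussian_one_ne_top p)]

/-- Testing the boundedness of the cross-Wigner distribution on Gaussians. -/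
theorem exists_gaussian_bound {g : 𝓢(E, ℂ)} {Φ : 𝓢(WithLp 2 (E × E), ℂ)} (hΦ : Φ ≠ 0)
    {p₁ q₁ p₂ q₂ p q : ℝ≥0∞} (hp₁ : 1 ≤ p₁) (hq₁ : 1 ≤ q₁) (hp₂ : 1 ≤ p₂) (hq₂ : 1 ≤ q₂)
    (hp : 1 ≤ p) (hq : 1 ≤ q)
    (H : ∃ C : ℝ≥0, ∀ f₁ f₂ : 𝓢(E, ℂ), modNorm Φ p q (fun _ _ => 1)
      (crossWigner (toTemperedDistributionCLM E ℂ volume f₁)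
        (toTemperedDistributionCLM E ℂ volume f₂)) ≤
        C * modNorm g p₁ q₁ (fun _ _ => 1) (toTemperedDistributionCLM E ℂ volume f₁) *
          modNorm g p₂ q₂ (fun _ _ => 1) (toTemperedDistributionCLM E ℂ volume f₂)) :
    let D : ℝ≥0∞ → ℝ := fun r => (Module.finrank ℝ E / 2 : ℝ) * (1 / r).toReal
    ∃ C : ℝ, 0 ≤ C ∧ ∀ α β γ δ : ℝ, 0 < α → 0 < β → 0 < γ → 0 < δ → α + γ = 1 → β + δ = 1 →
      (α + β) ^ (-D p) * (γ + δ) ^ (-D p) *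
          ((α * β / (α + β)) ^ (-D q) * (γ * δ / (γ + δ)) ^ (-D q)) ≤
        C * (α ^ (-D p₁) * γ ^ (-D q₁)) * (β ^ (-D p₂) * δ ^ (-D q₂)) := by
  intro D
  obtain ⟨C, hC⟩ := H
  have hg₀ : (gaussian one_pos : 𝓢(E, ℂ)) ≠ 0 := gaussian_ne_zero one_pos
  obtain ⟨C₀, hC₀⟩ := exists_modNorm_le hΦ (wignerSchwartz (gaussian one_pos : 𝓢(E, ℂ)))
    (isModerate_one (E := WithLp 2 (E × E))) hp hq le_rfl le_rfl
  obtain ⟨C₁, hC₁⟩ := exists_modNorm_le hg₀ g isModerate_one hp₁ hq₁ le_rfl le_rfl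
  obtain ⟨C₂, hC₂⟩ := exists_modNorm_le hg₀ g isModerate_one hp₂ hq₂ le_rfl le_rfl
  have hne : ∀ {r : ℝ≥0∞}, 1 ≤ r → r ≠ 0 := fun h => (zero_lt_one.trans_le h).ne'
  set k : ℝ≥0∞ → ℝ := fun r => (eLpNorm (egaussian 1 : E → ℝ≥0∞) r volume).toReal
  have hkpos : ∀ {r : ℝ≥0∞}, 1 ≤ r → 0 < k r := fun h =>
    ENNReal.toReal_pos (eLpNorm_egaussian_one_ne_zero (hne h)) (eLpNorm_egaussian_one_ne_top _)
  have kp := hkpos hp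
  have kq := hkpos hq
  -- The window-change constants and the assumed bound, times the ratio of the norms of the unit
  -- Gaussian left over from the scaling law.
  refine ⟨C₀ * C * C₁ * C₂ * (k p₁ * k q₁ * (k p₂ * k q₂)) / (k p * k p * (k q * k q)), ?_, ?_⟩
  · have := hkpos hp₁
    have := hkpos hq₁
    have := hkpos hp₂
    have := hkpos hq₂
    positivity
  intro α β γ δ hα hβ hγ hδ hαγ hβδ
  -- Every pair with `α + γ = 1` is attained, by the Gaussian with `l = α / γ`.
  have hlam : ∀ {α γ : ℝ}, 0 < γ → α + γ = 1 →
      α / γ / (1 + α / γ) = α ∧ 1 / (1 + α / γ) = γ := by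
    intro α γ hγ h
    have h1 : 1 + α / γ = 1 / γ := by
      field_simp
      linarith
    rw [h1]
    constructor <;> field_simp
  obtain ⟨c₁, hc₁, h₁⟩ := exists_enorm_stft_gaussian (E := E) (div_pos hα hγ)
  obtain ⟨c₂, hc₂, h₂⟩ := exists_enorm_stft_gaussian (E := E) (div_pos hβ hδ)
  rw [(hlam hγ hαγ).1, (hlam hγ hαγ).2] at h₁
  rw [(hlam hδ hβδ).1, (hlam hδ hβδ).2] at h₂
  set f₁ : 𝓢(E, ℂ) := gaussian (div_pos hα hγ)
  set f₂ : 𝓢(E, ℂ) := gaussian (div_pos hβ hδ)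
  have hmain : modNorm (wignerSchwartz (gaussian one_pos : 𝓢(E, ℂ))) p q (fun _ _ => 1)
      (crossWigner (toTemperedDistributionCLM E ℂ volume f₁)
        (toTemperedDistributionCLM E ℂ volume f₂)) ≤
      C₀ * C * C₁ * C₂ * (modNorm (gaussian one_pos) p₁ q₁ (fun _ _ => 1)
        (toTemperedDistributionCLM E ℂ volume f₁) * modNorm (gaussian one_pos) p₂ q₂
          (fun _ _ => 1) (toTemperedDistributionCLM E ℂ volume f₂)) := by
    refine (hC₀ _).trans ((mul_le_mul_right (hC f₁ f₂) _).trans ?_)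
    refine (mul_le_mul_right (mul_le_mul' (mul_le_mul_right (hC₁ _) _) (hC₂ _)) _).trans_eq ?_
    ring
  rw [modNorm_crossWigner_of_enorm_stft_eq hc₁ hc₂ hα hβ hγ hδ (hne hp) (hne hq) h₁ h₂,
    modNorm_of_enorm_stft_eq hc₁ hα (hne hp₁) q₁ h₁,
    modNorm_of_enorm_stft_eq hc₂ hβ (hne hp₂) q₂ h₂] at hmain
  have hcoe : ∀ C : ℝ≥0, (C : ℝ≥0∞) = ENNReal.ofReal C := fun C =>
    (ENNReal.ofReal_coe_nnreal).symm
  have hN : ∀ {a : ℝ}, 0 < a → ∀ r, eLpNorm (egaussian a : E → ℝ≥0∞) r volume =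
      ENNReal.ofReal (a ^ (-D r) * k r) := fun ha r => eLpNorm_egaussian_eq_ofReal ha r
  have hk0 : ∀ r, 0 ≤ k r := fun r => ENNReal.toReal_nonneg
  have k₁ := hk0 p₁
  have k₂ := hk0 q₁
  have k₃ := hk0 p₂
  have k₄ := hk0 q₂
  clear_value D k
  rw [hN (add_pos hα hβ), hN (add_pos hγ hδ), hN (div_pos (mul_pos hα hβ) (add_pos hα hβ)),
    hN (div_pos (mul_pos hγ hδ) (add_pos hγ hδ)), hN hα, hN hγ, hN hβ, hN hδ, hcoe, hcoe, hcoe,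
    hcoe] at hmain
  simp (discharger := positivity) only [← ENNReal.ofReal_mul] at hmain
  rw [ENNReal.ofReal_le_ofReal_iff (by positivity)] at hmain
  rw [div_mul_eq_mul_div, div_mul_eq_mul_div, le_div_iff₀ (by positivity)]
  refine le_of_mul_le_mul_left ?_ (mul_pos hc₁ hc₂)
  refine le_trans (le_of_eq ?_) (hmain.trans (le_of_eq ?_))
  · ring
  · ring

/-- The conditions on the exponents that are necessary for the boundedness of the cross-Wigner
distribution. -/
theorem exponents_of_modNorm_crossWigner_le (hE : 0 < Module.finrank ℝ E) {g : 𝓢(E, ℂ)}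
    {Φ : 𝓢(WithLp 2 (E × E), ℂ)} (hΦ : Φ ≠ 0)
    {p₁ q₁ p₂ q₂ p q : ℝ≥0∞} (hp₁ : 1 ≤ p₁) (hq₁ : 1 ≤ q₁) (hp₂ : 1 ≤ p₂) (hq₂ : 1 ≤ q₂)
    (hp : 1 ≤ p) (hq : 1 ≤ q)
    (H : ∃ C : ℝ≥0, ∀ f₁ f₂ : 𝓢(E, ℂ), modNorm Φ p q (fun _ _ => 1)
      (crossWigner (toTemperedDistributionCLM E ℂ volume f₁)
        (toTemperedDistributionCLM E ℂ volume f₂)) ≤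
        C * modNorm g p₁ q₁ (fun _ _ => 1) (toTemperedDistributionCLM E ℂ volume f₁) *
          modNorm g p₂ q₂ (fun _ _ => 1) (toTemperedDistributionCLM E ℂ volume f₂)) :
    (p₁ ≤ q ∧ q₁ ≤ q ∧ p₂ ≤ q ∧ q₂ ≤ q) ∧
      (p⁻¹ + q⁻¹ ≤ p₁⁻¹ + p₂⁻¹ ∧ p⁻¹ + q⁻¹ ≤ q₁⁻¹ + q₂⁻¹) := by
  obtain ⟨C, hC, h⟩ := exists_gaussian_bound hΦ hp₁ hq₁ hp₂ hq₂ hp hq H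
  have hd : 0 < (Module.finrank ℝ E / 2 : ℝ) := by positivity
  have hD : ∀ r : ℝ≥0∞, 0 ≤ (Module.finrank ℝ E / 2 : ℝ) * (1 / r).toReal := fun r => by
    positivity
  have hfin : ∀ {r : ℝ≥0∞}, 1 ≤ r → r⁻¹ ≠ ∞ := fun h => by
    rw [Ne, ENNReal.inv_eq_top]
    exact (zero_lt_one.trans_le h).ne'
  have hle : ∀ {r r' : ℝ≥0∞}, 1 ≤ r → 1 ≤ r' → (Module.finrank ℝ E / 2 : ℝ) * (1 / r).toReal ≤
      (Module.finrank ℝ E / 2 : ℝ) * (1 / r').toReal → r' ≤ r := by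
    intro r r' hr hr' h
    have h' := le_of_mul_le_mul_left h hd
    rw [one_div, one_div, ENNReal.toReal_le_toReal (hfin hr) (hfin hr')] at h'
    exact ENNReal.inv_le_inv.1 h'
  have hadd : ∀ {r s r' s' : ℝ≥0∞}, 1 ≤ r → 1 ≤ s → 1 ≤ r' → 1 ≤ s' →
      (Module.finrank ℝ E / 2 : ℝ) * (1 / r).toReal +
        (Module.finrank ℝ E / 2 : ℝ) * (1 / s).toReal ≤
      (Module.finrank ℝ E / 2 : ℝ) * (1 / r').toReal +
        (Module.finrank ℝ E / 2 : ℝ) * (1 / s').toReal → r⁻¹ + s⁻¹ ≤ r'⁻¹ + s'⁻¹ := by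
    intro r s r' s' hr hs hr' hs' h
    rw [← mul_add, ← mul_add] at h
    have h' := le_of_mul_le_mul_left h hd
    simp only [one_div] at h'
    rwa [← ENNReal.toReal_add (hfin hr) (hfin hs), ← ENNReal.toReal_add (hfin hr') (hfin hs'),
      ENNReal.toReal_le_toReal (ENNReal.add_ne_top.2 ⟨hfin hr, hfin hs⟩)
        (ENNReal.add_ne_top.2 ⟨hfin hr', hfin hs'⟩)] at h'
  -- The Gaussian inequality is invariant under exchanging position with frequency and `f₁` with
  -- `f₂`, with the exponents permuted accordingly. The four combinations give the four parts of
  -- (1). The two without exchange of functions also give (2).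
  obtain ⟨hx₁, hx⟩ := exponents_of_bound (hD p) (hD q) (hD q₁) (hD q₂) hC h
  obtain ⟨hξ₁, hξ⟩ := exponents_of_bound (hD p) (hD q) (hD p₁) (hD p₂) hC
    fun α β γ δ hα hβ hγ hδ hαγ hβδ => by
      have := h γ δ α β hγ hδ hα hβ (by linarith) (by linarith)
      convert this using 1 <;> ring
  obtain ⟨hx₂, -⟩ := exponents_of_bound (hD p) (hD q) (hD q₂) (hD q₁) hC
    fun α β γ δ hα hβ hγ hδ hαγ hβδ => by
      have := h β α δ γ hβ hα hδ hγ hβδ hαγ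
      rw [add_comm β, add_comm δ, mul_comm β, mul_comm δ] at this
      convert this using 1
      ring
  obtain ⟨hξ₂, -⟩ := exponents_of_bound (hD p) (hD q) (hD p₂) (hD p₁) hC
    fun α β γ δ hα hβ hγ hδ hαγ hβδ => by
      have := h δ γ β α hδ hγ hβ hα (by linarith) (by linarith)
      rw [add_comm β, add_comm δ, mul_comm β, mul_comm δ] at this
      convert this using 1 <;> ring
  exact ⟨⟨hle hq hp₁ hx₁, hle hq hq₁ hξ₁, hle hq hp₂ hx₂, hle hq hq₂ hξ₂⟩,
    hadd hp hq hp₁ hp₂ hx, hadd hp hq hq₁ hq₂ hξ⟩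

end Necessity

end TFA

theorem theorem1p1 (d : ℕ) (hd : 0 < d)
    (g : 𝓢(EuclideanSpace ℝ (Fin d), ℂ)) (hg : g ≠ 0)
    (Φ : 𝓢(WithLp 2 (EuclideanSpace ℝ (Fin d) × EuclideanSpace ℝ (Fin d)), ℂ)) (hΦ : Φ ≠ 0)
    (p₁ q₁ p₂ q₂ p q : ℝ≥0∞) (hp₁ : 1 ≤ p₁) (hq₁ : 1 ≤ q₁) (hp₂ : 1 ≤ p₂) (hq₂ : 1 ≤ q₂)
    (hp : 1 ≤ p) (hq : 1 ≤ q) :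
    (∀ s : ℝ, (p₁ ≤ q ∧ q₁ ≤ q ∧ p₂ ≤ q ∧ q₂ ≤ q) →
      (p⁻¹ + q⁻¹ ≤ p₁⁻¹ + p₂⁻¹ ∧ p⁻¹ + q⁻¹ ≤ q₁⁻¹ + q₂⁻¹) →
      ∃ C : ℝ≥0, ∀ f₁ ∈ TFA.modulationSpace g p₁ q₁ (TFA.phaseWeight |s|),
        ∀ f₂ ∈ TFA.modulationSpace g p₂ q₂ (TFA.phaseWeight s),
          TFA.crossWigner f₁ f₂ ∈ TFA.modulationSpace Φ p q (TFA.freqWeight s) ∧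
          TFA.modNorm Φ p q (TFA.freqWeight s) (TFA.crossWigner f₁ f₂) ≤
            C * TFA.modNorm g p₁ q₁ (TFA.phaseWeight |s|) f₁ *
              TFA.modNorm g p₂ q₂ (TFA.phaseWeight s) f₂) ∧
    ((∃ C : ℝ≥0, ∀ f₁ f₂ : 𝓢(EuclideanSpace ℝ (Fin d), ℂ),
        TFA.modNorm Φ p q (fun _ _ => 1)
            (TFA.crossWigner (toTemperedDistributionCLM _ ℂ volume f₁)
              (toTemperedDistributionCLM _ ℂ volume f₂)) ≤
          C * TFA.modNorm g p₁ q₁ (fun _ _ => 1) (toTemperedDistributionCLM _ ℂ volume f₁) *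
            TFA.modNorm g p₂ q₂ (fun _ _ => 1) (toTemperedDistributionCLM _ ℂ volume f₂)) →
      (p₁ ≤ q ∧ q₁ ≤ q ∧ p₂ ≤ q ∧ q₂ ≤ q) ∧
      (p⁻¹ + q⁻¹ ≤ p₁⁻¹ + p₂⁻¹ ∧ p⁻¹ + q⁻¹ ≤ q₁⁻¹ + q₂⁻¹)) := by
  refine ⟨fun s h₁ h₂ => ?_, fun H => ?_⟩
  · obtain ⟨C, hC⟩ := TFA.exists_modNorm_crossWigner_le hg Φ s hp₁ hq₁ hp₂ hq₂ hp hq h₁ h₂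
    refine ⟨C, fun f₁ hf₁ f₂ hf₂ => ⟨(hC f₁ f₂).trans_lt ?_, hC f₁ f₂⟩⟩
    exact ENNReal.mul_lt_top (ENNReal.mul_lt_top ENNReal.coe_lt_top hf₁) hf₂
  · exact TFA.exponents_of_modNorm_crossWigner_le (by simpa using hd) hΦ hp₁ hq₁ hp₂ hq₂ hp hq H
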